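/- Let $\mathcal V$ be a complete and cocomplete symmetric monoidal closed category, with unit $I$ and internal hom $[-,-]$, equipped with a model structure which satisfies the pushout-product axiom (a monoidal model category) and for which $I$ is cofibrant, and suppose that the ordinary category $\mathcal V_0$ is locally presentable. For a small $\mathcal V$-category $\mathcal D$, write $[\mathcal D,\mathcal V]$ for the $\mathcal V$-category of $\mathcal V$-functors $\mathcal D\to\mathcal V$, and $\mathcal I$ for the unit $\mathcal V$-category (one object, with hom-object $I$). Definitions. * An *interval* is an object $J$ of $\mathcal V$ with maps $d,c\colon I\to J$ and $e\colon J\to I$ such that $ed=ec=1_I$, the map $(d\ c)\colon I+I\to J$ is a cofibration and $e$ is a weak equivalence. A morphism $f\colon A\to B$ of $\mathcal V$ is *shrinkable* if there are $s\colon B\to A$ with $fs=1_B$, an interval $(J,d,c,e)$, and $h\colon J\to[A,A]$ such that $hd$ and $hc$ are the maps $I\to[A,A]$ corresponding to $sf$ and $1_A$, and $[A,f]\circ h$ is the composite of $e$ with the map $I\to[A,B]$ corresponding to $f$. Write $\mathcal E$ for the class of shrinkable morphisms of $\mathcal V$, regarded as a full sub-$\mathcal V$-category of the $\mathcal V$-category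 $\mathcal V^{\mathbf 2}$ of arrows of $\mathcal V$. * For a weight $W\colon\mathcal D\to\mathcal V$ with $\mathcal D$ small, $W$-weighted limits are *$\mathcal E$-stable* if $\mathcal E$ is closed in $\mathcal V^{\mathbf 2}$ under $W$-weighted limits. A $\mathcal V$-category has *$\mathcal E$-stable limits* if it has $W$-weighted limits for every such $W$ for which $W$-weighted limits are $\mathcal E$-stable. * A weight $Q\colon\mathcal D\to\mathcal V$ is *cofibrant* if, for each $\mathcal V$-natural transformation $p\colon F\to G$ in $[\mathcal D,\mathcal V]$ which is pointwise a trivial fibration, $[\mathcal D,\mathcal V](Q,p)$ is a trivial fibration in $\mathcal V$. A $\mathcal V$-category $\mathcal B$ has *enough cofibrantly-weighted limits* if for each small $\mathcal V$-category $\mathcal D$ and each $\mathcal V$-functor $P\colon\mathcal D\to\mathcal I$ there are a cofibrant weight $Q\colon\mathcal D\to\mathcal V$ and a pointwise trivial fibration from $Q$ to the composite $\mathcal D\xrightarrow{P}\mathcal I\xrightarrow{I}\mathcal V$, where $I$ selects the unit object, such that $\mathcal B$ has $Q$-weighted limits. Shrinkable morphisms are *closed in $\mathcal V^{\mathbf 2}$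 under enough cofibrantly-weighted limits* if for each such $\mathcal D$ and $P$ there are such a $Q$ and such a pointwise trivial fibration for which $Q$-weighted limits are $\mathcal E$-stable. * A $\mathcal V$-category $\mathcal C$ has *$\mathcal E$-weak colimits* if for each small $\mathcal V$-category $\mathcal D$, each weight $W\colon\mathcal D^{\mathrm{op}}\to\mathcal V$ and each $\mathcal V$-functor $S\colon\mathcal D\to\mathcal C$ there are an object $c$ of $\mathcal C$ and a $\mathcal V$-natural transformation $\eta\colon W\to\mathcal C(S-,c)$ such that for all $a\in\mathcal C$ the induced map $\mathcal C(c,a)\to[\mathcal D^{\mathrm{op}},\mathcal V](W,\mathcal C(S-,a))$ is shrinkable. * A *conical colimit* in $\mathcal C$ is a colimit in the underlying ordinary category $\mathcal C_0$ which each $\mathcal C(-,c)$ sends to a limit in $\mathcal V_0$. For a regular cardinal $\lambda$, an object $A$ of $\mathcal C$ is *$\lambda$-presentable* if $\mathcal C(A,-)\colon\mathcal C\to\mathcal V$ preserves conical $\lambda$-filtered colimits, and $\mathcal C$ is *$\lambda$-accessible* if it has conical $\lambda$-filtered colimits and a (small) set of $\lambda$-presentable objects such that every object is a conical $\lambda$-filtered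 colimit of objects in this set. $\mathcal C$ is *accessible* if it is $\lambda$-accessible for some regular cardinal $\lambda\ge\lambda_0$, where $\lambda_0$ is a regular cardinal such that $\mathcal V_0$ is locally $\lambda_0$-presentable, $I$ is $\lambda_0$-presentable in $\mathcal V_0$, and $\lambda_0$-presentable objects of $\mathcal V_0$ are closed under $\otimes$. Theorem. Suppose that the shrinkable morphisms in $\mathcal V$ are closed in $\mathcal V^{\mathbf 2}$ under enough cofibrantly-weighted limits, and let $\mathcal C$ be an accessible $\mathcal V$-category. Then the following are equivalent: 1. $\mathcal C$ has $\mathcal E$-stable limits; 2. $\mathcal C$ has powers by all objects of $\mathcal V$ and enough cofibrantly-weighted limits; 3. $\mathcal C$ has $\mathcal E$-weak colimits. -/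

import Mathlib

noncomputable section

namespace HEnriched

open CategoryTheory Category Limits MonoidalCategory HomotopicalAlgebra Opposite
open scoped CategoryTheory.MonoidalClosed

universe v u u₁ u₂ u₃

set_option linter.unusedSectionVars false

/-! ### Composition of hom-objects -/

lemma eHomWhiskerLeft_eComp {V : Type u} [Category.{v} V] [MonoidalCategory V]
    {B : Type u₂} [Category.{v} B] [EnrichedOrdinaryCategory V B]
    (X : B) {Y Y' : B} (g : Y ⟶ Y') (Z : B) :
    eHomWhiskerLeft V X g ▷ _ ≫ eComp V X Y' Z =
      _ ◁ eHomWhiskerRight V g Z ≫ eComp V X Y Z := by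
  simp only [eHomWhiskerLeft, eHomWhiskerRight, MonoidalCategory.whiskerLeft_comp_assoc,
    comp_whiskerRight_assoc]
  rw [← e_assoc, ← e_assoc']
  simp

/-! ### Monoidal model categories -/

/-- The pushout-product axiom for a model structure on a monoidal category. -/
class PushoutProductAxiom (V : Type u) [Category.{v} V] [MonoidalCategory V]
    [ModelCategory V] : Prop where
  cofibration {A B X Y : V} (i : A ⟶ B) (j : X ⟶ Y) (hi : Cofibration i) (hj : Cofibration j) :
    Cofibration
      ((MonoidalCategory.Arrow.pushoutProduct.obj (Arrow.mk i)).obj (Arrow.mk j)).hom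
  weakEquivalence {A B X Y : V} (i : A ⟶ B) (j : X ⟶ Y)
    (hi : Cofibration i) (hj : Cofibration j) (hw : WeakEquivalence i ∨ WeakEquivalence j) :
    WeakEquivalence
      ((MonoidalCategory.Arrow.pushoutProduct.obj (Arrow.mk i)).obj (Arrow.mk j)).hom

/-! ### The object of `V`-natural transformations -/

section NatObj

variable {V : Type u} [Category.{v} V] [MonoidalCategory V] [SymmetricCategory V]
  [MonoidalClosed V] [HasLimits V]
variable {D : Type v} [EnrichedCategory V D] {B : Type u₁} [EnrichedCategory V B]

/-- `(F x ⟶ F y) ⊗ (F y ⟶ G y) ⟶ (F x ⟶ G y)`, as a map out of the product of all `B(Fx, Gx)`. -/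
def natObjFst (F G : EnrichedFunctor V D B) :
    (∏ᶜ fun x : D => (EnrichedCategory.Hom (F.obj x) (G.obj x) : V)) ⟶
      ∏ᶜ fun p : D × D => (ihom (EnrichedCategory.Hom p.1 p.2 : V)).obj
        (EnrichedCategory.Hom (F.obj p.1) (G.obj p.2) : V) :=
  Pi.lift fun p => MonoidalClosed.curry
    ((F.map p.1 p.2 ⊗ₘ Pi.π (fun x : D => (EnrichedCategory.Hom (F.obj x) (G.obj x) : V)) p.2) ≫
      eComp V (F.obj p.1) (F.obj p.2) (G.obj p.2))

/-- `(F x ⟶ G x) ⊗ (G x ⟶ G y) ⟶ (F x ⟶ G y)`, as a map out of the product of all `B(Fx, Gx)`. -/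
def natObjSnd (F G : EnrichedFunctor V D B) :
    (∏ᶜ fun x : D => (EnrichedCategory.Hom (F.obj x) (G.obj x) : V)) ⟶
      ∏ᶜ fun p : D × D => (ihom (EnrichedCategory.Hom p.1 p.2 : V)).obj
        (EnrichedCategory.Hom (F.obj p.1) (G.obj p.2) : V) :=
  Pi.lift fun p => MonoidalClosed.curry
    ((β_ _ _).hom ≫
      (Pi.π (fun x : D => (EnrichedCategory.Hom (F.obj x) (G.obj x) : V)) p.1 ⊗ₘ
        G.map p.1 p.2) ≫
      eComp V (F.obj p.1) (G.obj p.1) (G.obj p.2))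

/-- The hom-object `[D, B](F, G)`, i.e. the end of `B(F-, G-)` computed in `V`. -/
def natObj (F G : EnrichedFunctor V D B) : V :=
  equalizer (natObjFst F G) (natObjSnd F G)

/-- The component `[D, B](F, G) ⟶ B(Fx, Gx)`. -/
def natObjπ (F G : EnrichedFunctor V D B) (x : D) :
    natObj F G ⟶ (EnrichedCategory.Hom (F.obj x) (G.obj x) : V) :=
  equalizer.ι _ _ ≫ Pi.π (fun x : D => (EnrichedCategory.Hom (F.obj x) (G.obj x) : V)) x

lemma natObjπ_condition (F G : EnrichedFunctor V D B) (x y : D) :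
    (F.map x y ⊗ₘ natObjπ F G y) ≫ eComp V (F.obj x) (F.obj y) (G.obj y) =
      (β_ _ _).hom ≫ (natObjπ F G x ⊗ₘ G.map x y) ≫
        eComp V (F.obj x) (G.obj x) (G.obj y) := by
  have h := equalizer.condition (natObjFst F G) (natObjSnd F G) =≫ Pi.π _ (x, y)
  rw [Category.assoc, Category.assoc, natObjFst, natObjSnd, Pi.lift_π, Pi.lift_π,
    ← MonoidalClosed.curry_natural_left, ← MonoidalClosed.curry_natural_left] at h
  replace h := MonoidalClosed.curry_injective h
  rw [BraidedCategory.braiding_naturality_right_assoc, whiskerLeft_comp_tensorHom_assoc,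
    whiskerRight_comp_tensorHom_assoc] at h
  exact h

/-- The universal property of `[D, B](F, G)`. -/
def natObjLift (F G : EnrichedFunctor V D B) {T : V}
    (φ : ∀ x, T ⟶ (EnrichedCategory.Hom (F.obj x) (G.obj x) : V))
    (hφ : ∀ x y, (F.map x y ⊗ₘ φ y) ≫ eComp V (F.obj x) (F.obj y) (G.obj y) =
      (β_ _ _).hom ≫ (φ x ⊗ₘ G.map x y) ≫ eComp V (F.obj x) (G.obj x) (G.obj y)) :
    T ⟶ natObj F G :=
  equalizer.lift (Pi.lift φ) (by
    refine Pi.hom_ext _ _ fun p => ?_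
    rw [Category.assoc, Category.assoc, natObjFst, natObjSnd, Pi.lift_π, Pi.lift_π,
      ← MonoidalClosed.curry_natural_left, ← MonoidalClosed.curry_natural_left,
      BraidedCategory.braiding_naturality_right_assoc, whiskerLeft_comp_tensorHom_assoc,
      whiskerRight_comp_tensorHom_assoc, Pi.lift_π, Pi.lift_π, hφ])

@[simp]
lemma natObjLift_π (F G : EnrichedFunctor V D B) {T : V}
    (φ : ∀ x, T ⟶ (EnrichedCategory.Hom (F.obj x) (G.obj x) : V)) (hφ) (x : D) :
    natObjLift F G φ hφ ≫ natObjπ F G x = φ x := by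
  unfold natObjLift natObjπ
  exact (equalizer.lift_ι_assoc _ _ _).trans (Pi.lift_π _ _)

lemma natObj_hom_ext (F G : EnrichedFunctor V D B) {T : V} {f g : T ⟶ natObj F G}
    (h : ∀ x, f ≫ natObjπ F G x = g ≫ natObjπ F G x) : f = g := by
  refine equalizer.hom_ext (Pi.hom_ext _ _ fun x => ?_)
  exact ((Category.assoc _ _ _).trans (h x)).trans (Category.assoc _ _ _).symm

end NatObj

/-! ### Weights, `V`-natural transformations, representables -/

section Weights

variable (V : Type u) [Category.{v} V] [MonoidalCategory V] [SymmetricCategory V]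
  [MonoidalClosed V]

/-- A weight: a `V`-functor from `D` to `V`. -/
abbrev Weight (D : Type u₁) [EnrichedCategory V D] := EnrichedFunctor V D V

variable {V}

/-- `V`-natural transformations `F ⟶ G` between `V`-functors `D → V`: the naturality square is
required on the level of hom-objects, not just on the level of underlying morphisms. -/
structure VNatTrans {D : Type u₁} [EnrichedCategory V D] (F G : Weight V D) where
  app (x : D) : F.obj x ⟶ G.obj x
  naturality (x y : D) :
    F.map x y ≫ eHomWhiskerLeft V (F.obj x) (app y) =
      G.map x y ≫ eHomWhiskerRight V (app x) (G.obj y)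

variable {C : Type u₁} [EnrichedCategory V C]

lemma uncurry_tensorHom_comp {a b c P Q : V} (f : P ⟶ (ihom a).obj b) (g : Q ⟶ (ihom b).obj c) :
    MonoidalClosed.uncurry ((f ⊗ₘ g) ≫ MonoidalClosed.comp a b c) =
      (α_ _ _ _).inv ≫ MonoidalClosed.uncurry f ▷ Q ≫ MonoidalClosed.uncurry g := by
  have h : MonoidalClosed.comp a b c = MonoidalClosed.curry (MonoidalClosed.compTranspose a b c) := rfl
  rw [h, ← MonoidalClosed.curry_natural_left, MonoidalClosed.uncurry_curry,
    MonoidalClosed.compTranspose_eq, MonoidalClosed.uncurry_eq, MonoidalClosed.uncurry_eq,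
    comp_whiskerRight, Category.assoc, ← whisker_exchange_assoc]
  simp [MonoidalCategory.tensorHom_def]

/-- The `V`-functor `C(X, -) : C → V`. -/
def corep (X : C) : Weight V C where
  obj Y := (EnrichedCategory.Hom X Y : V)
  map Y Z := MonoidalClosed.curry (eComp V X Y Z)
  map_id Y := by
    apply MonoidalClosed.uncurry_injective
    rw [← MonoidalClosed.curry_natural_left, MonoidalClosed.uncurry_curry]
    have h : eId V (EnrichedCategory.Hom X Y : V) = MonoidalClosed.curry (ρ_ _).hom := rfl
    rw [h, MonoidalClosed.uncurry_curry]
    have := e_comp_id V X Y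
    rw [Iso.inv_comp_eq] at this
    simpa using this
  map_comp Y Z T := by
    apply MonoidalClosed.uncurry_injective
    have h : eComp V (EnrichedCategory.Hom X Y : V) (EnrichedCategory.Hom X Z : V)
      (EnrichedCategory.Hom X T : V) = MonoidalClosed.comp _ _ _ := rfl
    rw [h, uncurry_tensorHom_comp, ← MonoidalClosed.curry_natural_left,
      MonoidalClosed.uncurry_curry, MonoidalClosed.uncurry_curry, MonoidalClosed.uncurry_curry,
      e_assoc]

/-- The opposite of a `V`-functor. -/
def opFunctor {D : Type u₂} [EnrichedCategory V D] (S : EnrichedFunctor V D C) :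
    EnrichedFunctor V Dᵒᵖ Cᵒᵖ where
  obj x := op (S.obj x.unop)
  map x y := S.map y.unop x.unop
  map_id x := S.map_id x.unop
  map_comp x y z := by
    rw [eComp_op_eq, Category.assoc]
    erw [S.map_comp]
    rw [← BraidedCategory.braiding_naturality_assoc]
    rfl

end Weights

/-! ### Weighted limits -/

section WeightedLimits

variable {V : Type u} [Category.{v} V] [MonoidalCategory V] [SymmetricCategory V]
  [MonoidalClosed V] [HasLimits V]
variable {D : Type v} [EnrichedCategory V D] {C : Type u₁} [EnrichedCategory V C]

/-- The map `[D, V](Q, p) : [D, V](Q, F) ⟶ [D, V](Q, G)` induced by a `V`-natural transformation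
`p : F ⟶ G`. -/
def natObjMap (Q : Weight V D) {F G : Weight V D} (p : VNatTrans F G) :
    natObj Q F ⟶ natObj Q G :=
  natObjLift Q G (fun x => natObjπ Q F x ≫ eHomWhiskerLeft V (Q.obj x) (p.app x)) (by
    intro x y
    rw [← tensorHom_comp_whiskerLeft_assoc, ← eComp_eHomWhiskerLeft,
      reassoc_of% natObjπ_condition Q F x y, eComp_eHomWhiskerLeft,
      tensorHom_comp_whiskerLeft_assoc, p.naturality, ← tensorHom_comp_whiskerLeft_assoc,
      ← eHomWhiskerLeft_eComp, tensorHom_comp_whiskerRight_assoc])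

lemma comparison_aux {a b d : V} {L Sx Sy : C} (w : d ⟶ (ihom a).obj b)
    (s : d ⟶ (EnrichedCategory.Hom Sx Sy : V)) (ηx : a ⟶ (EnrichedCategory.Hom L Sx : V))
    (ηy : b ⟶ (EnrichedCategory.Hom L Sy : V))
    (hη : w ≫ eHomWhiskerLeft V a ηy =
      (s ≫ MonoidalClosed.curry (eComp V L Sx Sy)) ≫
        eHomWhiskerRight V ηx (EnrichedCategory.Hom L Sy : V)) (X : C) :
    (w ⊗ₘ MonoidalClosed.curry
        ((β_ _ _).hom ≫ (EnrichedCategory.Hom X L : V) ◁ ηy ≫ eComp V X L Sy)) ≫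
        MonoidalClosed.comp a b (EnrichedCategory.Hom X Sy : V) =
      (β_ d (EnrichedCategory.Hom X L : V)).hom ≫
        (MonoidalClosed.curry
            ((β_ _ _).hom ≫ (EnrichedCategory.Hom X L : V) ◁ ηx ≫ eComp V X L Sx) ⊗ₘ
          (s ≫ MonoidalClosed.curry (eComp V X Sx Sy))) ≫
          MonoidalClosed.comp a (EnrichedCategory.Hom X Sx : V)
            (EnrichedCategory.Hom X Sy : V) := by
  have hη' : MonoidalClosed.uncurry w ≫ ηy = (ηx ⊗ₘ s) ≫ eComp V L Sx Sy := by
    have h := congrArg MonoidalClosed.uncurry hη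
    rw [MonoidalClosed.enrichedOrdinaryCategorySelf_eHomWhiskerLeft,
      MonoidalClosed.enrichedOrdinaryCategorySelf_eHomWhiskerRight,
      MonoidalClosed.uncurry_natural_right, MonoidalClosed.uncurry_pre_app,
      MonoidalClosed.uncurry_natural_left, MonoidalClosed.uncurry_curry] at h
    rw [h, MonoidalCategory.tensorHom_def, Category.assoc]
  apply MonoidalClosed.uncurry_injective
  rw [uncurry_tensorHom_comp, MonoidalClosed.uncurry_natural_left, uncurry_tensorHom_comp,
    MonoidalClosed.uncurry_curry, MonoidalClosed.uncurry_curry,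
    MonoidalClosed.uncurry_natural_left, MonoidalClosed.uncurry_curry,
    ← BraidedCategory.braiding_naturality_left_assoc, ← comp_whiskerRight_assoc, hη',
    BraidedCategory.braiding_naturality_left_assoc, MonoidalCategory.whiskerLeft_comp_assoc,
    ← e_assoc]
  simp [MonoidalCategory.tensorHom_def, ← whisker_exchange_assoc]

/-- The component at `d` of the comparison map: the transpose of
`W d ⊗ C(X, L) ⟶ C(X, L) ⊗ C(L, S d) ⟶ C(X, S d)`. -/
def comparisonApp {W : Weight V D} {S : EnrichedFunctor V D C} {L : C}
    (η : VNatTrans W (S.comp V (corep L))) (X : C) (d : D) :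
    (EnrichedCategory.Hom X L : V) ⟶
      (ihom (W.obj d)).obj (EnrichedCategory.Hom X (S.obj d) : V) :=
  MonoidalClosed.curry
    ((β_ _ _).hom ≫ (EnrichedCategory.Hom X L : V) ◁ η.app d ≫ eComp V X L (S.obj d))

/-- The map `C(X, L) ⟶ [D, V](W, C(X, S-))` induced by `η : W ⟶ C(L, S-)`. -/
def comparison {W : Weight V D} {S : EnrichedFunctor V D C} {L : C}
    (η : VNatTrans W (S.comp V (corep L))) (X : C) :
    (EnrichedCategory.Hom X L : V) ⟶ natObj W (S.comp V (corep X)) :=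
  natObjLift W (S.comp V (corep X)) (comparisonApp η X) fun x y =>
    comparison_aux (W.map x y) (S.map x y) (η.app x) (η.app y) (η.naturality x y) X

end WeightedLimits

section Notions

variable (V : Type u) [Category.{v} V] [MonoidalCategory V] [SymmetricCategory V]
  [MonoidalClosed V] [HasLimits V]

section

variable {V} {D : Type v} [EnrichedCategory V D] {C : Type u₁} [EnrichedCategory V C]

/-- `η : W ⟶ C(L, S-)` exhibits `L` as the limit of `S` weighted by `W`. -/
def IsWeightedLimit {W : Weight V D} {S : EnrichedFunctor V D C} {L : C}
    (η : VNatTrans W (S.comp V (corep L))) : Prop :=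
  ∀ X : C, IsIso (comparison η X)

/-- `C` has all limits weighted by `W`. -/
def HasWeightedLimits (C : Type u₁) [EnrichedCategory V C] (W : Weight V D) : Prop :=
  ∀ S : EnrichedFunctor V D C,
    ∃ (L : C) (η : VNatTrans W (S.comp V (corep L))), IsWeightedLimit η

end

/-- `C` has powers: for all `X : V` and `c : C` there are `P : C` and `κ : X ⟶ C(P, c)` inducing
isomorphisms `C(B, P) ≅ [X, C(B, c)]`. -/
def HasPowers (C : Type u₁) [EnrichedCategory V C] : Prop :=
  ∀ (X : V) (c : C), ∃ (P : C) (κ : X ⟶ (EnrichedCategory.Hom P c : V)),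
    ∀ B : C, IsIso (MonoidalClosed.curry
      ((β_ X (EnrichedCategory.Hom B P : V)).hom ≫
        (EnrichedCategory.Hom B P : V) ◁ κ ≫ eComp V B P c))

end Notions

/-! ### The arrow category as a `V`-category -/

section Arrow

variable (V : Type u) [Category.{v} V] [MonoidalCategory V] [HasPullbacks V]
variable {C : Type u₁} [Category.{v} C] [EnrichedOrdinaryCategory V C]

/-- The hom-object of arrows `f ⟶ g`, i.e. the pullback of
`C(A, A') ⟶ C(A, B') ⟵ C(B, B')` for `f : A ⟶ B` and `g : A' ⟶ B'`. -/
def arrowHom (f g : Arrow C) : V :=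
  pullback (eHomWhiskerLeft V f.left g.hom) (eHomWhiskerRight V f.hom g.right)

/-- The component `C^𝟚(f, g) ⟶ C(A, A')` at the domains. -/
def arrowHomLeft (f g : Arrow C) :
    arrowHom V f g ⟶ (EnrichedCategory.Hom f.left g.left : V) := pullback.fst _ _

/-- The component `C^𝟚(f, g) ⟶ C(B, B')` at the codomains. -/
def arrowHomRight (f g : Arrow C) :
    arrowHom V f g ⟶ (EnrichedCategory.Hom f.right g.right : V) := pullback.snd _ _

lemma arrowHom_condition (f g : Arrow C) :
    arrowHomLeft V f g ≫ eHomWhiskerLeft V f.left g.hom =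
      arrowHomRight V f g ≫ eHomWhiskerRight V f.hom g.right := pullback.condition

/-- The universal property of the hom-object of arrows. -/
def arrowHomLift {f g : Arrow C} {T : V} (l : T ⟶ (EnrichedCategory.Hom f.left g.left : V))
    (r : T ⟶ (EnrichedCategory.Hom f.right g.right : V))
    (h : l ≫ eHomWhiskerLeft V f.left g.hom = r ≫ eHomWhiskerRight V f.hom g.right) :
    T ⟶ arrowHom V f g := pullback.lift l r h

@[simp]
lemma arrowHomLift_left {f g : Arrow C} {T : V}
    (l : T ⟶ (EnrichedCategory.Hom f.left g.left : V))
    (r : T ⟶ (EnrichedCategory.Hom f.right g.right : V)) (h) :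
    arrowHomLift V l r h ≫ arrowHomLeft V f g = l := pullback.lift_fst _ _ _

@[simp]
lemma arrowHomLift_right {f g : Arrow C} {T : V}
    (l : T ⟶ (EnrichedCategory.Hom f.left g.left : V))
    (r : T ⟶ (EnrichedCategory.Hom f.right g.right : V)) (h) :
    arrowHomLift V l r h ≫ arrowHomRight V f g = r := pullback.lift_snd _ _ _

lemma arrowHom_ext {f g : Arrow C} {T : V} {a b : T ⟶ arrowHom V f g}
    (h₁ : a ≫ arrowHomLeft V f g = b ≫ arrowHomLeft V f g)
    (h₂ : a ≫ arrowHomRight V f g = b ≫ arrowHomRight V f g) : a = b :=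
  pullback.hom_ext h₁ h₂

/-- The identity of an arrow in the `V`-category of arrows. -/
def arrowId (f : Arrow C) : 𝟙_ V ⟶ arrowHom V f f :=
  arrowHomLift V (eId V f.left) (eId V f.right) (by
    have h₁ : eId V f.left ≫ eHomWhiskerLeft V f.left f.hom = eHomEquiv V f.hom := by
      rw [← eHomEquiv_id, ← Category.id_comp f.hom, eHomEquiv_comp, eHomWhiskerLeft]
      simp [MonoidalCategory.tensorHom_def, unitors_inv_equal]
    have h₂ : eId V f.right ≫ eHomWhiskerRight V f.hom f.right = eHomEquiv V f.hom := by
      rw [← eHomEquiv_id, ← Category.comp_id f.hom, eHomEquiv_comp, eHomWhiskerRight]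
      simp [MonoidalCategory.tensorHom_def']
    rw [h₁, h₂])

/-- Composition in the `V`-category of arrows. -/
def arrowComp (f g h : Arrow C) : arrowHom V f g ⊗ arrowHom V g h ⟶ arrowHom V f h :=
  arrowHomLift V
    ((arrowHomLeft V f g ⊗ₘ arrowHomLeft V g h) ≫ eComp V f.left g.left h.left)
    ((arrowHomRight V f g ⊗ₘ arrowHomRight V g h) ≫ eComp V f.right g.right h.right) (by
      rw [Category.assoc, Category.assoc, eComp_eHomWhiskerLeft, eComp_eHomWhiskerRight,
        tensorHom_comp_whiskerLeft_assoc, tensorHom_comp_whiskerRight_assoc,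
        arrowHom_condition, ← arrowHom_condition V f g,
        ← tensorHom_comp_whiskerLeft_assoc, ← tensorHom_comp_whiskerRight_assoc,
        eHomWhiskerLeft_eComp])

lemma arrowComp_left (f g h : Arrow C) :
    arrowComp V f g h ≫ arrowHomLeft V f h =
      (arrowHomLeft V f g ⊗ₘ arrowHomLeft V g h) ≫ eComp V f.left g.left h.left :=
  arrowHomLift_left _ _ _ _

lemma arrowComp_right (f g h : Arrow C) :
    arrowComp V f g h ≫ arrowHomRight V f h =
      (arrowHomRight V f g ⊗ₘ arrowHomRight V g h) ≫ eComp V f.right g.right h.right :=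
  arrowHomLift_right _ _ _ _

lemma arrowId_left (f : Arrow C) : arrowId V f ≫ arrowHomLeft V f f = eId V f.left :=
  arrowHomLift_left _ _ _ _

lemma arrowId_right (f : Arrow C) : arrowId V f ≫ arrowHomRight V f f = eId V f.right :=
  arrowHomLift_right _ _ _ _

/-- The `V`-category of arrows of `C`. For `C = V` this is the power of `V` by the arrow category. -/
instance arrowEnriched : EnrichedCategory V (Arrow C) where
  Hom f g := arrowHom V f g
  id f := arrowId V f
  comp f g h := arrowComp V f g h
  id_comp f g := by
    apply arrowHom_ext
    · rw [Category.assoc, Category.assoc, arrowComp_left, whiskerRight_comp_tensorHom_assoc,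
        arrowId_left, MonoidalCategory.tensorHom_def', Category.assoc,
        ← leftUnitor_inv_naturality_assoc, e_id_comp, Category.id_comp, Category.comp_id]
    · rw [Category.assoc, Category.assoc, arrowComp_right, whiskerRight_comp_tensorHom_assoc,
        arrowId_right, MonoidalCategory.tensorHom_def', Category.assoc,
        ← leftUnitor_inv_naturality_assoc, e_id_comp, Category.id_comp, Category.comp_id]
  comp_id f g := by
    apply arrowHom_ext
    · rw [Category.assoc, Category.assoc, arrowComp_left, whiskerLeft_comp_tensorHom_assoc,
        arrowId_left, MonoidalCategory.tensorHom_def, Category.assoc,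
        ← rightUnitor_inv_naturality_assoc, e_comp_id, Category.id_comp, Category.comp_id]
    · rw [Category.assoc, Category.assoc, arrowComp_right, whiskerLeft_comp_tensorHom_assoc,
        arrowId_right, MonoidalCategory.tensorHom_def, Category.assoc,
        ← rightUnitor_inv_naturality_assoc, e_comp_id, Category.id_comp, Category.comp_id]
  assoc f g h k := by
    apply arrowHom_ext
    · rw [Category.assoc, Category.assoc, Category.assoc, arrowComp_left, arrowComp_left,
        whiskerRight_comp_tensorHom_assoc, whiskerLeft_comp_tensorHom_assoc, arrowComp_left,
        arrowComp_left, ← tensorHom_comp_whiskerRight_assoc, ← tensorHom_comp_whiskerLeft_assoc,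
        ← e_assoc, ← associator_inv_naturality_assoc]
    · rw [Category.assoc, Category.assoc, Category.assoc, arrowComp_right, arrowComp_right,
        whiskerRight_comp_tensorHom_assoc, whiskerLeft_comp_tensorHom_assoc, arrowComp_right,
        arrowComp_right, ← tensorHom_comp_whiskerRight_assoc, ← tensorHom_comp_whiskerLeft_assoc,
        ← e_assoc, ← associator_inv_naturality_assoc]

end Arrow

/-! ### The unit `V`-category -/

section Unit

variable (V : Type u) [Category.{v} V] [MonoidalCategory V]

/-- The type of objects of the unit `V`-category: a single object. -/
inductive UnitCat (V : Type u) : Type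
  | star : UnitCat V

/-- The unit `V`-category, with one object whose endomorphism object is the unit of `V`. -/
instance unitCatEnriched : EnrichedCategory V (UnitCat V) where
  Hom _ _ := 𝟙_ V
  id _ := 𝟙 _
  comp _ _ _ := (λ_ (𝟙_ V)).hom
  id_comp _ _ := by simp
  comp_id _ _ := by simp [unitors_equal]
  assoc _ _ _ _ := by simp [unitors_equal]

/-- The `V`-functor from the unit `V`-category to `V` selecting the unit object of `V`. -/
def unitFunctor [MonoidalClosed V] : Weight V (UnitCat V) where
  obj _ := 𝟙_ V
  map _ _ := eId V (𝟙_ V)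
  map_id _ := Category.id_comp _
  map_comp _ _ _ := by
    change (λ_ (𝟙_ V)).hom ≫ eId V (𝟙_ V) =
      ((eId V (𝟙_ V) ⊗ₘ eId V (𝟙_ V)) : 𝟙_ V ⊗ 𝟙_ V ⟶ _) ≫ eComp V (𝟙_ V) (𝟙_ V) (𝟙_ V)
    rw [← Iso.eq_inv_comp, MonoidalCategory.tensorHom_def', Category.assoc,
      ← leftUnitor_inv_naturality_assoc, e_id_comp, Category.comp_id]

end Unit

/-! ### Intervals, shrinkable morphisms, cofibrant weights -/

section Model

variable (V : Type u) [Category.{v} V] [MonoidalCategory V] [ModelCategory V]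

/-- An interval in `V`: a factorisation of the codiagonal of the unit object as a cofibration
`(d c)` followed by a weak equivalence `e`. -/
structure Interval where
  J : V
  d : 𝟙_ V ⟶ J
  c : 𝟙_ V ⟶ J
  e : J ⟶ 𝟙_ V
  d_e : d ≫ e = 𝟙 _
  c_e : c ≫ e = 𝟙 _
  cofibration : Cofibration (coprod.desc d c)
  weakEquivalence : WeakEquivalence e

/-- A morphism `f : A ⟶ B` of (the underlying category of) a `V`-category is shrinkable if it has
a section `s` and, for some interval, a `V`-homotopy from `s ∘ f` to the identity of `A` which
becomes trivial upon composing with `f`. -/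
def Shrinkable {C : Type u₁} [Category.{v} C] [EnrichedOrdinaryCategory V C] {A B : C}
    (f : A ⟶ B) : Prop :=
  ∃ s : B ⟶ A, s ≫ f = 𝟙 B ∧
    ∃ (J : Interval V) (h : J.J ⟶ (EnrichedCategory.Hom A A : V)),
      J.d ≫ h = eHomEquiv V (f ≫ s) ∧ J.c ≫ h = eHomEquiv V (𝟙 A) ∧
        h ≫ eHomWhiskerLeft V A f = J.e ≫ eHomEquiv V f

variable {V} [SymmetricCategory V] [MonoidalClosed V] [HasLimits V]
variable {D : Type v} [EnrichedCategory V D]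

/-- A `V`-natural transformation is a (pointwise) trivial fibration. -/
def VNatTrans.IsTrivialFibration {F G : Weight V D} (p : VNatTrans F G) : Prop :=
  ∀ x, trivialFibrations V (p.app x)

/-- A weight `Q` is cofibrant if `[D, V](Q, -)` sends trivial fibrations to trivial fibrations. -/
def IsCofibrantWeight (Q : Weight V D) : Prop :=
  ∀ (F G : Weight V D) (p : VNatTrans F G), p.IsTrivialFibration →
    trivialFibrations V (natObjMap Q p)

/-- `Q` is a cofibrant weight admitting a pointwise trivial fibration to the composite of
`P : D → UnitCat V` and the `V`-functor selecting the unit object. -/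
def IsCofibrantReplacement (P : EnrichedFunctor V D (UnitCat V)) (Q : Weight V D) : Prop :=
  IsCofibrantWeight Q ∧
    ∃ q : VNatTrans Q (P.comp V (unitFunctor V)), q.IsTrivialFibration

/-- `W`-weighted limits are `ℰ`-stable: the full sub-`V`-category of the `V`-category of arrows
of `V` consisting of the shrinkable morphisms is closed under `W`-weighted limits. -/
def IsEStable (W : Weight V D) : Prop :=
  ∀ (S : EnrichedFunctor V D (Arrow V)), (∀ x, Shrinkable V (S.obj x).hom) →
    ∀ (L : Arrow V) (η : VNatTrans W (S.comp V (corep L))),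
      IsWeightedLimit η → Shrinkable V L.hom

variable (V)

/-- Shrinkable morphisms are closed in the `V`-category of arrows of `V` under enough
cofibrantly-weighted limits. -/
def EnoughCofibrantlyWeightedLimitsEStable : Prop :=
  ∀ (D : Type v) [EnrichedCategory V D] (P : EnrichedFunctor V D (UnitCat V)),
    ∃ Q : Weight V D, IsCofibrantReplacement P Q ∧ IsEStable Q

/-- `C` has enough cofibrantly-weighted limits. -/
def HasEnoughCofibrantlyWeightedLimits (C : Type u₁) [EnrichedCategory V C] : Prop :=
  ∀ (D : Type v) [EnrichedCategory V D] (P : EnrichedFunctor V D (UnitCat V)),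
    ∃ Q : Weight V D, IsCofibrantReplacement P Q ∧ HasWeightedLimits C Q

/-- `C` has `ℰ`-stable limits. -/
def HasEStableLimits (C : Type u₁) [EnrichedCategory V C] : Prop :=
  ∀ (D : Type v) [EnrichedCategory V D] (W : Weight V D), IsEStable W → HasWeightedLimits C W

/-- `C` has `ℰ`-weak colimits: for every weight `W : Dᵒᵖ → V` and diagram `S : D → C` there is
`η : W ⟶ C(S-, c)` for which the induced maps `C(c, a) ⟶ [Dᵒᵖ, V](W, C(S-, a))` are shrinkable.
Here `C(S-, c)` is written as `Cᵒᵖ(op c, Sᵒᵖ-)`, so that the induced map is an instance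
of `comparison`. -/
def HasEWeakColimits (C : Type u₁) [EnrichedCategory V C] : Prop :=
  ∀ (D : Type v) [EnrichedCategory V D] (W : Weight V Dᵒᵖ) (S : EnrichedFunctor V D C),
    ∃ (c : C) (η : VNatTrans W ((opFunctor S).comp V (corep (op c)))),
      ∀ a : C, Shrinkable V (comparison η (op a))

end Model

/-! ### Accessible `V`-categories -/

section Accessible

variable (V : Type u) [Category.{v} V] [MonoidalCategory V]
variable {C : Type u₁} [Category.{v} C] [EnrichedOrdinaryCategory V C]

/-- A conical colimit: a colimit in the underlying category which is sent by each
`C(-, c)` to a limit in `V`. -/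
structure IsConicalColimit {H : Type v} [SmallCategory H] {F : H ⥤ C} (t : Cocone F) : Prop where
  isColimit : Nonempty (IsColimit t)
  isLimit (c : C) : Nonempty (IsLimit (((eHomFunctor V C).flip.obj c).mapCone t.op))

/-- `A` is `κ`-presentable in the enriched sense: `C(A, -)` preserves (conical) `κ`-filtered
colimits. -/
def IsEnrichedPresentable [MonoidalClosed V] (κ : Cardinal.{v}) [Fact κ.IsRegular] (A : C) :
    Prop :=
  ∀ (H : Type v) [SmallCategory H] [IsCardinalFiltered H κ] (F : H ⥤ C) (t : Cocone F),
    IsConicalColimit V t → IsConicalColimit V ((eCoyoneda V A).mapCocone t)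

variable (C) in
/-- `C` is `κ`-accessible as a `V`-category: it has `κ`-filtered colimits and a small family of
`κ`-presentable objects of which every object is a `κ`-filtered colimit. -/
structure IsEnrichedCardinalAccessible [MonoidalClosed V] (κ : Cardinal.{v}) [Fact κ.IsRegular] :
    Prop where
  exists_colimit (H : Type v) [SmallCategory H] [IsCardinalFiltered H κ] (F : H ⥤ C) :
    ∃ t : Cocone F, IsConicalColimit V t
  exists_generator : ∃ (ι : Type v) (G : ι → C), (∀ i, IsEnrichedPresentable V κ (G i)) ∧
    ∀ X : C, ∃ (H : Type v) (_ : SmallCategory H) (_ : IsCardinalFiltered H κ) (F : H ⥤ C)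
      (t : F ⟶ (Functor.const H).obj X),
      (∀ h, F.obj h ∈ Set.range G) ∧ IsConicalColimit V (Cocone.mk X t)

/-- The condition on a regular cardinal that makes it an admissible lower bound for enriched
accessibility: `V` is locally `κ`-presentable, its unit object is `κ`-presentable, and
`κ`-presentable objects are closed under the tensor product. -/
structure IsBaseCardinal (κ : Cardinal.{v}) [Fact κ.IsRegular] : Prop where
  locallyPresentable : IsCardinalLocallyPresentable V κ
  unit : IsCardinalPresentable (𝟙_ V) κ
  tensor (X Y : V) (hX : IsCardinalPresentable X κ) (hY : IsCardinalPresentable Y κ) :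
    IsCardinalPresentable (X ⊗ Y) κ

variable (C) in
/-- `C` is accessible as a `V`-category: it is `κ`-accessible for some regular cardinal `κ`
above some base cardinal. -/
def IsEnrichedAccessible [MonoidalClosed V] : Prop :=
  ∃ (κ₀ κ : Cardinal.{v}) (_ : Fact κ₀.IsRegular) (_ : Fact κ.IsRegular),
    IsBaseCardinal V κ₀ ∧ κ₀ ≤ κ ∧ IsEnrichedCardinalAccessible V C κ

end Accessible

end HEnriched

end

open CategoryTheory MonoidalCategory Limits HomotopicalAlgebra HEnriched

universe v u w

noncomputable section

namespace HEnriched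

open CategoryTheory Category Limits MonoidalCategory HomotopicalAlgebra Opposite
open scoped CategoryTheory.MonoidalClosed

universe u₁ u₂ u₃

set_option linter.unusedSectionVars false

/-! ### Weights as right modules -/

section Modules

variable {V : Type u} [Category.{v} V] [MonoidalCategory V] [SymmetricCategory V]
  [MonoidalClosed V]
variable {C : Type u₁} [EnrichedCategory V C] {D : Type u₂} [EnrichedCategory V D]

/-! Throughout, a weight is read as a module over a `V`-category, and a point of `M x` as a module
map `C(x, -) ⟶ M` (`evalAt`); all cones, cocones and homotopies are then manipulated through the
Yoneda lemma.

From 1 to 2. Weighted limits in the arrow category are computed as `[D, V](W, p)`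
(`isWeightedLimit_arrowCone`), so `ℰ`-stability of `W` says that `[D, V](W, -)` turns pointwise
shrinkable transformations into shrinkable morphisms (`isEStable_iff`). A power is a limit weighted
by an object `X` on the unit `V`-category, and `[X, -]`, being a `V`-functor, carries a section and
a homotopy to a section and a homotopy; hence power weights are always `ℰ`-stable. The assumption on
`V` supplies enough cofibrant weights that are `ℰ`-stable.

From 2 to 3 is an adjoint functor theorem up to homotopy. An `ℰ`-weak colimit of `S` weighted by `W`
is a point of `M = [Dᵒᵖ, V](W, C(S-, -))` whose evaluations `C(c, a) ⟶ M a` are all shrinkable. The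
weight `M` preserves the weighted limits that exist in `C`, and accessibility gives it a solution
set `f`. Classically one takes the limit `L` of the solution set in the category of elements; here
the limit is weighted by a cofibrant replacement `Q ⟶ I` of the constant weight. Since `I` is
cofibrant, each `Q i ⟶ I` has a section, giving a projection `L ⟶ f i`. A map `f i ⟶ L` of elements
induces an endomorphism of `Q` over `I`; because `Q` is cofibrant and `Q ⟶ I` a trivial fibration,
this endomorphism is homotopic to the identity, and so is the composite `L ⟶ f i ⟶ L`
(`homotopicOver_endo`). It follows that `L` is initial up to fibrewise homotopy among elements
(`exists_homotopyInitial`), and powers turn statements about points into statements about arbitrary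
maps, which gives shrinkability (`exists_shrinkable_evalAt`).

From 3 to 1. Let `W` be `ℰ`-stable, let `S : D → C`, and let `G` be a generating family of
presentable objects. Put `F i = [D, V](W, C(G i, S-))`, the presheaf that a limit of `S` would have
to represent on `G`, and let `c` be an `ℰ`-weak colimit of the inclusion of `G` weighted by `F`. The
maps `C(c, S d) ⟶ [F, C(G-, S d)]` are shrinkable, so by `ℰ`-stability the induced map on `[D, V](W,
-)` has a section; it yields a cone on `c` for which `F` is a retract of `C(G-, c)`
(`exists_family_section`). The resulting idempotent of `C(G-, c)` comes from an idempotent of `c`,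
because `c` is a filtered colimit of objects of `G`. It splits because filtered colimits exist, and
the splitting represents `F` on `G`, hence is the limit, since every object is a conical colimit of
objects of `G`. -/

/-- The action `M x ⊗ C(x, y) ⟶ M y` of a weight. -/
def act (M : EnrichedFunctor V C V) (x y : C) :
    M.obj x ⊗ (EnrichedCategory.Hom x y : V) ⟶ M.obj y :=
  MonoidalClosed.uncurry (M.map x y)

lemma act_id (M : EnrichedFunctor V C V) (x : C) :
    M.obj x ◁ eId V x ≫ act M x x = (ρ_ _).hom := by
  rw [act, ← MonoidalClosed.uncurry_natural_left, M.map_id]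
  exact MonoidalClosed.uncurry_curry _

lemma act_comp (M : EnrichedFunctor V C V) (x y z : C) :
    M.obj x ◁ eComp V x y z ≫ act M x z =
      (α_ _ _ _).inv ≫ act M x y ▷ _ ≫ act M y z := by
  rw [act, ← MonoidalClosed.uncurry_natural_left, M.map_comp]
  exact uncurry_tensorHom_comp _ _

/-- A weight from a family of objects with an action. -/
def weightOfAct (obj : C → V) (a : ∀ x y, obj x ⊗ (EnrichedCategory.Hom x y : V) ⟶ obj y)
    (h_id : ∀ x, obj x ◁ eId V x ≫ a x x = (ρ_ _).hom)
    (h_comp : ∀ x y z, obj x ◁ eComp V x y z ≫ a x z =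
      (α_ _ _ _).inv ≫ a x y ▷ _ ≫ a y z) : EnrichedFunctor V C V where
  obj := obj
  map x y := MonoidalClosed.curry (a x y)
  map_id x := by
    rw [← MonoidalClosed.curry_natural_left, h_id]
    rfl
  map_comp x y z := by
    apply MonoidalClosed.uncurry_injective
    refine Eq.trans ?_ (uncurry_tensorHom_comp _ _).symm
    rw [MonoidalClosed.uncurry_natural_left, MonoidalClosed.uncurry_curry,
      MonoidalClosed.uncurry_curry, MonoidalClosed.uncurry_curry, h_comp]

lemma act_weightOfAct (obj : C → V)
    (a : ∀ x y, obj x ⊗ (EnrichedCategory.Hom x y : V) ⟶ obj y) (h_id) (h_comp) (x y : C) :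
    act (weightOfAct obj a h_id h_comp) x y = a x y :=
  MonoidalClosed.uncurry_curry _

lemma act_functorComp (S : EnrichedFunctor V D C) (M : EnrichedFunctor V C V) (x y : D) :
    act (S.comp V M) x y = (M.obj (S.obj x) ◁ S.map x y ≫ act M (S.obj x) (S.obj y) :) :=
  MonoidalClosed.uncurry_natural_left _ _

/-- The map `C(x, y) ⟶ M y` given by acting on a point `p` of `M x`. -/
def evalAt (M : EnrichedFunctor V C V) {x : C} (p : 𝟙_ V ⟶ M.obj x) (y : C) :
    (EnrichedCategory.Hom x y : V) ⟶ M.obj y :=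
  (λ_ _).inv ≫ p ▷ _ ≫ act M x y

@[simp]
lemma eId_evalAt (M : EnrichedFunctor V C V) {x : C} (p : 𝟙_ V ⟶ M.obj x) :
    eId V x ≫ evalAt M p x = p := by
  rw [evalAt, leftUnitor_inv_naturality_assoc, whisker_exchange_assoc, act_id]
  simp [unitors_inv_equal]

/-- Associativity of the action: acting on a fixed point is a module map `C(x, -) ⟶ M`, the one
corresponding to `p` under Yoneda. -/
lemma eComp_evalAt (M : EnrichedFunctor V C V) {x : C} (p : 𝟙_ V ⟶ M.obj x) (y z : C) :
    eComp V x y z ≫ evalAt M p z = evalAt M p y ▷ _ ≫ act M y z := by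
  simp only [evalAt, comp_whiskerRight, Category.assoc]
  rw [leftUnitor_inv_naturality_assoc, whisker_exchange_assoc, act_comp]
  simp

lemma act_corep (X y z : C) : act (corep (V := V) X) y z = eComp V X y z :=
  MonoidalClosed.uncurry_curry _

/-- Precomposition `C(Y, Z) ⟶ C(X, Z)` with a point of `C(X, Y)`. -/
def precomp {X Y : C} (u : 𝟙_ V ⟶ (EnrichedCategory.Hom X Y : V)) (Z : C) :
    (EnrichedCategory.Hom Y Z : V) ⟶ (EnrichedCategory.Hom X Z : V) :=
  (λ_ _).inv ≫ u ▷ _ ≫ eComp V X Y Z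

lemma eComp_precomp {X Y : C} (u : 𝟙_ V ⟶ (EnrichedCategory.Hom X Y : V)) (Z T : C) :
    eComp V Y Z T ≫ precomp u T = precomp u Z ▷ _ ≫ eComp V X Z T := by
  simp only [precomp, comp_whiskerRight, Category.assoc]
  rw [leftUnitor_inv_naturality_assoc, whisker_exchange_assoc, ← e_assoc']
  simp

lemma precomp_id (X Z : C) : precomp (eId V X) Z = 𝟙 _ := e_id_comp V X Z

lemma precomp_precomp {X Y Z : C} (u : 𝟙_ V ⟶ (EnrichedCategory.Hom X Y : V))
    (t : 𝟙_ V ⟶ (EnrichedCategory.Hom Y Z : V)) (T : C) :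
    precomp t T ≫ precomp u T = precomp (t ≫ precomp u Z) T := by
  rw [precomp, Category.assoc, Category.assoc, eComp_precomp]
  simp [precomp]

lemma precomp_evalAt (M : EnrichedFunctor V C V) {X Y : C} (p : 𝟙_ V ⟶ M.obj X)
    (u : 𝟙_ V ⟶ (EnrichedCategory.Hom X Y : V)) (Z : C) :
    precomp u Z ≫ evalAt M p Z = evalAt M (u ≫ evalAt M p Y) Z := by
  rw [precomp, Category.assoc, Category.assoc, eComp_evalAt]
  simp [evalAt]

lemma precomp_eHomEquiv {C : Type u₁} [Category.{v} C] [EnrichedOrdinaryCategory V C]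
    {X Y : C} (f : X ⟶ Y) (Z : C) :
    precomp (eHomEquiv V f) Z = eHomWhiskerRight V f Z := rfl

lemma VNatTrans.act_app {F G : Weight V D} (p : VNatTrans F G) (x y : D) :
    act F x y ≫ p.app y = p.app x ▷ _ ≫ act G x y := by
  have h := congrArg MonoidalClosed.uncurry (p.naturality x y)
  rwa [MonoidalClosed.enrichedOrdinaryCategorySelf_eHomWhiskerLeft,
    MonoidalClosed.enrichedOrdinaryCategorySelf_eHomWhiskerRight,
    MonoidalClosed.uncurry_natural_right, MonoidalClosed.uncurry_pre_app] at h

/-- A `V`-natural transformation from a family of maps compatible with the actions. -/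
def VNatTrans.ofAct {F G : Weight V D} (app : ∀ x, F.obj x ⟶ G.obj x)
    (h : ∀ x y, act F x y ≫ app y = app x ▷ _ ≫ act G x y) : VNatTrans F G where
  app := app
  naturality x y := by
    apply MonoidalClosed.uncurry_injective
    rw [MonoidalClosed.enrichedOrdinaryCategorySelf_eHomWhiskerLeft,
      MonoidalClosed.enrichedOrdinaryCategorySelf_eHomWhiskerRight,
      MonoidalClosed.uncurry_natural_right, MonoidalClosed.uncurry_pre_app]
    exact h x y

variable [HasLimits V]

/-! ### The object of natural transformations, as classifying module maps -/

section NatObjEval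

variable {D : Type v} [EnrichedCategory V D]

/-- The evaluation `[D, V](F, G) ⊗ F x ⟶ G x`. -/
def natObjEval (F G : Weight V D) (x : D) : natObj F G ⊗ F.obj x ⟶ G.obj x :=
  (β_ _ _).hom ≫ MonoidalClosed.uncurry (natObjπ F G x)

lemma whiskerRight_natObjEval {F G : Weight V D} {T : V} (f : T ⟶ natObj F G) (x : D) :
    f ▷ F.obj x ≫ natObjEval F G x =
      (β_ _ _).hom ≫ MonoidalClosed.uncurry (f ≫ natObjπ F G x) := by
  rw [natObjEval, BraidedCategory.braiding_naturality_left_assoc,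
    ← MonoidalClosed.uncurry_natural_left]

/-- This is the equalizer condition defining the end, transposed. Together with `natObjCurry` it
says that maps `T ⟶ natObj F G` are module maps `T ⊗ F ⟶ G`, the form in which the object of natural
transformations is used from here on. -/
lemma natObjEval_act (F G : Weight V D) (x y : D) :
    natObj F G ◁ act F x y ≫ natObjEval F G y =
      (α_ _ _ _).inv ≫ natObjEval F G x ▷ _ ≫ act G x y := by
  have h := congrArg MonoidalClosed.uncurry (natObjπ_condition F G x y)
  have h₁ := uncurry_tensorHom_comp (F.map x y) (natObjπ F G y)
  have h₂ := uncurry_tensorHom_comp (natObjπ F G x) (G.map x y)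
  replace h := h₁.symm.trans (h.trans
    ((MonoidalClosed.uncurry_natural_left _ _).trans (congrArg _ h₂)))
  simp only [natObjEval, comp_whiskerRight, Category.assoc,
    BraidedCategory.braiding_naturality_right_assoc]
  change _ ≫ MonoidalClosed.uncurry (F.map x y) ▷ _ ≫ _ = _
  have h' : MonoidalClosed.uncurry (F.map x y) ▷ natObj F G ≫
      MonoidalClosed.uncurry (natObjπ F G y) = (α_ _ _ _).hom ≫ F.obj x ◁ (β_ _ _).hom ≫
        (α_ _ _ _).inv ≫ MonoidalClosed.uncurry (natObjπ F G x) ▷ _ ≫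
          MonoidalClosed.uncurry (G.map x y) := by
    rw [← h, Iso.hom_inv_id_assoc]
  rw [h']
  simp [act, ← MonoidalCategory.whiskerLeft_comp_assoc]

/-- The map `T ⟶ [D, V](F, G)` induced by a family of maps `T ⊗ F x ⟶ G x` compatible with the
actions. -/
def natObjCurry {F G : Weight V D} {T : V} (ψ : ∀ x, T ⊗ F.obj x ⟶ G.obj x)
    (hψ : ∀ x y, T ◁ act F x y ≫ ψ y = (α_ _ _ _).inv ≫ ψ x ▷ _ ≫ act G x y) :
    T ⟶ natObj F G :=
  natObjLift F G (fun x => MonoidalClosed.curry ((β_ _ _).hom ≫ ψ x)) fun x y => by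
    apply MonoidalClosed.uncurry_injective
    refine (uncurry_tensorHom_comp _ _).trans (Eq.trans ?_
      ((MonoidalClosed.uncurry_natural_left _ _).trans
        (congrArg _ (uncurry_tensorHom_comp _ _))).symm)
    rw [MonoidalClosed.uncurry_curry, MonoidalClosed.uncurry_curry,
      BraidedCategory.braiding_naturality_left_assoc]
    change _ ≫ _ ≫ T ◁ act F x y ≫ _ = _ ≫ _ ≫ _ ≫ act G x y
    rw [hψ]
    simp

@[simp]
lemma natObjCurry_eval {F G : Weight V D} {T : V} (ψ : ∀ x, T ⊗ F.obj x ⟶ G.obj x) (hψ) (x : D) :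
    natObjCurry ψ hψ ▷ F.obj x ≫ natObjEval F G x = ψ x := by
  rw [whiskerRight_natObjEval, natObjCurry, natObjLift_π,
    MonoidalClosed.uncurry_curry, SymmetricCategory.symmetry_assoc]

lemma natObj_ext {F G : Weight V D} {T : V} {f g : T ⟶ natObj F G}
    (h : ∀ x, f ▷ F.obj x ≫ natObjEval F G x = g ▷ F.obj x ≫ natObjEval F G x) : f = g := by
  refine natObj_hom_ext F G fun x => MonoidalClosed.uncurry_injective ?_
  rw [← cancel_epi (β_ _ _).hom, ← whiskerRight_natObjEval, ← whiskerRight_natObjEval]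
  exact h x

@[simp]
lemma natObjMap_eval (Q : Weight V D) {F G : Weight V D} (p : VNatTrans F G) (x : D) :
    natObjMap Q p ▷ Q.obj x ≫ natObjEval Q G x = natObjEval Q F x ≫ p.app x := by
  rw [whiskerRight_natObjEval, natObjMap, natObjLift_π,
    MonoidalClosed.enrichedOrdinaryCategorySelf_eHomWhiskerLeft,
    MonoidalClosed.uncurry_natural_right, natObjEval, Category.assoc]

/-- A `V`-natural transformation as a point of the object of natural transformations. -/
def natObjPoint {F G : Weight V D} (p : VNatTrans F G) : 𝟙_ V ⟶ natObj F G :=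
  natObjCurry (fun x => (λ_ _).hom ≫ p.app x) fun x y => by simp [p.act_app]

@[simp]
lemma natObjPoint_eval {F G : Weight V D} (p : VNatTrans F G) (x : D) :
    natObjPoint p ▷ F.obj x ≫ natObjEval F G x = (λ_ _).hom ≫ p.app x :=
  natObjCurry_eval _ _ _

/-- The `V`-natural transformation determined by a point of the object of natural
transformations. -/
def natTransOfPoint {F G : Weight V D} (z : 𝟙_ V ⟶ natObj F G) : VNatTrans F G :=
  VNatTrans.ofAct (fun x => (λ_ _).inv ≫ z ▷ _ ≫ natObjEval F G x) fun x y => by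
    rw [leftUnitor_inv_naturality_assoc, whisker_exchange_assoc, natObjEval_act]
    simp

lemma natTransOfPoint_app {F G : Weight V D} (z : 𝟙_ V ⟶ natObj F G) (x : D) :
    (natTransOfPoint z).app x = (λ_ _).inv ≫ z ▷ _ ≫ natObjEval F G x := rfl

end NatObjEval

/-! ### Cones -/

section Cones

variable {D : Type v} [EnrichedCategory V D] {W : Weight V D} {S : EnrichedFunctor V D C}

/-- The components `W d ⟶ C(L, S d)` of a cone. -/
def coneHom {L : C} (η : VNatTrans W (S.comp V (corep L))) (d : D) :
    W.obj d ⟶ (EnrichedCategory.Hom L (S.obj d) : V) :=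
  η.app d

lemma act_coneHom {L : C} (η : VNatTrans W (S.comp V (corep L))) (x y : D) :
    act W x y ≫ coneHom η y =
      coneHom η x ▷ _ ≫ _ ◁ S.map x y ≫ eComp V L (S.obj x) (S.obj y) := by
  have h := η.act_app x y
  rw [act_functorComp, act_corep] at h
  exact h

/-- A cone from its components. -/
def coneOf {L : C} (app : ∀ d, W.obj d ⟶ (EnrichedCategory.Hom L (S.obj d) : V))
    (h : ∀ x y, act W x y ≫ app y =
      app x ▷ _ ≫ _ ◁ S.map x y ≫ eComp V L (S.obj x) (S.obj y)) :
    VNatTrans W (S.comp V (corep L)) :=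
  VNatTrans.ofAct app fun x y => by
    rw [act_functorComp, act_corep]
    exact h x y

variable (M : Weight V C) (W S)

/-- The evaluation `[D, V](W, M S-) ⊗ W d ⟶ M (S d)`. -/
def weightEval (d : D) : natObj W (S.comp V M) ⊗ W.obj d ⟶ M.obj (S.obj d) :=
  natObjEval W (S.comp V M) d

lemma weightEval_act (x y : D) :
    natObj W (S.comp V M) ◁ act W x y ≫ weightEval W S M y =
      (α_ _ _ _).inv ≫ weightEval W S M x ▷ _ ≫ _ ◁ S.map x y ≫
        act M (S.obj x) (S.obj y) := by
  have h := natObjEval_act W (S.comp V M) x y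
  rw [act_functorComp] at h
  exact h

variable {W S M}

/-- The map `T ⟶ [D, V](W, M S-)` induced by a compatible family `T ⊗ W d ⟶ M (S d)`. -/
def weightCurry {T : V} (ψ : ∀ d, T ⊗ W.obj d ⟶ M.obj (S.obj d))
    (hψ : ∀ x y, T ◁ act W x y ≫ ψ y =
      (α_ _ _ _).inv ≫ ψ x ▷ _ ≫ _ ◁ S.map x y ≫ act M (S.obj x) (S.obj y)) :
    T ⟶ natObj W (S.comp V M) :=
  natObjCurry ψ fun x y => by
    rw [act_functorComp]
    exact hψ x y

@[simp]
lemma weightCurry_eval {T : V} (ψ : ∀ d, T ⊗ W.obj d ⟶ M.obj (S.obj d)) (hψ) (d : D) :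
    weightCurry (S := S) (M := M) ψ hψ ▷ W.obj d ≫ weightEval W S M d = ψ d :=
  natObjCurry_eval _ _ _

lemma weightEval_ext {T : V} {f g : T ⟶ natObj W (S.comp V M)}
    (h : ∀ d, f ▷ W.obj d ≫ weightEval W S M d = g ▷ W.obj d ≫ weightEval W S M d) : f = g :=
  natObj_ext h

variable (W S)

/-- The evaluation `[D, V](W, C(X, S-)) ⊗ W d ⟶ C(X, S d)`. -/
def coneEval (X : C) (d : D) :
    natObj W (S.comp V (corep X)) ⊗ W.obj d ⟶ (EnrichedCategory.Hom X (S.obj d) : V) :=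
  natObjEval W (S.comp V (corep X)) d

lemma coneEval_act (X : C) (x y : D) :
    natObj W (S.comp V (corep X)) ◁ act W x y ≫ coneEval W S X y =
      (α_ _ _ _).inv ≫ coneEval W S X x ▷ _ ≫ _ ◁ S.map x y ≫
        eComp V X (S.obj x) (S.obj y) := by
  have h := natObjEval_act W (S.comp V (corep X)) x y
  rw [act_functorComp, act_corep] at h
  exact h

variable {W S}

/-- The map `T ⟶ [D, V](W, C(X, S-))` induced by a compatible family `T ⊗ W d ⟶ C(X, S d)`. -/
def coneCurry {X : C} {T : V}
    (ψ : ∀ d, T ⊗ W.obj d ⟶ (EnrichedCategory.Hom X (S.obj d) : V))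
    (hψ : ∀ x y, T ◁ act W x y ≫ ψ y =
      (α_ _ _ _).inv ≫ ψ x ▷ _ ≫ _ ◁ S.map x y ≫ eComp V X (S.obj x) (S.obj y)) :
    T ⟶ natObj W (S.comp V (corep X)) :=
  natObjCurry ψ fun x y => by
    rw [act_functorComp, act_corep]
    exact hψ x y

@[simp]
lemma coneCurry_eval {X : C} {T : V}
    (ψ : ∀ d, T ⊗ W.obj d ⟶ (EnrichedCategory.Hom X (S.obj d) : V)) (hψ) (d : D) :
    coneCurry (S := S) ψ hψ ▷ W.obj d ≫ coneEval W S X d = ψ d :=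
  natObjCurry_eval _ _ _

lemma coneEval_ext {X : C} {T : V} {f g : T ⟶ natObj W (S.comp V (corep X))}
    (h : ∀ d, f ▷ W.obj d ≫ coneEval W S X d = g ▷ W.obj d ≫ coneEval W S X d) : f = g :=
  natObj_ext h

/-- The map `M L ⟶ [D, V](W, M S-)` induced by `η : W ⟶ C(L, S-)`. -/
def weightComparison (M : Weight V C) {L : C}
    (η : VNatTrans W (S.comp V (corep L))) : M.obj L ⟶ natObj W (S.comp V M) :=
  weightCurry (fun d => M.obj L ◁ coneHom η d ≫ act M L (S.obj d)) fun x y => by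
    simp only [← MonoidalCategory.whiskerLeft_comp_assoc, act_coneHom]
    simp only [MonoidalCategory.whiskerLeft_comp, Category.assoc, act_comp,
      associator_inv_naturality_right_assoc, whisker_exchange_assoc]
    simp

@[simp]
lemma weightComparison_eval (M : Weight V C) {L : C}
    (η : VNatTrans W (S.comp V (corep L))) (d : D) :
    weightComparison M η ▷ W.obj d ≫ weightEval W S M d =
      M.obj L ◁ coneHom η d ≫ act M L (S.obj d) :=
  weightCurry_eval _ _ _

@[simp]
lemma comparison_eval {L : C} (η : VNatTrans W (S.comp V (corep L))) (X : C) (d : D) :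
    comparison η X ▷ W.obj d ≫ coneEval W S X d =
      (EnrichedCategory.Hom X L : V) ◁ coneHom η d ≫ eComp V X L (S.obj d) := by
  have h : comparison η X ≫ natObjπ W (S.comp V (corep X)) d = comparisonApp η X d :=
    natObjLift_π _ _ _ _ _
  refine (whiskerRight_natObjEval _ d).trans ?_
  rw [h]
  refine (congrArg _ (MonoidalClosed.uncurry_curry _)).trans ?_
  exact SymmetricCategory.symmetry_assoc _ _ _

end Cones

end Modules

/-! ### Shrinkable morphisms of `V` -/

section Shrinkable

variable {V : Type u} [Category.{v} V] [MonoidalCategory V] [SymmetricCategory V]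
  [MonoidalClosed V] [ModelCategory V]

/-- Transposing the homotopy `J ⟶ [A, A]` to `J ⊗ A ⟶ A` makes it possible to conjugate it by maps
and to transport it without internal homs. -/
lemma shrinkable_iff {A B : V} (f : A ⟶ B) :
    Shrinkable V f ↔ ∃ s : B ⟶ A, s ≫ f = 𝟙 B ∧
      ∃ (J : Interval V) (H : J.J ⊗ A ⟶ A),
        J.d ▷ A ≫ H = (λ_ A).hom ≫ f ≫ s ∧ J.c ▷ A ≫ H = (λ_ A).hom ∧
          H ≫ f = J.e ▷ A ≫ (λ_ A).hom ≫ f := by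
  have hom_eq {X Y : V} (g : X ⟶ Y) :
      eHomEquiv V g = MonoidalClosed.curry ((ρ_ X).hom ≫ g) := rfl
  refine exists_congr fun s => and_congr_right fun _ => exists_congr fun J => ?_
  constructor
  · rintro ⟨h, hd, hc, he⟩
    refine ⟨(β_ _ _).hom ≫ MonoidalClosed.uncurry h, ?_, ?_, ?_⟩
    · rw [BraidedCategory.braiding_naturality_left_assoc, ← MonoidalClosed.uncurry_natural_left,
        hd, hom_eq, MonoidalClosed.uncurry_curry]
      simp
    · rw [BraidedCategory.braiding_naturality_left_assoc, ← MonoidalClosed.uncurry_natural_left,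
        hc, hom_eq, MonoidalClosed.uncurry_curry]
      simp
    · rw [MonoidalClosed.enrichedOrdinaryCategorySelf_eHomWhiskerLeft] at he
      rw [Category.assoc, ← MonoidalClosed.uncurry_natural_right, he,
        MonoidalClosed.uncurry_natural_left, hom_eq, MonoidalClosed.uncurry_curry,
        ← BraidedCategory.braiding_naturality_left_assoc]
      simp
  · rintro ⟨H, hd, hc, he⟩
    refine ⟨MonoidalClosed.curry ((β_ _ _).hom ≫ H), ?_, ?_, ?_⟩
    · rw [← MonoidalClosed.curry_natural_left, BraidedCategory.braiding_naturality_right_assoc,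
        hd, hom_eq]
      simp
    · rw [← MonoidalClosed.curry_natural_left, BraidedCategory.braiding_naturality_right_assoc,
        hc, hom_eq]
      simp
    · rw [MonoidalClosed.enrichedOrdinaryCategorySelf_eHomWhiskerLeft,
        ← MonoidalClosed.curry_natural_right, Category.assoc, he, hom_eq,
        ← MonoidalClosed.curry_natural_left, ← BraidedCategory.braiding_naturality_right_assoc]
      simp

/-- Conjugating the section and the homotopy by the retraction preserves all four equations. Needed
because a weighted limit is determined only up to isomorphism. -/
lemma Shrinkable.of_retract {A B A' B' : V} {f : A ⟶ B} {f' : A' ⟶ B'} (hf' : Shrinkable V f')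
    (i : A ⟶ A') (r : A' ⟶ A) (i' : B ⟶ B') (r' : B' ⟶ B) (hi : i ≫ f' = f ≫ i')
    (hr : r ≫ f = f' ≫ r') (h : i ≫ r = 𝟙 A) (h' : i' ≫ r' = 𝟙 B) : Shrinkable V f := by
  rw [shrinkable_iff] at hf' ⊢
  obtain ⟨s, hs, J, H, hd, hc, he⟩ := hf'
  refine ⟨i' ≫ s ≫ r, ?_, J, J.J ◁ i ≫ H ≫ r, ?_, ?_, ?_⟩
  · simp only [Category.assoc, hr, reassoc_of% hs, h']
  · rw [← whisker_exchange_assoc, reassoc_of% hd, id_whiskerLeft_assoc]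
    simp [reassoc_of% hi]
  · rw [← whisker_exchange_assoc, reassoc_of% hc, id_whiskerLeft_assoc]
    simp [h]
  · simp only [Category.assoc, hr, reassoc_of% he]
    rw [whisker_exchange_assoc, id_whiskerLeft_assoc]
    simp [reassoc_of% hi, h']

end Shrinkable

/-! ### Weighted limits in the `V`-category of arrows -/

section ArrowLimits

variable {V : Type u} [Category.{v} V] [MonoidalCategory V] [SymmetricCategory V]
  [MonoidalClosed V] [HasLimits V]

/-- The evaluation of the hom-object of arrows at the domains. -/
def arrowEvalLeft (X Y : Arrow V) : X.left ⊗ arrowHom V X Y ⟶ Y.left :=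
  MonoidalClosed.uncurry (arrowHomLeft V X Y)

/-- The evaluation of the hom-object of arrows at the codomains. -/
def arrowEvalRight (X Y : Arrow V) : X.right ⊗ arrowHom V X Y ⟶ Y.right :=
  MonoidalClosed.uncurry (arrowHomRight V X Y)

lemma arrowEval_condition (X Y : Arrow V) :
    arrowEvalLeft X Y ≫ Y.hom = X.hom ▷ _ ≫ arrowEvalRight X Y := by
  have h := congrArg MonoidalClosed.uncurry (arrowHom_condition V X Y)
  rwa [MonoidalClosed.enrichedOrdinaryCategorySelf_eHomWhiskerLeft,
    MonoidalClosed.enrichedOrdinaryCategorySelf_eHomWhiskerRight,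
    MonoidalClosed.uncurry_natural_right, MonoidalClosed.uncurry_pre_app] at h

/-- The map `T ⟶ V^𝟚(X, Y)` induced by compatible maps `T ⊗ X ⟶ Y` on domains and codomains. -/
def arrowCurry {X Y : Arrow V} {T : V} (l : X.left ⊗ T ⟶ Y.left) (r : X.right ⊗ T ⟶ Y.right)
    (h : l ≫ Y.hom = X.hom ▷ T ≫ r) : T ⟶ arrowHom V X Y :=
  arrowHomLift V (MonoidalClosed.curry l) (MonoidalClosed.curry r) (by
    apply MonoidalClosed.uncurry_injective
    rw [MonoidalClosed.enrichedOrdinaryCategorySelf_eHomWhiskerLeft,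
      MonoidalClosed.enrichedOrdinaryCategorySelf_eHomWhiskerRight,
      MonoidalClosed.uncurry_natural_right, MonoidalClosed.uncurry_pre_app,
      MonoidalClosed.uncurry_curry, MonoidalClosed.uncurry_curry, h])

@[simp]
lemma arrowCurry_left {X Y : Arrow V} {T : V} (l : X.left ⊗ T ⟶ Y.left)
    (r : X.right ⊗ T ⟶ Y.right) (h) :
    X.left ◁ arrowCurry l r h ≫ arrowEvalLeft X Y = l := by
  rw [arrowEvalLeft, ← MonoidalClosed.uncurry_natural_left, arrowCurry, arrowHomLift_left,
    MonoidalClosed.uncurry_curry]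

@[simp]
lemma arrowCurry_right {X Y : Arrow V} {T : V} (l : X.left ⊗ T ⟶ Y.left)
    (r : X.right ⊗ T ⟶ Y.right) (h) :
    X.right ◁ arrowCurry l r h ≫ arrowEvalRight X Y = r := by
  rw [arrowEvalRight, ← MonoidalClosed.uncurry_natural_left, arrowCurry, arrowHomLift_right,
    MonoidalClosed.uncurry_curry]

lemma arrowEval_ext {X Y : Arrow V} {T : V} {f g : T ⟶ arrowHom V X Y}
    (h₁ : X.left ◁ f ≫ arrowEvalLeft X Y = X.left ◁ g ≫ arrowEvalLeft X Y)
    (h₂ : X.right ◁ f ≫ arrowEvalRight X Y = X.right ◁ g ≫ arrowEvalRight X Y) : f = g := by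
  refine arrowHom_ext V (MonoidalClosed.uncurry_injective ?_)
    (MonoidalClosed.uncurry_injective ?_)
  · rw [MonoidalClosed.uncurry_natural_left, MonoidalClosed.uncurry_natural_left]
    exact h₁
  · rw [MonoidalClosed.uncurry_natural_left, MonoidalClosed.uncurry_natural_left]
    exact h₂

lemma eComp_arrowEvalLeft (X Y Z : Arrow V) :
    X.left ◁ eComp V X Y Z ≫ arrowEvalLeft X Z =
      (α_ _ _ _).inv ≫ arrowEvalLeft X Y ▷ _ ≫ arrowEvalLeft Y Z := by
  refine (MonoidalClosed.uncurry_natural_left _ _).symm.trans ?_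
  refine (congrArg _ (arrowComp_left V X Y Z)).trans ?_
  exact uncurry_tensorHom_comp _ _

lemma eComp_arrowEvalRight (X Y Z : Arrow V) :
    X.right ◁ eComp V X Y Z ≫ arrowEvalRight X Z =
      (α_ _ _ _).inv ≫ arrowEvalRight X Y ▷ _ ≫ arrowEvalRight Y Z := by
  refine (MonoidalClosed.uncurry_natural_left _ _).symm.trans ?_
  refine (congrArg _ (arrowComp_right V X Y Z)).trans ?_
  exact uncurry_tensorHom_comp _ _

lemma eId_arrowEvalLeft (X : Arrow V) :
    X.left ◁ eId V X ≫ arrowEvalLeft X X = (ρ_ _).hom := by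
  refine (MonoidalClosed.uncurry_natural_left _ _).symm.trans ?_
  refine (congrArg _ (arrowId_left V X)).trans ?_
  exact MonoidalClosed.uncurry_curry _

lemma eId_arrowEvalRight (X : Arrow V) :
    X.right ◁ eId V X ≫ arrowEvalRight X X = (ρ_ _).hom := by
  refine (MonoidalClosed.uncurry_natural_left _ _).symm.trans ?_
  refine (congrArg _ (arrowId_right V X)).trans ?_
  exact MonoidalClosed.uncurry_curry _

variable {D : Type v} [EnrichedCategory V D]

/-- The `V`-functor to the `V`-category of arrows given by a `V`-natural transformation. -/
abbrev arrowFunctor {F G : Weight V D} (p : VNatTrans F G) : EnrichedFunctor V D (Arrow V) where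
  obj x := Arrow.mk (p.app x)
  map x y := arrowHomLift V (f := Arrow.mk (p.app x)) (g := Arrow.mk (p.app y))
    (F.map x y) (G.map x y) (p.naturality x y)
  map_id x := by
    apply arrowHom_ext
    · refine (Category.assoc _ _ _).trans ?_
      rw [arrowHomLift_left]
      exact (F.map_id x).trans (arrowId_left V (Arrow.mk (p.app x))).symm
    · refine (Category.assoc _ _ _).trans ?_
      rw [arrowHomLift_right]
      exact (G.map_id x).trans (arrowId_right V (Arrow.mk (p.app x))).symm
  map_comp x y z := by
    apply arrowHom_ext
    · refine (Category.assoc _ _ _).trans ?_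
      rw [arrowHomLift_left]
      refine (F.map_comp x y z).trans (Eq.symm ?_)
      refine (Category.assoc _ _ _).trans ?_
      refine (congrArg _ (arrowComp_left V _ _ _)).trans ?_
      rw [tensorHom_comp_tensorHom_assoc, arrowHomLift_left, arrowHomLift_left]
      rfl
    · refine (Category.assoc _ _ _).trans ?_
      rw [arrowHomLift_right]
      refine (G.map_comp x y z).trans (Eq.symm ?_)
      refine (Category.assoc _ _ _).trans ?_
      refine (congrArg _ (arrowComp_right V _ _ _)).trans ?_
      rw [tensorHom_comp_tensorHom_assoc, arrowHomLift_right, arrowHomLift_right]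
      rfl

/-- The hom-objects of arrows are pullbacks, so projecting to domains and codomains splits a
`V`-functor into the arrow category into two weights and a transformation between them. -/
lemma exists_eq_arrowFunctor (S : EnrichedFunctor V D (Arrow V)) :
    ∃ (F G : Weight V D) (p : VNatTrans F G), S = arrowFunctor p := by
  let F : Weight V D :=
    { obj x := (S.obj x).left
      map x y := S.map x y ≫ arrowHomLeft V _ _
      map_id x := by
        rw [S.map_id_assoc]
        exact arrowId_left V (S.obj x)
      map_comp x y z := by
        rw [S.map_comp_assoc]
        refine (congrArg _ (arrowComp_left V _ _ _)).trans ?_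
        exact tensorHom_comp_tensorHom_assoc _ _ _ _ _ }
  let G : Weight V D :=
    { obj x := (S.obj x).right
      map x y := S.map x y ≫ arrowHomRight V _ _
      map_id x := by
        rw [S.map_id_assoc]
        exact arrowId_right V (S.obj x)
      map_comp x y z := by
        rw [S.map_comp_assoc]
        refine (congrArg _ (arrowComp_right V _ _ _)).trans ?_
        exact tensorHom_comp_tensorHom_assoc _ _ _ _ _ }
  let p : VNatTrans F G :=
    { app x := (S.obj x).hom
      naturality x y := by
        dsimp only [F, G]
        rw [Category.assoc, Category.assoc, arrowHom_condition] }
  refine ⟨F, G, p, EnrichedFunctor.ext V (fun _ => rfl) fun x y => ?_⟩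
  refine (Category.comp_id _).trans ?_
  apply arrowHom_ext
  · exact (arrowHomLift_left (f := S.obj x) (g := S.obj y) V _ _ _).symm
  · exact (arrowHomLift_right (f := S.obj x) (g := S.obj y) V _ _ _).symm

/-! ### Pointwise construction of weighted limits of arrows -/

section PointwiseLimit

variable {F G : Weight V D} (p : VNatTrans F G) (W : Weight V D)

lemma whiskerLeft_arrowFunctor_map_left (x y : D) :
    F.obj x ◁ (arrowFunctor p).map x y ≫
      arrowEvalLeft (Arrow.mk (p.app x)) (Arrow.mk (p.app y)) = act F x y := by
  refine (MonoidalClosed.uncurry_natural_left _ _).symm.trans (congrArg _ ?_)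
  exact arrowHomLift_left _ _ _ _

lemma whiskerLeft_arrowFunctor_map_right (x y : D) :
    G.obj x ◁ (arrowFunctor p).map x y ≫
      arrowEvalRight (Arrow.mk (p.app x)) (Arrow.mk (p.app y)) = act G x y := by
  refine (MonoidalClosed.uncurry_natural_left _ _).symm.trans (congrArg _ ?_)
  exact arrowHomLift_right _ _ _ _

/-- The component at `d` of the limit cone in the `V`-category of arrows. -/
def arrowConeApp (d : D) :
    W.obj d ⟶ arrowHom V (Arrow.mk (natObjMap W p)) (Arrow.mk (p.app d)) :=
  arrowCurry (X := Arrow.mk (natObjMap W p)) (Y := Arrow.mk (p.app d))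
    (natObjEval W F d) (natObjEval W G d) (natObjMap_eval W p d).symm

lemma arrowConeApp_left (d : D) :
    natObj W F ◁ arrowConeApp p W d ≫
      arrowEvalLeft (Arrow.mk (natObjMap W p)) (Arrow.mk (p.app d)) = natObjEval W F d :=
  arrowCurry_left (X := Arrow.mk (natObjMap W p)) (Y := Arrow.mk (p.app d)) _ _ _

lemma arrowConeApp_right (d : D) :
    natObj W G ◁ arrowConeApp p W d ≫
      arrowEvalRight (Arrow.mk (natObjMap W p)) (Arrow.mk (p.app d)) = natObjEval W G d :=
  arrowCurry_right (X := Arrow.mk (natObjMap W p)) (Y := Arrow.mk (p.app d)) _ _ _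

lemma arrowEval_comp_left {X Y Z : Arrow V} {A B : V} (f : A ⟶ arrowHom V X Y)
    (g : B ⟶ arrowHom V Y Z) :
    X.left ◁ (f ▷ B ≫ arrowHom V X Y ◁ g ≫ eComp V X Y Z) ≫ arrowEvalLeft X Z =
      (α_ _ _ _).inv ≫ (X.left ◁ f ≫ arrowEvalLeft X Y) ▷ B ≫
        Y.left ◁ g ≫ arrowEvalLeft Y Z := by
  simp only [MonoidalCategory.whiskerLeft_comp, Category.assoc]
  refine (congrArg _ (congrArg _ (eComp_arrowEvalLeft X Y Z))).trans ?_
  rw [associator_inv_naturality_right_assoc, whisker_exchange_assoc]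
  simp

lemma arrowEval_comp_right {X Y Z : Arrow V} {A B : V} (f : A ⟶ arrowHom V X Y)
    (g : B ⟶ arrowHom V Y Z) :
    X.right ◁ (f ▷ B ≫ arrowHom V X Y ◁ g ≫ eComp V X Y Z) ≫ arrowEvalRight X Z =
      (α_ _ _ _).inv ≫ (X.right ◁ f ≫ arrowEvalRight X Y) ▷ B ≫
        Y.right ◁ g ≫ arrowEvalRight Y Z := by
  simp only [MonoidalCategory.whiskerLeft_comp, Category.assoc]
  refine (congrArg _ (congrArg _ (eComp_arrowEvalRight X Y Z))).trans ?_
  rw [associator_inv_naturality_right_assoc, whisker_exchange_assoc]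
  simp

/-- The limit cone on `[D, V](W, p)` in the `V`-category of arrows. -/
def arrowCone : VNatTrans W ((arrowFunctor p).comp V (corep (Arrow.mk (natObjMap W p)))) :=
  coneOf (arrowConeApp p W) fun x y => by
    apply arrowEval_ext
    · refine Eq.trans ?_ (arrowEval_comp_left _ _).symm
      have h₁ := arrowConeApp_left p W x
      have h₂ := whiskerLeft_arrowFunctor_map_left p x y
      have h₃ := arrowConeApp_left p W y
      rw [MonoidalCategory.whiskerLeft_comp, Category.assoc]
      refine (congrArg _ h₃).trans ((natObjEval_act W F x y).trans ?_)
      exact congrArg₂ (fun a b => (α_ _ _ _).inv ≫ a ▷ _ ≫ b) h₁.symm h₂.symm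
    · refine Eq.trans ?_ (arrowEval_comp_right _ _).symm
      have h₁ := arrowConeApp_right p W x
      have h₂ := whiskerLeft_arrowFunctor_map_right p x y
      have h₃ := arrowConeApp_right p W y
      rw [MonoidalCategory.whiskerLeft_comp, Category.assoc]
      refine (congrArg _ h₃).trans ((natObjEval_act W G x y).trans ?_)
      exact congrArg₂ (fun a b => (α_ _ _ _).inv ≫ a ▷ _ ≫ b) h₁.symm h₂.symm

variable (X : Arrow V)

/-- On domains the comparison map, once transposed, is just the evaluation of `[D, V](W, F)`; this
identity and its analogue on codomains reduce the universal property of the cone to that of the two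
ends. -/
lemma comparison_arrowCone_left {T : V} (f : T ⟶ arrowHom V X (Arrow.mk (natObjMap W p)))
    (d : D) :
    X.left ◁ ((f ≫ comparison (arrowCone p W) X) ▷ W.obj d ≫
        coneEval W (arrowFunctor p) X d) ≫ arrowEvalLeft X (Arrow.mk (p.app d)) =
      (α_ _ _ _).inv ≫ (X.left ◁ f ≫ arrowEvalLeft X (Arrow.mk (natObjMap W p))) ▷ _ ≫
        natObjEval W F d := by
  rw [comp_whiskerRight, Category.assoc]
  refine (congrArg (fun a => X.left ◁ (f ▷ _ ≫ a) ≫ arrowEvalLeft X (Arrow.mk (p.app d)))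
    (comparison_eval (arrowCone p W) X d)).trans ?_
  refine (arrowEval_comp_left (Y := Arrow.mk (natObjMap W p)) (Z := Arrow.mk (p.app d))
    f (arrowConeApp p W d)).trans ?_
  exact congrArg (fun a => (α_ _ _ _).inv ≫
    (X.left ◁ f ≫ arrowEvalLeft X (Arrow.mk (natObjMap W p))) ▷ _ ≫ a) (arrowConeApp_left p W d)

lemma comparison_arrowCone_right {T : V} (f : T ⟶ arrowHom V X (Arrow.mk (natObjMap W p)))
    (d : D) :
    X.right ◁ ((f ≫ comparison (arrowCone p W) X) ▷ W.obj d ≫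
        coneEval W (arrowFunctor p) X d) ≫ arrowEvalRight X (Arrow.mk (p.app d)) =
      (α_ _ _ _).inv ≫ (X.right ◁ f ≫ arrowEvalRight X (Arrow.mk (natObjMap W p))) ▷ _ ≫
        natObjEval W G d := by
  rw [comp_whiskerRight, Category.assoc]
  refine (congrArg (fun a => X.right ◁ (f ▷ _ ≫ a) ≫ arrowEvalRight X (Arrow.mk (p.app d)))
    (comparison_eval (arrowCone p W) X d)).trans ?_
  refine (arrowEval_comp_right (Y := Arrow.mk (natObjMap W p)) (Z := Arrow.mk (p.app d))
    f (arrowConeApp p W d)).trans ?_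
  exact congrArg (fun a => (α_ _ _ _).inv ≫
    (X.right ◁ f ≫ arrowEvalRight X (Arrow.mk (natObjMap W p))) ▷ _ ≫ a)
    (arrowConeApp_right p W d)

lemma comparison_arrowCone_mono {T : V} {f g : T ⟶ arrowHom V X (Arrow.mk (natObjMap W p))}
    (h : f ≫ comparison (arrowCone p W) X = g ≫ comparison (arrowCone p W) X) : f = g := by
  apply arrowEval_ext
  · refine natObj_ext (F := W) (G := F) fun d => ?_
    rw [← cancel_epi (α_ _ _ _).inv]
    refine (comparison_arrowCone_left p W X f d).symm.trans (Eq.trans ?_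
      (comparison_arrowCone_left p W X g d))
    rw [h]
  · refine natObj_ext (F := W) (G := G) fun d => ?_
    rw [← cancel_epi (α_ _ _ _).inv]
    refine (comparison_arrowCone_right p W X f d).symm.trans (Eq.trans ?_
      (comparison_arrowCone_right p W X g d))
    rw [h]

/-- The family `(X.left ⊗ [D, V](W, V^𝟚(X, p-))) ⊗ W d ⟶ F d`. -/
def arrowUncurryLeft (d : D) :
    (X.left ⊗ natObj W ((arrowFunctor p).comp V (corep X))) ⊗ W.obj d ⟶ F.obj d :=
  (α_ _ _ _).hom ≫ X.left ◁ coneEval W (arrowFunctor p) X d ≫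
    arrowEvalLeft X (Arrow.mk (p.app d))

/-- The family `(X.right ⊗ [D, V](W, V^𝟚(X, p-))) ⊗ W d ⟶ G d`. -/
def arrowUncurryRight (d : D) :
    (X.right ⊗ natObj W ((arrowFunctor p).comp V (corep X))) ⊗ W.obj d ⟶ G.obj d :=
  (α_ _ _ _).hom ≫ X.right ◁ coneEval W (arrowFunctor p) X d ≫
    arrowEvalRight X (Arrow.mk (p.app d))

lemma arrowUncurryLeft_act (x y : D) :
    (X.left ⊗ natObj W ((arrowFunctor p).comp V (corep X))) ◁ act W x y ≫
        arrowUncurryLeft p W X y =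
      (α_ _ _ _).inv ≫ arrowUncurryLeft p W X x ▷ _ ≫ act F x y := by
  have h₁ := congrArg (fun a => X.left ◁ a ≫ arrowEvalLeft X (Arrow.mk (p.app y)))
    (coneEval_act W (arrowFunctor p) X x y)
  have h₂ := arrowEval_comp_left (Y := Arrow.mk (p.app x)) (Z := Arrow.mk (p.app y))
    (coneEval W (arrowFunctor p) X x) ((arrowFunctor p).map x y)
  have h₃ := whiskerLeft_arrowFunctor_map_left p x y
  unfold arrowUncurryLeft
  rw [associator_naturality_right_assoc, ← cancel_epi (α_ _ _ _).inv]
  rw [Iso.inv_hom_id_assoc, ← MonoidalCategory.whiskerLeft_comp_assoc]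
  refine h₁.trans ?_
  rw [MonoidalCategory.whiskerLeft_comp, Category.assoc]
  refine (congrArg _ h₂).trans ?_
  refine (congrArg (fun a => X.left ◁ (α_ _ _ _).inv ≫ (α_ _ _ _).inv ≫
    (X.left ◁ coneEval W (arrowFunctor p) X x ≫ arrowEvalLeft X (Arrow.mk (p.app x))) ▷ _ ≫ a)
    h₃).trans ?_
  simp

lemma arrowUncurryRight_act (x y : D) :
    (X.right ⊗ natObj W ((arrowFunctor p).comp V (corep X))) ◁ act W x y ≫
        arrowUncurryRight p W X y =
      (α_ _ _ _).inv ≫ arrowUncurryRight p W X x ▷ _ ≫ act G x y := by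
  have h₁ := congrArg (fun a => X.right ◁ a ≫ arrowEvalRight X (Arrow.mk (p.app y)))
    (coneEval_act W (arrowFunctor p) X x y)
  have h₂ := arrowEval_comp_right (Y := Arrow.mk (p.app x)) (Z := Arrow.mk (p.app y))
    (coneEval W (arrowFunctor p) X x) ((arrowFunctor p).map x y)
  have h₃ := whiskerLeft_arrowFunctor_map_right p x y
  unfold arrowUncurryRight
  rw [associator_naturality_right_assoc, ← cancel_epi (α_ _ _ _).inv]
  rw [Iso.inv_hom_id_assoc, ← MonoidalCategory.whiskerLeft_comp_assoc]
  refine h₁.trans ?_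
  rw [MonoidalCategory.whiskerLeft_comp, Category.assoc]
  refine (congrArg _ h₂).trans ?_
  refine (congrArg (fun a => X.right ◁ (α_ _ _ _).inv ≫ (α_ _ _ _).inv ≫
    (X.right ◁ coneEval W (arrowFunctor p) X x ≫ arrowEvalRight X (Arrow.mk (p.app x))) ▷ _ ≫ a)
    h₃).trans ?_
  simp

/-- The inverse of the comparison map for the limit cone on `[D, V](W, p)`. -/
def arrowComparisonInv :
    natObj W ((arrowFunctor p).comp V (corep X)) ⟶ arrowHom V X (Arrow.mk (natObjMap W p)) :=
  arrowCurry (X := X) (Y := Arrow.mk (natObjMap W p))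
    (natObjCurry (arrowUncurryLeft p W X) (arrowUncurryLeft_act p W X))
    (natObjCurry (arrowUncurryRight p W X) (arrowUncurryRight_act p W X)) <| by
    refine natObj_ext fun d => ?_
    have h := arrowEval_condition X (Arrow.mk (p.app d))
    have h₁ : ∀ {T : V} (f : T ⟶ natObj W F), (f ≫ (Arrow.mk (natObjMap W p)).hom) ▷ _ ≫
        natObjEval W G d = f ▷ _ ≫ natObjEval W F d ≫ p.app d := fun f => by
      rw [← natObjMap_eval, comp_whiskerRight_assoc]
      rfl
    refine (h₁ _).trans ?_
    rw [reassoc_of% natObjCurry_eval, comp_whiskerRight, Category.assoc, natObjCurry_eval]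
    unfold arrowUncurryLeft arrowUncurryRight
    simp only [Category.assoc]
    refine (congrArg (fun a => (α_ _ _ _).hom ≫ X.left ◁ coneEval W (arrowFunctor p) X d ≫ a)
      h).trans ?_
    refine (congrArg _ (whisker_exchange_assoc _ _ _)).trans ?_
    rw [associator_naturality_left_assoc]

lemma isWeightedLimit_arrowCone : IsWeightedLimit (arrowCone p W) := fun X => by
  have h : arrowComparisonInv p W X ≫ comparison (arrowCone p W) X = 𝟙 _ := by
    refine coneEval_ext fun d => ?_
    apply arrowEval_ext
    · refine (comparison_arrowCone_left p W X _ d).trans ?_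
      rw [arrowComparisonInv]
      refine (congrArg (fun a => (α_ _ _ _).inv ≫ a ▷ _ ≫ natObjEval W F d)
        (arrowCurry_left (X := X) (Y := Arrow.mk (natObjMap W p)) _ _ _)).trans ?_
      rw [natObjCurry_eval, arrowUncurryLeft, Iso.inv_hom_id_assoc, id_whiskerRight,
        Category.id_comp]
    · refine (comparison_arrowCone_right p W X _ d).trans ?_
      rw [arrowComparisonInv]
      refine (congrArg (fun a => (α_ _ _ _).inv ≫ a ▷ _ ≫ natObjEval W G d)
        (arrowCurry_right (X := X) (Y := Arrow.mk (natObjMap W p)) _ _ _)).trans ?_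
      rw [natObjCurry_eval, arrowUncurryRight, Iso.inv_hom_id_assoc, id_whiskerRight,
        Category.id_comp]
  -- The comparison is monic, so a one-sided inverse is a two-sided inverse.
  refine ⟨arrowComparisonInv p W X, comparison_arrowCone_mono p W X ?_, h⟩
  refine (Category.assoc _ _ _).trans ((congrArg _ h).trans ?_)
  exact (Category.comp_id _).trans (Category.id_comp _).symm

end PointwiseLimit

/-! ### Stability of shrinkable morphisms via pointwise limits -/

section EStable

variable {C : Type u₁} [EnrichedCategory V C] {W : Weight V D} {S : EnrichedFunctor V D C}

/-- The point of `[D, V](W, C(X, S-))` given by a cone. -/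
def conePoint {X : C} (η : VNatTrans W (S.comp V (corep X))) :
    𝟙_ V ⟶ natObj W (S.comp V (corep X)) := natObjPoint η

lemma conePoint_eval {X : C} (η : VNatTrans W (S.comp V (corep X))) (d : D) :
    conePoint η ▷ W.obj d ≫ coneEval W S X d = (λ_ _).hom ≫ coneHom η d :=
  natObjPoint_eval _ _

lemma eId_comparison {X : C} (η : VNatTrans W (S.comp V (corep X))) :
    eId V X ≫ comparison η X = conePoint η := by
  refine coneEval_ext fun d => ?_
  rw [conePoint_eval, comp_whiskerRight, Category.assoc, comparison_eval,
    ← whisker_exchange_assoc, id_whiskerLeft_assoc, ← Iso.eq_inv_comp]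
  simp

/-- Evaluating the comparison at a point `g` restricts the cone `η'` along `g`. With its converse
`comparison_precomp` this is the universal property of the cone on points. -/
lemma coneHom_precomp {X Y : C} (η : VNatTrans W (S.comp V (corep X)))
    (η' : VNatTrans W (S.comp V (corep Y))) {g : 𝟙_ V ⟶ (EnrichedCategory.Hom X Y : V)}
    (hg : g ≫ comparison η' X = conePoint η) (d : D) :
    coneHom η' d ≫ precomp g (S.obj d) = coneHom η d := by
  have h := congrArg (fun a => a ▷ W.obj d ≫ coneEval W S X d) hg
  rw [conePoint_eval, comp_whiskerRight, Category.assoc, comparison_eval,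
    ← whisker_exchange_assoc, id_whiskerLeft_assoc] at h
  rw [precomp, ← cancel_epi (λ_ (W.obj d)).hom, ← h]

lemma comparison_precomp {X Y : C} (η : VNatTrans W (S.comp V (corep X)))
    (η' : VNatTrans W (S.comp V (corep Y))) (g : 𝟙_ V ⟶ (EnrichedCategory.Hom X Y : V))
    (hg : ∀ d, coneHom η' d ≫ precomp g (S.obj d) = coneHom η d) :
    g ≫ comparison η' X = conePoint η := by
  refine coneEval_ext fun d => ?_
  rw [conePoint_eval, comp_whiskerRight, Category.assoc, comparison_eval,
    ← whisker_exchange_assoc, id_whiskerLeft_assoc, ← hg]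
  simp [precomp]

/-- Two limits of the same diagram are isomorphic; we only need a retraction. -/
lemma IsWeightedLimit.exists_retract {X Y : C} {η : VNatTrans W (S.comp V (corep X))}
    {η' : VNatTrans W (S.comp V (corep Y))} (hη : IsWeightedLimit η) (hη' : IsWeightedLimit η') :
    ∃ (i : 𝟙_ V ⟶ (EnrichedCategory.Hom X Y : V)) (r : 𝟙_ V ⟶ (EnrichedCategory.Hom Y X : V)),
      r ≫ precomp i X = eId V X := by
  have := hη X
  have := hη Y
  have := hη' X
  refine ⟨conePoint η ≫ inv (comparison η' X), conePoint η' ≫ inv (comparison η Y), ?_⟩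
  rw [← cancel_mono (comparison η X), eId_comparison]
  apply comparison_precomp
  intro d
  rw [← precomp_precomp, ← Category.assoc, coneHom_precomp η' η (by simp) d,
    coneHom_precomp η η' (by simp) d]

lemma comp_precomp {X Y Z : C} (i : 𝟙_ V ⟶ (EnrichedCategory.Hom X Y : V)) {T : V}
    (r : T ⟶ (EnrichedCategory.Hom Y Z : V)) :
    r ≫ precomp i Z = (λ_ _).inv ≫ i ▷ _ ≫ _ ◁ r ≫ eComp V X Y Z := by
  rw [precomp, leftUnitor_inv_naturality_assoc, whisker_exchange_assoc]

/-- The morphism on domains underlying a point of the hom-object of arrows. -/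
def arrowPointLeft {X Y : Arrow V} (i : 𝟙_ V ⟶ arrowHom V X Y) : X.left ⟶ Y.left :=
  (ρ_ _).inv ≫ X.left ◁ i ≫ arrowEvalLeft X Y

/-- The morphism on codomains underlying a point of the hom-object of arrows. -/
def arrowPointRight {X Y : Arrow V} (i : 𝟙_ V ⟶ arrowHom V X Y) : X.right ⟶ Y.right :=
  (ρ_ _).inv ≫ X.right ◁ i ≫ arrowEvalRight X Y

lemma arrowPoint_condition {X Y : Arrow V} (i : 𝟙_ V ⟶ arrowHom V X Y) :
    arrowPointLeft i ≫ Y.hom = X.hom ≫ arrowPointRight i := by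
  simp only [arrowPointLeft, arrowPointRight, Category.assoc, arrowEval_condition]
  rw [whisker_exchange_assoc, rightUnitor_inv_naturality_assoc]

lemma arrowPointLeft_comp {X Y Z : Arrow V} (i : 𝟙_ V ⟶ arrowHom V X Y)
    (r : 𝟙_ V ⟶ arrowHom V Y Z) :
    arrowPointLeft i ≫ arrowPointLeft r = arrowPointLeft (X := X) (Y := Z) (r ≫ precomp i Z) := by
  have h := arrowEval_comp_left i r
  have h' : (r ≫ precomp i Z : _ ⟶ arrowHom V X Z) =
      (λ_ _).inv ≫ i ▷ _ ≫ arrowHom V X Y ◁ r ≫ eComp V X Y Z :=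
    comp_precomp (V := V) (X := X) (Y := Y) (Z := Z) i r
  unfold arrowPointLeft
  rw [h', MonoidalCategory.whiskerLeft_comp]
  simp only [Category.assoc]
  refine Eq.trans ?_ (congrArg (fun a => (ρ_ _).inv ≫ X.left ◁ (λ_ _).inv ≫ a) h).symm
  simp

lemma arrowPointRight_comp {X Y Z : Arrow V} (i : 𝟙_ V ⟶ arrowHom V X Y)
    (r : 𝟙_ V ⟶ arrowHom V Y Z) :
    arrowPointRight i ≫ arrowPointRight r =
      arrowPointRight (X := X) (Y := Z) (r ≫ precomp i Z) := by
  have h := arrowEval_comp_right i r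
  have h' : (r ≫ precomp i Z : _ ⟶ arrowHom V X Z) =
      (λ_ _).inv ≫ i ▷ _ ≫ arrowHom V X Y ◁ r ≫ eComp V X Y Z :=
    comp_precomp (V := V) (X := X) (Y := Y) (Z := Z) i r
  unfold arrowPointRight
  rw [h', MonoidalCategory.whiskerLeft_comp]
  simp only [Category.assoc]
  refine Eq.trans ?_ (congrArg (fun a => (ρ_ _).inv ≫ X.right ◁ (λ_ _).inv ≫ a) h).symm
  simp

lemma arrowPointLeft_id (X : Arrow V) : arrowPointLeft (X := X) (eId V X) = 𝟙 _ := by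
  unfold arrowPointLeft
  refine (congrArg _ (eId_arrowEvalLeft X)).trans (Iso.inv_hom_id _)

lemma arrowPointRight_id (X : Arrow V) : arrowPointRight (X := X) (eId V X) = 𝟙 _ := by
  unfold arrowPointRight
  refine (congrArg _ (eId_arrowEvalRight X)).trans (Iso.inv_hom_id _)

/-- Stability of shrinkable morphisms under `W`-weighted limits, in terms of the functors
`[D, V](W, -)`. -/
lemma isEStable_iff [ModelCategory V] (W : Weight V D) :
    IsEStable W ↔ ∀ (F G : Weight V D) (p : VNatTrans F G),
      (∀ x, Shrinkable V (p.app x)) → Shrinkable V (natObjMap W p) := by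
  constructor
  · intro h F G p hp
    exact h (arrowFunctor p) hp _ _ (isWeightedLimit_arrowCone p W)
  · intro h S hS L η hη
    obtain ⟨F, G, p, rfl⟩ := exists_eq_arrowFunctor S
    -- An arbitrary limit is a retract of the pointwise one, so it inherits shrinkability from
    -- `natObjMap W p`.
    obtain ⟨i, r, hir⟩ := hη.exists_retract (isWeightedLimit_arrowCone p W)
    refine (h F G p hS).of_retract (arrowPointLeft i)
      (arrowPointLeft r) (arrowPointRight i) (arrowPointRight r)
      (arrowPoint_condition i) (arrowPoint_condition r) ?_ ?_
    · refine (arrowPointLeft_comp i r).trans ?_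
      rw [hir, arrowPointLeft_id]
    · refine (arrowPointRight_comp i r).trans ?_
      rw [hir, arrowPointRight_id]

end EStable

end ArrowLimits

/-! ### Powers as weighted limits -/

/-- The object type of a small copy of the unit `V`-category. -/
def PointCat (V : Type u) [Category.{v} V] : Type v := PUnit

section Powers

variable {V : Type u} [Category.{v} V] [MonoidalCategory V]

instance pointCatEnriched : EnrichedCategory V (PointCat V) where
  Hom _ _ := 𝟙_ V
  id _ := 𝟙 _
  comp _ _ _ := (λ_ (𝟙_ V)).hom
  id_comp _ _ := by simp
  comp_id _ _ := by simp [unitors_equal]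
  assoc _ _ _ _ := by simp [unitors_equal]

variable (V) in
/-- The object of the small unit `V`-category. -/
def pointCatStar : PointCat V := PUnit.unit

variable [SymmetricCategory V] [MonoidalClosed V]

/-- Every hom-object is the unit and every identity is `𝟙`, so the unit law for the action already
determines it. -/
lemma act_pointCat (F : Weight V (PointCat V)) (x y : PointCat V) :
    act F x y = (ρ_ (F.obj x)).hom := by
  have h := act_id F x
  have h' : F.obj x ◁ eId V x = 𝟙 (F.obj x ⊗ 𝟙_ V) := whiskerLeft_id _ _
  exact (Category.id_comp _).symm.trans ((congrArg (fun a => a ≫ act F x x) h').symm.trans h)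

/-- An object of `V` as a weight on the unit `V`-category. -/
def powerWeight (X : V) : Weight V (PointCat V) :=
  weightOfAct (fun _ => X) (fun _ _ => (ρ_ X).hom)
    (fun _ => (congrArg (· ≫ (ρ_ X).hom) (whiskerLeft_id X (𝟙_ V))).trans (Category.id_comp _))
    (fun _ _ _ => by
      change X ◁ (λ_ (𝟙_ V)).hom ≫ (ρ_ X).hom =
        (α_ X (𝟙_ V) (𝟙_ V)).inv ≫ (ρ_ X).hom ▷ 𝟙_ V ≫ (ρ_ X).hom
      rw [triangle_assoc_comp_right_assoc])

/-- The `V`-functor on the unit `V`-category selecting an object. -/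
def pointFunctor {C : Type u₁} [EnrichedCategory V C] (c : C) :
    EnrichedFunctor V (PointCat V) C where
  obj _ := c
  map _ _ := eId V c
  map_id _ := Category.id_comp _
  map_comp _ _ _ := by
    change (λ_ (𝟙_ V)).hom ≫ eId V c =
      ((eId V c ⊗ₘ eId V c) : 𝟙_ V ⊗ 𝟙_ V ⟶ _) ≫ eComp V c c c
    rw [← Iso.eq_inv_comp, MonoidalCategory.tensorHom_def', Category.assoc,
      ← leftUnitor_inv_naturality_assoc, e_id_comp, Category.comp_id]

variable [HasLimits V]

lemma pointCat_compatible (F G : Weight V (PointCat V)) {T : V}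
    (ψ : ∀ x, T ⊗ F.obj x ⟶ G.obj x) (x y : PointCat V) :
    T ◁ act F x y ≫ ψ y = (α_ _ _ _).inv ≫ ψ x ▷ _ ≫ act G x y := by
  rw [act_pointCat, act_pointCat]
  change T ◁ (ρ_ (F.obj x)).hom ≫ ψ x = (α_ T (F.obj x) (𝟙_ V)).inv ≫ ψ x ▷ 𝟙_ V ≫ _
  simp

/-- Over the unit `V`-category the end imposes no condition, since compatibility with the action is
automatic (`pointCat_compatible`); it is therefore the internal hom. -/
instance isIso_natObjπ_pointCat (F G : Weight V (PointCat V)) (x : PointCat V) :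
    IsIso (natObjπ F G x) := by
  let g : (ihom (F.obj x)).obj (G.obj x) ⟶ natObj F G :=
    natObjCurry (fun y => (β_ _ _).hom ≫ (ihom.ev (F.obj x)).app (G.obj x))
      (pointCat_compatible F G _)
  have hg : g ≫ natObjπ F G x = 𝟙 ((ihom (F.obj x)).obj (G.obj x)) := by
    apply MonoidalClosed.uncurry_injective
    rw [← cancel_epi (β_ _ _).hom, ← whiskerRight_natObjEval]
    refine (natObjCurry_eval _ _ x).trans (congrArg _ ?_)
    exact (MonoidalClosed.uncurry_id_eq_ev _ _).symm
  refine ⟨g, natObj_ext fun y => ?_, hg⟩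
  rw [whiskerRight_natObjEval, whiskerRight_natObjEval, Category.assoc]
  -- All objects of `PointCat V` are definitionally equal, so the component at `y` is the component
  -- at `x`.
  have h : natObjπ F G x ≫ g ≫ natObjπ F G y = 𝟙 _ ≫ natObjπ F G y := by
    refine (congrArg (natObjπ F G x ≫ ·) hg).trans ?_
    exact (Category.comp_id _).trans (Category.id_comp _).symm
  rw [h]

/-- `[X, -]` is a `V`-functor, so it carries the section and the homotopy of a shrinkable morphism
to a section and a homotopy of the image, along the same interval. -/
lemma isEStable_powerWeight [ModelCategory V] (W : Weight V (PointCat V)) : IsEStable W := by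
  rw [isEStable_iff]
  intro F G p hp
  -- Because there is only one object, the data chosen at `pointCatStar V` serve for every `x`, and
  -- a single interval suffices.
  have key : ∃ (s : ∀ x, G.obj x ⟶ F.obj x) (J : Interval V) (H : ∀ x, J.J ⊗ F.obj x ⟶ F.obj x),
      ∀ x, s x ≫ p.app x = 𝟙 _ ∧ J.d ▷ F.obj x ≫ H x = (λ_ _).hom ≫ p.app x ≫ s x ∧
        J.c ▷ F.obj x ≫ H x = (λ_ _).hom ∧
          H x ≫ p.app x = J.e ▷ F.obj x ≫ (λ_ _).hom ≫ p.app x := by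
    obtain ⟨s, hs, J, H, h⟩ := (shrinkable_iff _).1 (hp (pointCatStar V))
    exact ⟨fun _ => s, J, fun _ => H, fun _ => ⟨hs, h⟩⟩
  obtain ⟨s, J, H, h⟩ := key
  rw [shrinkable_iff]
  refine ⟨natObjCurry (fun x => natObjEval W G x ≫ s x) (pointCat_compatible W F _),
    natObj_ext fun x => ?_, J, natObjCurry (fun x => (α_ _ _ _).hom ≫
      J.J ◁ natObjEval W F x ≫ H x) (pointCat_compatible W F _),
    natObj_ext fun x => ?_, natObj_ext fun x => ?_, natObj_ext fun x => ?_⟩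
  all_goals obtain ⟨hs, hd, hc, he⟩ := h x
  · rw [comp_whiskerRight, Category.assoc, natObjMap_eval, reassoc_of% natObjCurry_eval,
      id_whiskerRight, Category.id_comp, Category.assoc, hs, Category.comp_id]
  · simp only [comp_whiskerRight, Category.assoc, natObjCurry_eval]
    rw [reassoc_of% natObjMap_eval, associator_naturality_left_assoc, ← whisker_exchange_assoc, hd,
      id_whiskerLeft_assoc]
    simp
  · rw [comp_whiskerRight, Category.assoc, natObjCurry_eval, associator_naturality_left_assoc,
      ← whisker_exchange_assoc, hc, id_whiskerLeft_assoc]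
    simp
  · simp only [comp_whiskerRight, Category.assoc, natObjMap_eval]
    rw [reassoc_of% natObjCurry_eval, Category.assoc, Category.assoc, he, whisker_exchange_assoc,
      id_whiskerLeft_assoc]
    simp

variable {C : Type u₁} [EnrichedCategory V C]

/-- `κ : X ⟶ C(P, c)` exhibits `P` as the power of `c` by `X`. -/
def IsPower {X : V} {P c : C} (κ : X ⟶ (EnrichedCategory.Hom P c : V)) : Prop :=
  ∀ B : C, IsIso (MonoidalClosed.curry
    ((β_ X (EnrichedCategory.Hom B P : V)).hom ≫
      (EnrichedCategory.Hom B P : V) ◁ κ ≫ eComp V B P c))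

/-- The cone on a power. -/
def powerCone {X : V} {P c : C} (κ : X ⟶ (EnrichedCategory.Hom P c : V)) :
    VNatTrans (powerWeight X) ((pointFunctor c).comp V (corep P)) :=
  coneOf (fun _ => κ) fun x y => by
    rw [act_pointCat]
    refine (rightUnitor_naturality κ).symm.trans (congrArg (κ ▷ 𝟙_ V ≫ ·) ?_)
    have h := e_comp_id V P c
    rw [Iso.inv_comp_eq, Category.comp_id] at h
    exact h.symm

/-- The two maps required to be invertible differ by the isomorphism `natObjπ` of the one-object
end. -/
lemma isPower_iff {X : V} {P c : C} (κ : X ⟶ (EnrichedCategory.Hom P c : V)) :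
    IsPower κ ↔ IsWeightedLimit (powerCone κ) := by
  refine forall_congr' fun B => ?_
  have h : comparison (powerCone κ) B ≫ natObjπ _ _ (pointCatStar V) =
    MonoidalClosed.curry ((β_ X (EnrichedCategory.Hom B P : V)).hom ≫
      (EnrichedCategory.Hom B P : V) ◁ κ ≫ eComp V B P c) := natObjLift_π _ _ _ _ _
  rw [← h]
  have hπ := isIso_natObjπ_pointCat (powerWeight X) ((pointFunctor c).comp V (corep B))
    (pointCatStar V)
  exact ⟨fun h' => @IsIso.of_isIso_comp_right _ _ _ _ _ _ _ hπ h',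
    fun h' => @IsIso.comp_isIso _ _ _ _ _ _ _ h' hπ⟩

lemma hasPowers_of_hasEStableLimits [ModelCategory V] (h : HasEStableLimits V C) :
    HasPowers V C := by
  intro X c
  obtain ⟨P, η, hη⟩ := h (PointCat V) (powerWeight X) (isEStable_powerWeight _) (pointFunctor c)
  refine ⟨P, coneHom η (pointCatStar V), ?_⟩
  exact (isPower_iff _).2 hη

end Powers

/-! ### Fibrewise homotopies between points -/

section Homotopy

variable {V : Type u} [Category.{v} V] [MonoidalCategory V] [ModelCategory V]

/-- Two points of `X` are homotopic over `p : X ⟶ Y` if some interval maps to `X` with these points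
as end points, and constantly to `Y`. -/
def HomotopicOver {X Y : V} (p : X ⟶ Y) (a b : 𝟙_ V ⟶ X) : Prop :=
  ∃ (J : Interval V) (h : J.J ⟶ X), J.d ≫ h = a ∧ J.c ≫ h = b ∧ h ≫ p = J.e ≫ a ≫ p

/-- Restrict the constancy condition to the second end point. The relation is thus symmetric
although its definition mentions only the image of `a`. -/
lemma HomotopicOver.comp_eq {X Y : V} {p : X ⟶ Y} {a b : 𝟙_ V ⟶ X} (h : HomotopicOver p a b) :
    a ≫ p = b ≫ p := by
  obtain ⟨J, h, hd, hc, he⟩ := h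
  have := J.c ≫= he
  rw [reassoc_of% hc, reassoc_of% J.c_e] at this
  exact this.symm

/-- The interval with its end points interchanged. -/
def Interval.swap (J : Interval V) : Interval V where
  J := J.J
  d := J.c
  c := J.d
  e := J.e
  d_e := J.c_e
  c_e := J.d_e
  cofibration := by
    have := J.cofibration
    have h : coprod.desc J.c J.d = (coprod.braiding _ _).hom ≫ coprod.desc J.d J.c := by
      ext
      · rw [coprod.inl_desc, coprod.braiding_hom, coprod.inl_desc_assoc, coprod.inr_desc]
      · rw [coprod.inr_desc, coprod.braiding_hom, coprod.inr_desc_assoc, coprod.inl_desc]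
    rw [h]
    infer_instance
  weakEquivalence := J.weakEquivalence

lemma HomotopicOver.symm {X Y : V} {p : X ⟶ Y} {a b : 𝟙_ V ⟶ X} (h : HomotopicOver p a b) :
    HomotopicOver p b a := by
  have h' := h.comp_eq
  obtain ⟨J, h, hd, hc, he⟩ := h
  exact ⟨J.swap, h, hc, hd, he.trans (congrArg (J.e ≫ ·) h')⟩

lemma HomotopicOver.map {X Y X' Y' : V} {p : X ⟶ Y} {a b : 𝟙_ V ⟶ X} (h : HomotopicOver p a b)
    {p' : X' ⟶ Y'} (f : X ⟶ X') (g : Y ⟶ Y') (hfg : f ≫ p' = p ≫ g) :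
    HomotopicOver p' (a ≫ f) (b ≫ f) := by
  obtain ⟨J, h, hd, hc, he⟩ := h
  exact ⟨J, h ≫ f, by rw [reassoc_of% hd], by rw [reassoc_of% hc], by simp [hfg, reassoc_of% he]⟩

/-- Factor `(d c)` as a cofibration followed by a trivial fibration: an interval-like object whose
end points need not form a cofibration can always be replaced by a genuine interval mapping to it.
-/
lemma exists_interval_of_weakEquivalence {K : V} (d c : 𝟙_ V ⟶ K) (e : K ⟶ 𝟙_ V)
    (hd : d ≫ e = 𝟙 _) (hc : c ≫ e = 𝟙 _) (he : WeakEquivalence e) :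
    ∃ (J : Interval V) (r : J.J ⟶ K), J.d ≫ r = d ∧ J.c ≫ r = c ∧ r ≫ e = J.e := by
  let φ := MorphismProperty.factorizationData (cofibrations V) (trivialFibrations V)
    (coprod.desc d c)
  have h₁ : coprod.inl ≫ φ.i ≫ φ.p = d := by rw [φ.fac, coprod.inl_desc]
  have h₂ : coprod.inr ≫ φ.i ≫ φ.p = c := by rw [φ.fac, coprod.inr_desc]
  refine ⟨{
    J := φ.Z
    d := coprod.inl ≫ φ.i
    c := coprod.inr ≫ φ.i
    e := φ.p ≫ e
    d_e := by simp only [Category.assoc, reassoc_of% h₁, hd]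
    c_e := by simp only [Category.assoc, reassoc_of% h₂, hc]
    cofibration := by
      have h : coprod.desc (coprod.inl ≫ φ.i) (coprod.inr ≫ φ.i) = φ.i := by
        ext
        · rw [coprod.inl_desc]
        · rw [coprod.inr_desc]
      rw [h]
      infer_instance
    weakEquivalence := inferInstance }, φ.p, ?_, ?_, rfl⟩
  · rw [Category.assoc, h₁]
  · rw [Category.assoc, h₂]

/-- The coprojection of the cofibrant `I` into `I + I` is a cofibration, and `d` is a section of a
weak equivalence. -/
lemma Interval.trivialCofibration_d (hI : IsCofibrant (𝟙_ V)) (J : Interval V) :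
    Cofibration J.d ∧ WeakEquivalence J.d := by
  have := J.cofibration
  have := J.weakEquivalence
  constructor
  · have h : J.d = coprod.inl ≫ coprod.desc J.d J.c := by rw [coprod.inl_desc]
    rw [h]
    infer_instance
  · exact weakEquivalence_of_postcomp_of_fac J.d_e

/-- Glue the two intervals end to end. The pushout of the trivial cofibration `J'.d` is a trivial
cofibration, so the glued object is weakly equivalent to `I`; it is then replaced by a genuine
interval. -/
lemma HomotopicOver.trans (hI : IsCofibrant (𝟙_ V)) {X Y : V} {p : X ⟶ Y} {a b c : 𝟙_ V ⟶ X}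
    (h : HomotopicOver p a b) (h' : HomotopicOver p b c) : HomotopicOver p a c := by
  have hab := h.comp_eq
  obtain ⟨J, h, hd, hc, he⟩ := h
  obtain ⟨J', h', hd', hc', he'⟩ := h'
  obtain ⟨_, _⟩ := J'.trivialCofibration_d hI
  have := J.weakEquivalence
  let e : pushout J.c J'.d ⟶ 𝟙_ V := pushout.desc J.e J'.e (by rw [J.c_e, J'.d_e])
  have he₁ : pushout.inl _ _ ≫ e = J.e := pushout.inl_desc _ _ _
  have : WeakEquivalence e := weakEquivalence_of_precomp_of_fac he₁
  obtain ⟨K, r, hrd, hrc, hre⟩ := exists_interval_of_weakEquivalence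
    (J.d ≫ pushout.inl J.c J'.d) (J'.c ≫ pushout.inr J.c J'.d) e
    (by rw [Category.assoc, pushout.inl_desc, J.d_e])
    (by rw [Category.assoc, pushout.inr_desc, J'.c_e]) this
  refine ⟨K, r ≫ pushout.desc h h' (by rw [hc, hd']), ?_, ?_, ?_⟩
  · rw [reassoc_of% hrd, pushout.inl_desc, hd]
  · rw [reassoc_of% hrc, pushout.inr_desc, hc']
  · rw [← hre, Category.assoc, Category.assoc]
    congr 1
    ext
    · rw [pushout.inl_desc_assoc, pushout.inl_desc_assoc, he]
    · rw [pushout.inr_desc_assoc, pushout.inr_desc_assoc, he', hab]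

/-- Lift the constant homotopy in the base against the cofibration `I + I ⟶ J`. -/
lemma homotopicOver_of_trivialFibration {X Y : V} {p : X ⟶ Y} (hp : trivialFibrations V p)
    {a b : 𝟙_ V ⟶ X} (h : a ≫ p = b ≫ p) : HomotopicOver p a b := by
  obtain ⟨_, _⟩ := (mem_trivialFibrations_iff p).1 hp
  -- Any interval will do; one exists by factoring the codiagonal of `I`.
  obtain ⟨J, r, -, -, hr⟩ := exists_interval_of_weakEquivalence (𝟙 (𝟙_ V)) (𝟙 _) (𝟙 _) (by simp)
    (by simp) inferInstance
  have := J.cofibration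
  have sq : CommSq (coprod.desc a b) (coprod.desc J.d J.c) p (J.e ≫ a ≫ p) := ⟨by
    ext
    · rw [coprod.inl_desc_assoc, coprod.inl_desc_assoc, reassoc_of% J.d_e]
    · rw [coprod.inr_desc_assoc, coprod.inr_desc_assoc, reassoc_of% J.c_e, h]⟩
  refine ⟨J, sq.lift, ?_, ?_, sq.fac_right⟩
  · have := coprod.inl ≫= sq.fac_left
    rwa [coprod.inl_desc_assoc, coprod.inl_desc] at this
  · have := coprod.inr ≫= sq.fac_left
    rwa [coprod.inr_desc_assoc, coprod.inr_desc] at this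

lemma exists_section_of_trivialFibration (hI : IsCofibrant (𝟙_ V)) {X : V} {p : X ⟶ 𝟙_ V}
    (hp : trivialFibrations V p) : ∃ a : 𝟙_ V ⟶ X, a ≫ p = 𝟙 _ := by
  obtain ⟨_, _⟩ := (mem_trivialFibrations_iff p).1 hp
  have sq : CommSq (initial.to X) (initial.to (𝟙_ V)) p (𝟙 _) := ⟨by simp⟩
  exact ⟨sq.lift, sq.fac_right⟩

end Homotopy

/-! ### Full sub-`V`-categories on families of objects -/

section FullOn

variable {V : Type u} [Category.{v} V] [MonoidalCategory V] {B : Type u₁} [EnrichedCategory V B]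

/-- The object type of the full sub-`V`-category on a family of objects. -/
def FullOn {ι : Type u₂} (_ : ι → B) : Type u₂ := ι

instance fullOnEnriched {ι : Type u₂} (f : ι → B) : EnrichedCategory V (FullOn f) where
  Hom i j := EnrichedCategory.Hom (f i) (f j)
  id i := eId V (f i)
  comp i j k := eComp V (f i) (f j) (f k)
  id_comp _ _ := e_id_comp V _ _
  comp_id _ _ := e_comp_id V _ _
  assoc _ _ _ _ := e_assoc V _ _ _ _

/-- The inclusion of the full sub-`V`-category on a family of objects. -/
def fullOnInclusion {ι : Type u₂} (f : ι → B) : EnrichedFunctor V (FullOn f) B where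
  obj i := f i
  map i j := 𝟙 _
  map_id i := Category.comp_id _
  map_comp i j k := by
    rw [Category.comp_id, id_tensorHom_id]
    exact (Category.id_comp _).symm

end FullOn

/-! ### The `V`-category of elements of a weight -/

section Elements

variable {V : Type u} [Category.{v} V] [MonoidalCategory V] [SymmetricCategory V]
  [MonoidalClosed V] [HasLimits V] {C : Type u₁} [EnrichedCategory V C]

/-- An element of a weight: a point of some value. -/
structure Elements (M : Weight V C) where
  base : C
  pt : 𝟙_ V ⟶ M.obj base

variable {M : Weight V C}

/-- The hom-object of elements: maps preserving the chosen points. -/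
def elHom (x y : Elements M) : V := pullback (evalAt M x.pt y.base) y.pt

/-- The underlying map in `C` of a map of elements. -/
def elFst (x y : Elements M) : elHom x y ⟶ (EnrichedCategory.Hom x.base y.base : V) :=
  pullback.fst _ _

/-- The augmentation of the hom-object of elements. -/
def elSnd (x y : Elements M) : elHom x y ⟶ 𝟙_ V := pullback.snd _ _

lemma elHom_condition (x y : Elements M) :
    elFst x y ≫ evalAt M x.pt y.base = elSnd x y ≫ y.pt := pullback.condition

/-- The universal property of the hom-object of elements. -/
def elLift {x y : Elements M} {T : V} (a : T ⟶ (EnrichedCategory.Hom x.base y.base : V))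
    (b : T ⟶ 𝟙_ V) (h : a ≫ evalAt M x.pt y.base = b ≫ y.pt) : T ⟶ elHom x y :=
  pullback.lift a b h

@[simp]
lemma elLift_fst {x y : Elements M} {T : V} (a : T ⟶ (EnrichedCategory.Hom x.base y.base : V))
    (b : T ⟶ 𝟙_ V) (h) : elLift a b h ≫ elFst x y = a := pullback.lift_fst _ _ _

@[simp]
lemma elLift_snd {x y : Elements M} {T : V} (a : T ⟶ (EnrichedCategory.Hom x.base y.base : V))
    (b : T ⟶ 𝟙_ V) (h) : elLift a b h ≫ elSnd x y = b := pullback.lift_snd _ _ _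

lemma elHom_ext {x y : Elements M} {T : V} {a b : T ⟶ elHom x y}
    (h₁ : a ≫ elFst x y = b ≫ elFst x y) (h₂ : a ≫ elSnd x y = b ≫ elSnd x y) : a = b :=
  pullback.hom_ext h₁ h₂

/-- The identity of an element. -/
def elId (x : Elements M) : 𝟙_ V ⟶ elHom x x :=
  elLift (eId V x.base) (𝟙 _) (by simp)

/-- Composition of maps of elements. -/
def elComp (x y z : Elements M) : elHom x y ⊗ elHom y z ⟶ elHom x z :=
  elLift ((elFst x y ⊗ₘ elFst y z) ≫ eComp V x.base y.base z.base)
    ((elSnd x y ⊗ₘ elSnd y z) ≫ (λ_ _).hom) (by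
      have h : y.pt ▷ _ ≫ act M y.base z.base = (λ_ _).hom ≫ evalAt M y.pt z.base := by
        simp [evalAt]
      rw [Category.assoc, eComp_evalAt, tensorHom_comp_whiskerRight_assoc, elHom_condition,
        ← tensorHom_comp_whiskerRight_assoc, h, MonoidalCategory.tensorHom_def, MonoidalCategory.tensorHom_def, Category.assoc,
        Category.assoc, Category.assoc, leftUnitor_naturality_assoc, elHom_condition,
        ← leftUnitor_naturality_assoc])

lemma elId_fst (x : Elements M) : elId x ≫ elFst x x = eId V x.base := elLift_fst _ _ _

lemma elId_snd (x : Elements M) : elId x ≫ elSnd x x = 𝟙 _ := elLift_snd _ _ _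

lemma elComp_fst (x y z : Elements M) : elComp x y z ≫ elFst x z =
    (elFst x y ⊗ₘ elFst y z) ≫ eComp V x.base y.base z.base := elLift_fst _ _ _

lemma elComp_snd (x y z : Elements M) : elComp x y z ≫ elSnd x z =
    (elSnd x y ⊗ₘ elSnd y z) ≫ (λ_ _).hom := elLift_snd _ _ _

instance elementsEnriched : EnrichedCategory V (Elements M) where
  Hom := elHom
  id := elId
  comp := elComp
  id_comp x y := by
    apply elHom_ext
    · rw [Category.assoc, Category.assoc, elComp_fst, whiskerRight_comp_tensorHom_assoc,
        elId_fst, MonoidalCategory.tensorHom_def', Category.assoc, ← leftUnitor_inv_naturality_assoc, e_id_comp,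
        Category.id_comp, Category.comp_id]
    · rw [Category.assoc, Category.assoc, elComp_snd, whiskerRight_comp_tensorHom_assoc,
        elId_snd, MonoidalCategory.tensorHom_def', Category.assoc, ← leftUnitor_inv_naturality_assoc]
      simp
  comp_id x y := by
    apply elHom_ext
    · rw [Category.assoc, Category.assoc, elComp_fst, whiskerLeft_comp_tensorHom_assoc,
        elId_fst, MonoidalCategory.tensorHom_def, Category.assoc, ← rightUnitor_inv_naturality_assoc, e_comp_id,
        Category.id_comp, Category.comp_id]
    · rw [Category.assoc, Category.assoc, elComp_snd, whiskerLeft_comp_tensorHom_assoc,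
        elId_snd, MonoidalCategory.tensorHom_def, Category.assoc, ← rightUnitor_inv_naturality_assoc]
      simp [unitors_equal]
  assoc x y z t := by
    apply elHom_ext
    · rw [Category.assoc, Category.assoc, Category.assoc, elComp_fst, elComp_fst,
        whiskerRight_comp_tensorHom_assoc, whiskerLeft_comp_tensorHom_assoc, elComp_fst,
        elComp_fst, ← tensorHom_comp_whiskerRight_assoc, ← tensorHom_comp_whiskerLeft_assoc,
        ← e_assoc, ← associator_inv_naturality_assoc]
    · rw [Category.assoc, Category.assoc, Category.assoc, elComp_snd, elComp_snd,
        whiskerRight_comp_tensorHom_assoc, whiskerLeft_comp_tensorHom_assoc, elComp_snd,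
        elComp_snd, ← tensorHom_comp_whiskerRight_assoc, ← tensorHom_comp_whiskerLeft_assoc,
        ← associator_inv_naturality_assoc]
      simp [unitors_equal]

end Elements

/-! ### Weak initial objects among elements -/

section WeakInitial

variable {V : Type u} [Category.{v} V] [MonoidalCategory V] [SymmetricCategory V]
  [MonoidalClosed V] {C : Type u₁} [EnrichedCategory V C]

lemma whiskerRight_act (M : Weight V C) {x y : C} (p : 𝟙_ V ⟶ M.obj x) {T : V}
    (g : T ⟶ (EnrichedCategory.Hom x y : V)) :
    p ▷ T ≫ M.obj x ◁ g ≫ act M x y = (λ_ T).hom ≫ g ≫ evalAt M p y := by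
  rw [evalAt, leftUnitor_inv_naturality_assoc, Iso.hom_inv_id_assoc, whisker_exchange_assoc]

lemma whiskerRight_eComp {x y z : C} (p : 𝟙_ V ⟶ (EnrichedCategory.Hom x y : V)) {T : V}
    (g : T ⟶ (EnrichedCategory.Hom y z : V)) :
    p ▷ T ≫ _ ◁ g ≫ eComp V x y z = (λ_ T).hom ≫ g ≫ precomp p z := by
  rw [precomp, leftUnitor_inv_naturality_assoc, Iso.hom_inv_id_assoc, whisker_exchange_assoc]

variable [HasLimits V]

lemma evalAt_coneHom {D : Type v} [EnrichedCategory V D] {W : Weight V D}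
    {S : EnrichedFunctor V D C} {L : C} (η : VNatTrans W (S.comp V (corep L))) {x : D}
    (a : 𝟙_ V ⟶ W.obj x) (y : D) :
    evalAt W a y ≫ coneHom η y = S.map x y ≫ precomp (a ≫ coneHom η x) (S.obj y) := by
  rw [evalAt, Category.assoc, Category.assoc, act_coneHom, ← comp_whiskerRight_assoc,
    whiskerRight_eComp, Iso.inv_hom_id_assoc]

variable (M : Weight V C)

/-- The weight sends the weighted limits which exist in `C` to limits in `V`. -/
def PreservesWeightedLimits : Prop :=
  ∀ (D : Type v) [EnrichedCategory V D] (W : Weight V D) (S : EnrichedFunctor V D C) (L : C)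
    (η : VNatTrans W (S.comp V (corep L))), IsWeightedLimit η → IsIso (weightComparison M η)

variable {M} {ι : Type v} (f : ι → Elements M)

/-- The diagram in `C` underlying a family of elements. -/
abbrev familyBase : EnrichedFunctor V (FullOn f) C where
  obj i := (f i).base
  map i j := elFst (f i) (f j)
  map_id i := elId_fst (f i)
  map_comp i j k := elComp_fst (f i) (f j) (f k)

/-- The augmentation of the `V`-category of a family of elements. -/
abbrev familyAug : EnrichedFunctor V (FullOn f) (UnitCat V) where
  obj _ := UnitCat.star
  map i j := elSnd (f i) (f j)
  map_id i := elId_snd (f i)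
  map_comp i j k := elComp_snd (f i) (f j) (f k)

variable {f} {Q : Weight V (FullOn f)}

/-- The action of maps of elements on a weight. -/
def elAct (Q : Weight V (FullOn f)) (i j : ι) :
    Q.obj i ⊗ elHom (f i) (f j) ⟶ Q.obj j := act Q i j

/-- The action of maps of elements on a point of a weight. -/
def elEval {i : ι} (a : 𝟙_ V ⟶ Q.obj i) (j : ι) : elHom (f i) (f j) ⟶ Q.obj j := evalAt Q a j

lemma elComp_elEval {i : ι} (a : 𝟙_ V ⟶ Q.obj i) (j k : ι) :
    elComp (f i) (f j) (f k) ≫ elEval a k = elEval a j ▷ _ ≫ elAct Q j k :=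
  eComp_evalAt Q a j k

variable (q : VNatTrans Q ((familyAug f).comp V (unitFunctor V)))

/-- The components of an augmentation of a weight. -/
def augHom (i : ι) : Q.obj i ⟶ 𝟙_ V := q.app i

lemma elAct_augHom (i j : ι) :
    elAct Q i j ≫ augHom q j = augHom q i ▷ _ ≫ (λ_ _).hom ≫ elSnd (f i) (f j) := by
  refine (q.act_app i j).trans ?_
  refine (congrArg _ (act_functorComp (familyAug f) (unitFunctor V) i j)).trans ?_
  change augHom q i ▷ _ ≫ 𝟙_ V ◁ elSnd (f i) (f j) ≫
    MonoidalClosed.uncurry (MonoidalClosed.curry (ρ_ (𝟙_ V)).hom) = _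
  rw [MonoidalClosed.uncurry_curry, id_whiskerLeft, ← unitors_equal]
  simp

/-- A point of `Q i` over the identity of `I` gives a Yoneda map from the hom-objects of elements to
`Q` that respects the augmentations. -/
lemma elEval_augHom {i : ι} {a : 𝟙_ V ⟶ Q.obj i} (ha : a ≫ augHom q i = 𝟙 _) (j : ι) :
    elEval a j ≫ augHom q j = elSnd (f i) (f j) := by
  change ((λ_ _).inv ≫ a ▷ _ ≫ elAct Q i j) ≫ _ = _
  rw [Category.assoc, Category.assoc, elAct_augHom, ← comp_whiskerRight_assoc, ha]
  simp

variable {L : C} (η : VNatTrans Q ((familyBase f).comp V (corep L)))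

/-- The components of a cone on a family of elements. -/
def familyCone (i : ι) : Q.obj i ⟶ (EnrichedCategory.Hom L (f i).base : V) := coneHom η i

lemma elEval_familyCone {i : ι} (a : 𝟙_ V ⟶ Q.obj i) (j : ι) :
    elEval a j ≫ familyCone η j =
      elFst (f i) (f j) ≫ precomp (a ≫ familyCone η i) (f j).base :=
  evalAt_coneHom η a j

lemma elAct_familyCone (i j : ι) :
    elAct Q i j ≫ familyCone η j =
      familyCone η i ▷ _ ≫ _ ◁ elFst (f i) (f j) ≫ eComp V L (f i).base (f j).base :=
  act_coneHom η i j

/-- The chosen points `(f i).pt`, pulled back along the augmentation, form a `Q`-cone of points in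
`M`. As `M` preserves the limit `L`, this cone is a point of `M L`, making `L` an element. -/
lemma exists_limitElement (hM : PreservesWeightedLimits M) (hη : IsWeightedLimit η) :
    ∃ x : 𝟙_ V ⟶ M.obj L, ∀ i, familyCone η i ≫ evalAt M x (f i).base =
      augHom q i ≫ (f i).pt := by
  have := hM _ _ _ _ η hη
  obtain ⟨z, hz⟩ : ∃ z : 𝟙_ V ⟶ natObj Q ((familyBase f).comp V M), ∀ i,
      z ▷ Q.obj i ≫ weightEval Q (familyBase f) M i =
        (λ_ _).hom ≫ augHom q i ≫ (f i).pt := by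
    refine ⟨weightCurry (S := familyBase f) (fun i => (λ_ _).hom ≫ augHom q i ≫ (f i).pt)
      fun i j => ?_, fun i => weightCurry_eval _ _ _⟩
    refine (leftUnitor_naturality_assoc _ _).trans ?_
    refine (congrArg ((λ_ _).hom ≫ ·) ((reassoc_of% (elAct_augHom q i j)) (f j).pt)).trans ?_
    rw [comp_whiskerRight, comp_whiskerRight, Category.assoc, Category.assoc]
    refine Eq.trans ?_ (congrArg (fun a => (α_ _ _ _).inv ≫ (λ_ _).hom ▷ _ ≫ augHom q i ▷ _ ≫ a)
      (whiskerRight_act M (f i).pt (elFst (f i) (f j)))).symm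
    rw [elHom_condition, leftUnitor_tensor_hom, Category.assoc]
  refine ⟨z ≫ inv (weightComparison M η), fun i => ?_⟩
  have h : (z ≫ inv (weightComparison M η)) ▷ Q.obj i ≫ M.obj L ◁ familyCone η i ≫
      act M L (f i).base = (λ_ _).hom ≫ augHom q i ≫ (f i).pt := by
    refine Eq.trans ?_ (hz i)
    refine (congrArg _ (weightComparison_eval M η i).symm).trans ?_
    rw [← comp_whiskerRight_assoc, Category.assoc, IsIso.inv_hom_id, Category.comp_id]
  rw [whiskerRight_act] at h
  exact (cancel_epi _).1 h

variable {q η}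

section

variable {x : 𝟙_ V ⟶ M.obj L}
    (hx : ∀ i, familyCone η i ≫ evalAt M x (f i).base = augHom q i ≫ (f i).pt) {i : ι}
    (a : 𝟙_ V ⟶ Q.obj i) (k : 𝟙_ V ⟶ (EnrichedCategory.Hom (f i).base L : V))
    (hk : k ≫ evalAt M (f i).pt L = x)

/-- The maps from a weight to the hom-objects of elements induced by a map of elements `k` from a
member of the family to the limit. -/
def weightToElHom (j : ι) : Q.obj j ⟶ elHom (f i) (f j) :=
  elLift (familyCone η j ≫ precomp k (f j).base) (augHom q j)
    (by rw [Category.assoc, precomp_evalAt, hk, hx])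

lemma weightToElHom_fst (j : ι) : weightToElHom hx k hk j ≫ elFst (f i) (f j) =
    familyCone η j ≫ precomp k (f j).base := elLift_fst _ _ _

lemma weightToElHom_snd (j : ι) : weightToElHom hx k hk j ≫ elSnd (f i) (f j) =
    augHom q j := elLift_snd _ _ _

lemma elAct_weightToElHom (j j' : ι) : elAct Q j j' ≫ weightToElHom hx k hk j' =
    weightToElHom hx k hk j ▷ _ ≫ elComp (f i) (f j) (f j') := by
  apply elHom_ext
  · rw [Category.assoc, weightToElHom_fst, Category.assoc, elComp_fst, ← Category.assoc,
      elAct_familyCone, whiskerRight_comp_tensorHom_assoc, weightToElHom_fst]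
    simp only [Category.assoc, eComp_precomp, MonoidalCategory.tensorHom_def,
      comp_whiskerRight, whisker_exchange_assoc]
  · rw [Category.assoc, weightToElHom_snd, Category.assoc, elComp_snd, elAct_augHom,
      whiskerRight_comp_tensorHom_assoc, weightToElHom_snd, MonoidalCategory.tensorHom_def,
      Category.assoc, leftUnitor_naturality]

lemma elAct_weightToElHom_elEval (j j' : ι) :
    elAct Q j j' ≫ weightToElHom hx k hk j' ≫ elEval a j' =
      (weightToElHom hx k hk j ≫ elEval a j) ▷ _ ≫ elAct Q j j' := by
  rw [comp_whiskerRight, Category.assoc, ← elComp_elEval, ← Category.assoc, ← Category.assoc,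
    elAct_weightToElHom]

/-- The endomorphism of the weight induced by a map of elements `k` from a member of the family
to the limit. -/
def weightEndo : VNatTrans Q Q :=
  VNatTrans.ofAct (fun j : ι => weightToElHom hx k hk j ≫ elEval a j)
    (elAct_weightToElHom_elEval hx a k hk)

lemma weightEndo_familyCone (j : ι) : (weightEndo hx a k hk).app j ≫ familyCone η j =
    familyCone η j ≫ precomp (k ≫ precomp (a ≫ familyCone η i) L) (f j).base := by
  change (weightToElHom hx k hk j ≫ elEval a j) ≫ _ = _
  rw [Category.assoc, elEval_familyCone, reassoc_of% weightToElHom_fst, precomp_precomp]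

lemma weightEndo_augHom (ha : a ≫ augHom q i = 𝟙 _) (j : ι) :
    (weightEndo hx a k hk).app j ≫ augHom q j = augHom q j := by
  change (weightToElHom hx k hk j ≫ elEval a j) ≫ _ = _
  rw [Category.assoc, elEval_augHom q ha, weightToElHom_snd]

lemma point_evalAt
    (hx : ∀ i, familyCone η i ≫ evalAt M x (f i).base = augHom q i ≫ (f i).pt)
    (a : 𝟙_ V ⟶ Q.obj i) (ha : a ≫ augHom q i = 𝟙 _) :
    (a ≫ familyCone η i) ≫ evalAt M x (f i).base = (f i).pt := by
  rw [Category.assoc, hx, reassoc_of% ha]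

/-- Translates endomorphisms of the weight into endomorphisms of the limit: if the restriction of
the cone along `g : L ⟶ L` is its composite with `ε`, then `ε` and `g` have the same image in `[Q,
C(L, S-)]`. -/
lemma natObjPoint_natObjMap_cone {ε : VNatTrans Q Q} {g : 𝟙_ V ⟶ (EnrichedCategory.Hom L L : V)}
    (h : ∀ j : ι, ε.app j ≫ familyCone η j = familyCone η j ≫ precomp g (f j).base) :
    natObjPoint ε ≫ natObjMap Q η = g ≫ comparison η L := by
  refine coneEval_ext fun j => ?_
  have h₁ := comparison_eval η L j
  have h₂ := natObjMap_eval Q η j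
  rw [comp_whiskerRight, comp_whiskerRight, Category.assoc, Category.assoc, h₁]
  refine (congrArg (natObjPoint ε ▷ Q.obj j ≫ ·) h₂).trans ?_
  rw [reassoc_of% natObjPoint_eval, whiskerRight_eComp]
  exact congrArg ((λ_ _).hom ≫ ·) (h j)

variable [ModelCategory V]

/-- The endomorphism `weightEndo` of `Q` agrees with the identity after the augmentation. Cofibrancy
of `Q` makes `[Q, q]` a trivial fibration, so the two are homotopic over it; composing with the cone
and inverting the comparison moves the homotopy to endomorphisms of `L`. -/
lemma homotopicOver_endo
    (hx : ∀ i, familyCone η i ≫ evalAt M x (f i).base = augHom q i ≫ (f i).pt)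
    (a : 𝟙_ V ⟶ Q.obj i) (k : 𝟙_ V ⟶ (EnrichedCategory.Hom (f i).base L : V))
    (hk : k ≫ evalAt M (f i).pt L = x) (hM : PreservesWeightedLimits M) (hη : IsWeightedLimit η)
    (hQ : IsCofibrantWeight Q) (hq : q.IsTrivialFibration) (ha : a ≫ augHom q i = 𝟙 _) :
    HomotopicOver (evalAt M x L) (k ≫ precomp (a ≫ familyCone η i) L) (eId V L) := by
  have := hM _ _ _ _ η hη
  have := hη L
  let ident : VNatTrans Q Q := VNatTrans.ofAct (fun j => 𝟙 _) (by simp)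
  have hε := weightEndo_augHom hx a k hk ha
  obtain ⟨J, H, hd, hc, he⟩ := homotopicOver_of_trivialFibration (hQ _ _ q hq)
    (a := natObjPoint (weightEndo hx a k hk)) (b := natObjPoint ident) (by
      refine natObj_ext fun j => ?_
      rw [comp_whiskerRight, comp_whiskerRight, Category.assoc, Category.assoc, natObjMap_eval,
        reassoc_of% natObjPoint_eval, reassoc_of% natObjPoint_eval]
      exact congrArg ((λ_ _).hom ≫ ·) ((hε j).trans (Category.id_comp _).symm))
  have hH (j : FullOn f) : H ▷ Q.obj j ≫ natObjEval Q Q j ≫ augHom q j =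
      J.e ▷ Q.obj j ≫ (λ_ _).hom ≫ augHom q j := by
    have h := congrArg (fun b => b ▷ Q.obj j ≫ natObjEval Q _ j) he
    simp only [comp_whiskerRight, Category.assoc, natObjMap_eval, reassoc_of% natObjPoint_eval] at h
    exact h.trans (congrArg (fun b => J.e ▷ Q.obj j ≫ (λ_ _).hom ≫ b) (hε j))
  have hval : (k ≫ precomp (a ≫ familyCone η i) L) ≫ evalAt M x L = x := by
    rw [Category.assoc, precomp_evalAt, point_evalAt hx a ha, hk]
  refine ⟨J, H ≫ natObjMap Q η ≫ inv (comparison η L), ?_, ?_, ?_⟩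
  · rw [reassoc_of% hd, reassoc_of% natObjPoint_natObjMap_cone (weightEndo_familyCone hx a k hk),
      IsIso.hom_inv_id, Category.comp_id]
  · have : natObjPoint ident ≫ natObjMap Q η = eId V L ≫ comparison η L :=
      natObjPoint_natObjMap_cone fun j => by
        rw [precomp_id]
        exact (Category.id_comp _).trans (Category.comp_id _).symm
    rw [reassoc_of% hc, reassoc_of% this, IsIso.hom_inv_id, Category.comp_id]
  -- That the homotopy lies over the constant point `x` is tested after the comparison for `M`,
  -- which is monic because `M` preserves the limit; there it reduces to `hx` and to `hH`, the
  -- constancy over the augmentation.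
  · rw [hval, ← cancel_mono (weightComparison M η)]
    refine weightEval_ext fun j => ?_
    have h₁ := weightComparison_eval M η j
    have h₂ := natObjMap_eval Q η j
    have h₃ := comparison_eval η L j
    have hR : ((J.e ≫ x) ≫ weightComparison M η) ▷ Q.obj j ≫ weightEval Q (familyBase f) M j =
        J.e ▷ Q.obj j ≫ (λ_ _).hom ≫ augHom q j ≫ (f j).pt := by
      rw [comp_whiskerRight, comp_whiskerRight, Category.assoc, Category.assoc, h₁,
        whiskerRight_act]
      exact congrArg (fun b => J.e ▷ _ ≫ (λ_ _).hom ≫ b) (hx j)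
    rw [hR, comp_whiskerRight, comp_whiskerRight, Category.assoc, Category.assoc, h₁]
    have h₄ : evalAt M x L ▷ Q.obj j ≫ M.obj L ◁ familyCone η j ≫ act M L (f j).base =
        (_ ◁ familyCone η j ≫ eComp V L L (f j).base) ≫ evalAt M x (f j).base := by
      rw [Category.assoc, eComp_evalAt, whisker_exchange_assoc]
    refine (congrArg (fun b => (H ≫ natObjMap Q η ≫ inv (comparison η L)) ▷ _ ≫ b) h₄).trans ?_
    refine (congrArg (fun b => (H ≫ natObjMap Q η ≫ inv (comparison η L)) ▷ _ ≫ b ≫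
      evalAt M x (f j).base) h₃.symm).trans ?_
    rw [Category.assoc, ← comp_whiskerRight_assoc, Category.assoc, Category.assoc,
      IsIso.inv_hom_id, Category.comp_id, comp_whiskerRight, Category.assoc]
    refine (congrArg (H ▷ _ ≫ ·) (Category.assoc _ _ _).symm).trans ?_
    refine (congrArg (fun b => H ▷ _ ≫ b) (congrArg (· ≫ evalAt M x (f j).base) h₂)).trans ?_
    have h₅ := congrArg (H ▷ Q.obj j ≫ natObjEval Q Q j ≫ ·) (hx j)
    have h₆ := congrArg (· ≫ (f j).pt) (hH j)
    simp only [Category.assoc] at h₆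
    exact (congrArg (H ▷ _ ≫ ·) (Category.assoc _ _ _)).trans (h₅.trans h₆)

/-- Parallel maps of elements `f i ⟶ f j` act on the point `a` to give two points of `Q j` over the
identity of `I`. These are homotopic because `Q j ⟶ I` is a trivial fibration, and the cone carries
the homotopy to `C(L, f j)`. -/
lemma homotopicOver_maps
    (hx : ∀ i, familyCone η i ≫ evalAt M x (f i).base = augHom q i ≫ (f i).pt)
    (a : 𝟙_ V ⟶ Q.obj i) (hq : q.IsTrivialFibration) (ha : a ≫ augHom q i = 𝟙 _) {j : ι}
    {u t : 𝟙_ V ⟶ (EnrichedCategory.Hom (f i).base (f j).base : V)}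
    (hu : u ≫ evalAt M (f i).pt (f j).base = (f j).pt)
    (ht : t ≫ evalAt M (f i).pt (f j).base = (f j).pt) :
    HomotopicOver (evalAt M x (f j).base) (u ≫ precomp (a ≫ familyCone η i) (f j).base)
      (t ≫ precomp (a ≫ familyCone η i) (f j).base) := by
  have aux {u : 𝟙_ V ⟶ (EnrichedCategory.Hom (f i).base (f j).base : V)}
      (hu : u ≫ evalAt M (f i).pt (f j).base = (f j).pt) : ∃ y : 𝟙_ V ⟶ Q.obj j,
        y ≫ augHom q j = 𝟙 _ ∧
          y ≫ familyCone η j = u ≫ precomp (a ≫ familyCone η i) (f j).base := by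
    refine ⟨elLift u (𝟙 _) (by rw [hu, Category.id_comp]) ≫ elEval a j, ?_, ?_⟩
    · rw [Category.assoc, elEval_augHom q ha, elLift_snd]
    · rw [Category.assoc, elEval_familyCone, reassoc_of% elLift_fst]
  obtain ⟨y, hy, hy'⟩ := aux hu
  obtain ⟨z, hz, hz'⟩ := aux ht
  have h : HomotopicOver (augHom q j) y z :=
    homotopicOver_of_trivialFibration (hq j) (hy.trans hz.symm)
  rw [← hy', ← hz']
  exact h.map _ _ (hx j)

end

/-- A family of elements of a limit-preserving weight admits a cone which is weakly initial up to
homotopy. -/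
lemma exists_weaklyInitial [ModelCategory V] (hI : IsCofibrant (𝟙_ V))
    (hC : HasEnoughCofibrantlyWeightedLimits V C) (hM : PreservesWeightedLimits M)
    (f : ι → Elements M) :
    ∃ (L : Elements M) (t : ∀ i, 𝟙_ V ⟶ (EnrichedCategory.Hom L.base (f i).base : V)),
      (∀ i, t i ≫ evalAt M L.pt (f i).base = (f i).pt) ∧
      (∀ i (k : 𝟙_ V ⟶ (EnrichedCategory.Hom (f i).base L.base : V)),
        k ≫ evalAt M (f i).pt L.base = L.pt →
          HomotopicOver (evalAt M L.pt L.base) (k ≫ precomp (t i) L.base) (eId V L.base)) ∧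
      ∀ i j (r s : 𝟙_ V ⟶ (EnrichedCategory.Hom (f i).base (f j).base : V)),
        r ≫ evalAt M (f i).pt (f j).base = (f j).pt →
        s ≫ evalAt M (f i).pt (f j).base = (f j).pt →
          HomotopicOver (evalAt M L.pt (f j).base) (r ≫ precomp (t i) (f j).base)
            (s ≫ precomp (t i) (f j).base) := by
  obtain ⟨Q, ⟨hQ, q, hq⟩, hlim⟩ := hC (FullOn f) (familyAug f)
  obtain ⟨L, η, hη⟩ := hlim (familyBase f)
  obtain ⟨x, hx⟩ := exists_limitElement q η hM hη
  have ha (i : ι) : ∃ a : 𝟙_ V ⟶ Q.obj i, a ≫ augHom q i = 𝟙 _ :=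
    exists_section_of_trivialFibration hI (hq i)
  choose a ha using ha
  exact ⟨⟨L, x⟩, fun i => a i ≫ familyCone η i, fun i => point_evalAt hx (a i) (ha i),
    fun i k hk => homotopicOver_endo hx (a i) k hk hM hη hQ hq (ha i),
    fun i j r s hr hs => homotopicOver_maps hx (a i) hq (ha i) hr hs⟩

end WeakInitial

/-! ### The weak adjoint functor theorem -/

section WeakAdjoint

variable {V : Type u} [Category.{v} V] [MonoidalCategory V] [SymmetricCategory V]
  [MonoidalClosed V] {C : Type u₁} [EnrichedCategory V C]

/-- Postcomposition `C(X, Y) ⟶ C(X, Z)` with a point of `C(Y, Z)`. -/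
def postcomp {Y Z : C} (g : 𝟙_ V ⟶ (EnrichedCategory.Hom Y Z : V)) (X : C) :
    (EnrichedCategory.Hom X Y : V) ⟶ (EnrichedCategory.Hom X Z : V) :=
  (ρ_ _).inv ≫ _ ◁ g ≫ eComp V X Y Z

lemma comp_postcomp {X Y Z : C} (a : 𝟙_ V ⟶ (EnrichedCategory.Hom X Y : V))
    (g : 𝟙_ V ⟶ (EnrichedCategory.Hom Y Z : V)) :
    a ≫ postcomp g X = g ≫ precomp a Z := by
  rw [postcomp, rightUnitor_inv_naturality_assoc, whiskerRight_eComp, ← unitors_inv_equal,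
    Iso.inv_hom_id_assoc]

lemma eId_postcomp {X Y : C} (g : 𝟙_ V ⟶ (EnrichedCategory.Hom X Y : V)) :
    eId V X ≫ postcomp g X = g := by
  rw [comp_postcomp, precomp_id, Category.comp_id]

lemma postcomp_evalAt (M : Weight V C) {X Y Z : C} (x : 𝟙_ V ⟶ M.obj X)
    (g : 𝟙_ V ⟶ (EnrichedCategory.Hom Y Z : V)) :
    postcomp g X ≫ evalAt M x Z = evalAt M x Y ≫ (ρ_ _).inv ≫ _ ◁ g ≫ act M Y Z := by
  rw [postcomp, Category.assoc, Category.assoc, eComp_evalAt, whisker_exchange_assoc,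
    rightUnitor_inv_naturality_assoc]

variable [HasLimits V]

lemma IsPower.exists_precomp_eq {X : V} {P a : C} {κ : X ⟶ (EnrichedCategory.Hom P a : V)}
    (hκ : IsPower κ) {B : C} (g : X ⟶ (EnrichedCategory.Hom B a : V)) :
    ∃ t : 𝟙_ V ⟶ (EnrichedCategory.Hom B P : V), κ ≫ precomp t a = g := by
  let φ := MonoidalClosed.curry ((β_ X (EnrichedCategory.Hom B P : V)).hom ≫
      (EnrichedCategory.Hom B P : V) ◁ κ ≫ eComp V B P a)
  have : IsIso φ := hκ B
  refine ⟨MonoidalClosed.curry ((ρ_ _).hom ≫ g) ≫ inv φ, ?_⟩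
  have h := congrArg MonoidalClosed.uncurry
    (Category.comp_id (MonoidalClosed.curry ((ρ_ X).hom ≫ g)))
  rw [← IsIso.inv_hom_id φ, ← Category.assoc, MonoidalClosed.uncurry_natural_left,
    MonoidalClosed.uncurry_curry, MonoidalClosed.uncurry_curry,
    BraidedCategory.braiding_naturality_right_assoc, whiskerRight_eComp,
    reassoc_of% braiding_leftUnitor] at h
  exact (cancel_epi _).1 h

variable {M : Weight V C}

/-- Preservation of the power says `M P ≅ [X, M a]`; on points, elements over `P` are maps `X ⟶ M
a`. -/
lemma exists_powerPoint {X : V} {P a : C} {κ : X ⟶ (EnrichedCategory.Hom P a : V)}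
    (hκ : IsIso (weightComparison M (powerCone κ))) (z : X ⟶ M.obj a) :
    ∃ y : 𝟙_ V ⟶ M.obj P, κ ≫ evalAt M y a = z := by
  let w : 𝟙_ V ⟶ natObj (powerWeight X) ((pointFunctor a).comp V M) :=
    weightCurry (W := powerWeight X) (S := pointFunctor a) (M := M) (T := 𝟙_ V)
      (fun _ => (λ_ X).hom ≫ z) (fun x y => by
        have := pointCat_compatible (powerWeight X) ((pointFunctor a).comp V M) (T := 𝟙_ V)
          (fun _ => (λ_ X).hom ≫ z) x y
        rwa [act_functorComp] at this)
  refine ⟨w ≫ inv (weightComparison M (powerCone κ)), ?_⟩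
  obtain ⟨ev, h₁, h₂⟩ : ∃ ev : natObj (powerWeight X) ((pointFunctor a).comp V M) ⊗ X ⟶ M.obj a,
      w ▷ X ≫ ev = (λ_ X).hom ≫ z ∧
        weightComparison M (powerCone κ) ▷ X ≫ ev = M.obj P ◁ κ ≫ act M P a :=
    ⟨weightEval (powerWeight X) (pointFunctor a) M (pointCatStar V),
      weightCurry_eval (W := powerWeight X) (S := pointFunctor a) _ _ _,
      weightComparison_eval M (powerCone κ) (pointCatStar V)⟩
  rw [← cancel_epi (λ_ X).hom, ← h₁, ← whiskerRight_act, ← h₂, ← comp_whiskerRight_assoc,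
    Category.assoc, IsIso.inv_hom_id, Category.comp_id]

lemma powerPoint_ext {X : V} {P a : C} {κ : X ⟶ (EnrichedCategory.Hom P a : V)}
    (hκ : IsIso (weightComparison M (powerCone κ))) {y z : 𝟙_ V ⟶ M.obj P}
    (h : κ ≫ evalAt M y a = κ ≫ evalAt M z a) : y = z := by
  rw [← cancel_mono (weightComparison M (powerCone κ))]
  refine weightEval_ext (W := powerWeight X) (S := pointFunctor a) fun d => ?_
  have h₁ := weightComparison_eval M (powerCone κ) d
  rw [comp_whiskerRight, comp_whiskerRight, Category.assoc, Category.assoc, h₁,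
    whiskerRight_act, whiskerRight_act]
  exact congrArg ((λ_ X).hom ≫ ·) h

variable (M) in
/-- Every element of `M` receives a map from a member of the family `f`. -/
def IsSolutionSet {ι : Type v} (f : ι → Elements M) : Prop :=
  ∀ y : Elements M, ∃ (i : ι) (g : 𝟙_ V ⟶ (EnrichedCategory.Hom (f i).base y.base : V)),
    g ≫ evalAt M (f i).pt y.base = y.pt

variable [ModelCategory V]

/-- Existence of maps out of `L` goes through the solution set. For uniqueness of `r, s : L ⟶ y`,
weakly equalize them by an element `L'` with a map `t' : L' ⟶ L`, and choose a map `L ⟶ f i ⟶ L'`.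
The composite `L ⟶ f i ⟶ L' ⟶ L` is homotopic to the identity, since it factors through the
projection to `f i`, and so `r` and `s` are homotopic. -/
lemma exists_homotopyInitial (hI : IsCofibrant (𝟙_ V))
    (hC : HasEnoughCofibrantlyWeightedLimits V C) (hM : PreservesWeightedLimits M)
    {ι : Type v} {f : ι → Elements M} (hf : IsSolutionSet M f) :
    ∃ L : Elements M, ∀ y : Elements M,
      (∃ g : 𝟙_ V ⟶ (EnrichedCategory.Hom L.base y.base : V),
        g ≫ evalAt M L.pt y.base = y.pt) ∧
      ∀ r s : 𝟙_ V ⟶ (EnrichedCategory.Hom L.base y.base : V),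
        r ≫ evalAt M L.pt y.base = y.pt → s ≫ evalAt M L.pt y.base = y.pt →
          HomotopicOver (evalAt M L.pt y.base) r s := by
  obtain ⟨L, t, ht, hL, -⟩ := exists_weaklyInitial hI hC hM f
  refine ⟨L, fun y => ⟨?_, fun r s hr hs => ?_⟩⟩
  · obtain ⟨i, g, hg⟩ := hf y
    exact ⟨g ≫ precomp (t i) _, by rw [Category.assoc, precomp_evalAt, ht, hg]⟩
  · obtain ⟨L', t', ht', -, hL'⟩ := exists_weaklyInitial hI hC hM
      (fun b : ULift.{v} Bool => bif b.down then L else y)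
    obtain ⟨i, g, hg⟩ := hf L'
    have hk : (g ≫ precomp (t i) L'.base) ≫ evalAt M L.pt L'.base = L'.pt := by
      rw [Category.assoc, precomp_evalAt, ht, hg]
    have ht₁ : t' ⟨true⟩ ≫ evalAt M L'.pt L.base = L.pt := ht' ⟨true⟩
    have h₁ := hL i (t' ⟨true⟩ ≫ precomp g L.base)
      (by rw [Category.assoc, precomp_evalAt, hg]; exact ht₁)
    have h₂ : HomotopicOver (evalAt M L'.pt y.base) (r ≫ precomp (t' ⟨true⟩) y.base)
        (s ≫ precomp (t' ⟨true⟩) y.base) := hL' ⟨true⟩ ⟨false⟩ r s hr hs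
    have h₃ := h₂.map (precomp (g ≫ precomp (t i) L'.base) y.base) (𝟙 _)
      (p' := evalAt M L.pt y.base) (by rw [precomp_evalAt, hk, Category.comp_id])
    -- Composing with `r` the homotopy from the endomorphism of `L` to the identity shows that the
    -- detour through `L'` does not change the homotopy class of `r`.
    have h₄ (r : 𝟙_ V ⟶ (EnrichedCategory.Hom L.base y.base : V)) :
        HomotopicOver (evalAt M L.pt y.base)
          ((r ≫ precomp (t' ⟨true⟩) y.base) ≫ precomp (g ≫ precomp (t i) L'.base) y.base) r := by
      have := h₁.map (postcomp r L.base) _ (postcomp_evalAt M L.pt r)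
      rw [eId_postcomp, comp_postcomp] at this
      rw [Category.assoc, precomp_precomp]
      rw [Category.assoc, precomp_precomp] at this
      exact this
    exact (h₄ r).symm.trans hI (h₃.trans hI (h₄ s))

/-- A limit-preserving weight with a solution set on a `V`-category with powers and enough
cofibrantly-weighted limits is weakly representable. -/
lemma exists_shrinkable_evalAt (hI : IsCofibrant (𝟙_ V)) (hP : HasPowers V C)
    (hC : HasEnoughCofibrantlyWeightedLimits V C) (hM : PreservesWeightedLimits M)
    {ι : Type v} {f : ι → Elements M} (hf : IsSolutionSet M f) :
    ∃ (c : C) (x : 𝟙_ V ⟶ M.obj c), ∀ a, Shrinkable V (evalAt M x a) := by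
  obtain ⟨L, hL⟩ := exists_homotopyInitial hI hC hM hf
  refine ⟨L.base, L.pt, fun a => (shrinkable_iff _).2 ?_⟩
  obtain ⟨s, hs⟩ : ∃ s : M.obj a ⟶ (EnrichedCategory.Hom L.base a : V),
      s ≫ evalAt M L.pt a = 𝟙 _ := by
    -- The power of `a` by `M a` carries the element naming the identity of `M a`; a map of elements
    -- from `L` to it transposes to a section of the evaluation.
    obtain ⟨P, κ, hκ⟩ := hP (M.obj a) a
    obtain ⟨y, hy⟩ := exists_powerPoint (hM _ _ _ _ _ ((isPower_iff κ).1 hκ)) (𝟙 _)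
    obtain ⟨g, hg⟩ := (hL ⟨P, y⟩).1
    exact ⟨κ ≫ precomp g a, by rw [Category.assoc, precomp_evalAt, hg, hy]⟩
  refine ⟨s, hs, ?_⟩
  -- The power of `a` by `C(L, a)` turns the two endomorphisms to be compared, `evalAt ≫ s` and the
  -- identity, into points `r, t : L ⟶ P`. They name the same element of `P` because `s` is a
  -- section, so they are homotopic.
  obtain ⟨P, κ, hκ⟩ := hP (EnrichedCategory.Hom L.base a : V) a
  obtain ⟨r, hr⟩ := IsPower.exists_precomp_eq hκ (evalAt M L.pt a ≫ s)
  obtain ⟨t, ht⟩ := IsPower.exists_precomp_eq hκ (𝟙 _)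
  have hrt : t ≫ evalAt M L.pt P = r ≫ evalAt M L.pt P := by
    refine powerPoint_ext (hM _ _ _ _ _ ((isPower_iff κ).1 hκ)) ?_
    rw [← precomp_evalAt, ← precomp_evalAt, reassoc_of% hr, reassoc_of% ht, hs, Category.comp_id]
  obtain ⟨J, h, hd, hc, he⟩ := (hL ⟨P, r ≫ evalAt M L.pt P⟩).2 r t rfl hrt
  refine ⟨J, h ▷ _ ≫ _ ◁ κ ≫ eComp V L.base P a, ?_, ?_, ?_⟩
  · rw [← comp_whiskerRight_assoc, hd, whiskerRight_eComp, hr]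
  · rw [← comp_whiskerRight_assoc, hc, whiskerRight_eComp, ht, Category.comp_id]
  · rw [Category.assoc, Category.assoc, eComp_evalAt, whisker_exchange_assoc,
      ← comp_whiskerRight_assoc, he, comp_whiskerRight_assoc, whiskerRight_act,
      ← precomp_evalAt, reassoc_of% hr, hs, Category.comp_id]

end WeakAdjoint

/-! ### Exchanging tensor factors -/

section SwapRight

variable {V : Type u} [Category.{v} V] [MonoidalCategory V] [SymmetricCategory V]

/-- The exchange of the last two factors of a threefold tensor product. -/
def swapRight (X Y Z : V) : (X ⊗ Y) ⊗ Z ⟶ (X ⊗ Z) ⊗ Y :=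
  (α_ X Y Z).hom ≫ X ◁ (β_ Y Z).hom ≫ (α_ X Z Y).inv

@[simp]
lemma swapRight_swapRight (X Y Z : V) : swapRight X Y Z ≫ swapRight X Z Y = 𝟙 _ := by
  simp only [swapRight, Category.assoc, Iso.inv_hom_id_assoc]
  rw [← MonoidalCategory.whiskerLeft_comp_assoc, SymmetricCategory.symmetry]
  simp

lemma swapRight_naturality_left {X X' : V} (f : X ⟶ X') (Y Z : V) :
    f ▷ Y ▷ Z ≫ swapRight X' Y Z = swapRight X Y Z ≫ f ▷ Z ▷ Y := by
  simp only [swapRight, Category.assoc, associator_naturality_left_assoc,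
    ← whisker_exchange_assoc, associator_inv_naturality_left]

lemma swapRight_naturality_middle (X : V) {Y Y' : V} (f : Y ⟶ Y') (Z : V) :
    (X ◁ f) ▷ Z ≫ swapRight X Y' Z = swapRight X Y Z ≫ (X ⊗ Z) ◁ f := by
  simp only [swapRight, Category.assoc, associator_naturality_middle_assoc,
    ← MonoidalCategory.whiskerLeft_comp_assoc, BraidedCategory.braiding_naturality_left]
  simp

lemma swapRight_naturality_right (X Y : V) {Z Z' : V} (f : Z ⟶ Z') :
    (X ⊗ Y) ◁ f ≫ swapRight X Y Z' = swapRight X Y Z ≫ (X ◁ f) ▷ Y := by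
  simp only [swapRight, Category.assoc, associator_naturality_right_assoc,
    ← MonoidalCategory.whiskerLeft_comp_assoc, BraidedCategory.braiding_naturality_right]
  simp

/-- A hexagon identity expanded, up to coherence of associators. -/
lemma swapRight_tensor_right (X Y Z T : V) :
    swapRight X Y (Z ⊗ T) ≫ (α_ X Z T).inv ▷ Y =
      (α_ (X ⊗ Y) Z T).inv ≫ swapRight X Y Z ▷ T ≫ swapRight (X ⊗ Z) Y T := by
  simp only [swapRight, BraidedCategory.braiding_tensor_right_hom]
  simp only [comp_whiskerRight, MonoidalCategory.whiskerLeft_comp, Category.assoc]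
  monoidal

lemma swapRight_tensor_middle (X Y Z T : V) :
    swapRight X (Y ⊗ Z) T ≫ (α_ (X ⊗ T) Y Z).inv =
      (α_ X Y Z).inv ▷ T ≫ swapRight (X ⊗ Y) Z T ≫ swapRight X Y T ▷ Z := by
  simp only [swapRight, BraidedCategory.braiding_tensor_left_hom]
  simp only [comp_whiskerRight, MonoidalCategory.whiskerLeft_comp, Category.assoc]
  monoidal

lemma swapRight_unit (X Y : V) :
    swapRight X (𝟙_ V) Y ≫ (ρ_ (X ⊗ Y)).hom = (ρ_ X).hom ▷ Y := by
  simp only [swapRight, braiding_tensorUnit_left, Category.assoc]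
  simp

lemma swapRight_unit_left (X Y : V) :
    (λ_ X).inv ▷ Y ≫ swapRight (𝟙_ V) X Y ≫ (λ_ Y).hom ▷ X = (β_ X Y).hom := by
  simp only [swapRight, Category.assoc, id_whiskerLeft]
  simp

end SwapRight

/-! ### Weights of natural transformations -/

section HomWeight

variable {V : Type u} [Category.{v} V] [MonoidalCategory V] [SymmetricCategory V]
  [MonoidalClosed V] {E : Type u₁} [EnrichedCategory V E] {D : Type v} [EnrichedCategory V D]

/-- The structure making a family of weights on `D` indexed by the objects of `E` into a
bimodule. -/
structure BimoduleAction (P : E → Weight V D) where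
  lact (e e' : E) (d : D) : (P e).obj d ⊗ (EnrichedCategory.Hom e e' : V) ⟶ (P e').obj d
  lact_id (e : E) (d : D) : (P e).obj d ◁ eId V e ≫ lact e e d = (ρ_ _).hom
  lact_comp (e e' e'' : E) (d : D) : (P e).obj d ◁ eComp V e e' e'' ≫ lact e e'' d =
    (α_ _ _ _).inv ≫ lact e e' d ▷ _ ≫ lact e' e'' d
  exchange (e e' : E) (d d' : D) : lact e e' d ▷ _ ≫ act (P e') d d' =
    swapRight _ _ _ ≫ act (P e) d d' ▷ _ ≫ lact e e' d'

variable {P : E → Weight V D} (A : BimoduleAction P)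

lemma BimoduleAction.act_lact (e e' : E) (d d' : D) : act (P e) d d' ▷ _ ≫ A.lact e e' d' =
    swapRight _ _ _ ≫ A.lact e e' d ▷ _ ≫ act (P e') d d' := by
  rw [A.exchange, reassoc_of% swapRight_swapRight]

variable [HasLimits V] (W : Weight V D)

/-- The action of `E` on the objects of natural transformations from `W`. -/
def homAct (e e' : E) : natObj W (P e) ⊗ (EnrichedCategory.Hom e e' : V) ⟶ natObj W (P e') :=
  natObjCurry (fun d => swapRight _ _ _ ≫ natObjEval W (P e) d ▷ _ ≫ A.lact e e' d) (by
    intro d d'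
    rw [reassoc_of% swapRight_naturality_right, ← comp_whiskerRight_assoc, natObjEval_act]
    simp only [comp_whiskerRight, Category.assoc]
    rw [A.exchange, reassoc_of% swapRight_naturality_left, reassoc_of% swapRight_tensor_right])

lemma homAct_eval (e e' : E) (d : D) : homAct A W e e' ▷ W.obj d ≫ natObjEval W (P e') d =
    swapRight _ _ _ ≫ natObjEval W (P e) d ▷ _ ≫ A.lact e e' d := natObjCurry_eval _ _ _

/-- The weight `e ↦ [D, V](W, P e)`. -/
def homWeight : Weight V E :=
  weightOfAct (fun e => natObj W (P e)) (homAct A W)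
    (fun e => by
      refine natObj_ext fun d => ?_
      rw [comp_whiskerRight, Category.assoc, homAct_eval, reassoc_of% swapRight_naturality_middle,
        whisker_exchange_assoc, A.lact_id, rightUnitor_naturality, reassoc_of% swapRight_unit])
    (fun e e' e'' => by
      refine natObj_ext fun d => ?_
      simp only [comp_whiskerRight, Category.assoc, homAct_eval]
      rw [reassoc_of% swapRight_naturality_middle, whisker_exchange_assoc, A.lact_comp,
        reassoc_of% swapRight_naturality_left, ← comp_whiskerRight_assoc, homAct_eval,
        associator_inv_naturality_left_assoc, reassoc_of% swapRight_tensor_middle]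
      simp only [comp_whiskerRight, Category.assoc])

/-- The evaluation of `e ↦ [D, V](W, P e)`. -/
def homWeightEval (e : E) (d : D) : (homWeight A W).obj e ⊗ W.obj d ⟶ (P e).obj d :=
  natObjEval W (P e) d

lemma homWeightEval_act (e : E) (d d' : D) :
    (homWeight A W).obj e ◁ act W d d' ≫ homWeightEval A W e d' =
      (α_ _ _ _).inv ≫ homWeightEval A W e d ▷ _ ≫ act (P e) d d' := natObjEval_act _ _ _ _

lemma act_homWeight_eval (e e' : E) (d : D) :
    act (homWeight A W) e e' ▷ W.obj d ≫ homWeightEval A W e' d =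
      swapRight _ _ _ ≫ homWeightEval A W e d ▷ _ ≫ A.lact e e' d := by
  have h : act (homWeight A W) e e' = homAct A W e e' := act_weightOfAct _ _ _ _ _ _
  rw [h]
  exact homAct_eval A W e e' d

lemma homWeight_ext {e : E} {T : V} {f g : T ⟶ (homWeight A W).obj e}
    (h : ∀ d, f ▷ W.obj d ≫ homWeightEval A W e d = g ▷ W.obj d ≫ homWeightEval A W e d) :
    f = g := natObj_ext h

lemma exists_homWeight_lift {e : E} {T : V} (ψ : ∀ d, T ⊗ W.obj d ⟶ (P e).obj d)
    (hψ : ∀ x y, T ◁ act W x y ≫ ψ y = (α_ _ _ _).inv ≫ ψ x ▷ _ ≫ act (P e) x y) :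
    ∃ f : T ⟶ (homWeight A W).obj e, ∀ d, f ▷ W.obj d ≫ homWeightEval A W e d = ψ d :=
  ⟨natObjCurry ψ hψ, natObjCurry_eval ψ hψ⟩

lemma evalAt_homWeight_eval {e : E} {x : 𝟙_ V ⟶ (homWeight A W).obj e} {d : D}
    {t : W.obj d ⟶ (P e).obj d} (h : x ▷ W.obj d ≫ homWeightEval A W e d = (λ_ _).hom ≫ t)
    (e' : E) : evalAt (homWeight A W) x e' ▷ W.obj d ≫ homWeightEval A W e' d =
      (β_ _ _).hom ≫ t ▷ _ ≫ A.lact e e' d := by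
  simp only [evalAt, comp_whiskerRight, Category.assoc, act_homWeight_eval]
  rw [reassoc_of% swapRight_naturality_left, ← comp_whiskerRight_assoc, h, comp_whiskerRight,
    Category.assoc, ← swapRight_unit_left]
  simp only [Category.assoc]

lemma IsWeightedLimit.hom_ext {W : Weight V D} {S : EnrichedFunctor V D E} {L : E}
    {η : VNatTrans W (S.comp V (corep L))} (hη : IsWeightedLimit η) {X : E} {T : V}
    {f g : T ⟶ (EnrichedCategory.Hom X L : V)}
    (h : ∀ x, f ▷ W.obj x ≫ _ ◁ coneHom η x ≫ eComp V X L (S.obj x) =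
      g ▷ W.obj x ≫ _ ◁ coneHom η x ≫ eComp V X L (S.obj x)) : f = g := by
  have := hη X
  refine (cancel_mono (comparison η X)).1 (coneEval_ext fun x => ?_)
  rw [comp_whiskerRight, comp_whiskerRight, Category.assoc, Category.assoc, comparison_eval, h]

lemma IsWeightedLimit.exists_lift {W : Weight V D} {S : EnrichedFunctor V D E} {L : E}
    {η : VNatTrans W (S.comp V (corep L))} (hη : IsWeightedLimit η) {X : E} {T : V}
    (ψ : ∀ x, T ⊗ W.obj x ⟶ (EnrichedCategory.Hom X (S.obj x) : V))
    (hψ : ∀ x y, T ◁ act W x y ≫ ψ y =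
      (α_ _ _ _).inv ≫ ψ x ▷ _ ≫ _ ◁ S.map x y ≫ eComp V X (S.obj x) (S.obj y)) :
    ∃ f : T ⟶ (EnrichedCategory.Hom X L : V),
      ∀ x, f ▷ W.obj x ≫ _ ◁ coneHom η x ≫ eComp V X L (S.obj x) = ψ x := by
  have := hη X
  refine ⟨coneCurry ψ hψ ≫ inv (comparison η X), fun x => ?_⟩
  rw [← comparison_eval, ← comp_whiskerRight_assoc, Category.assoc, IsIso.inv_hom_id,
    Category.comp_id, coneCurry_eval]

variable {D' : Type v} [EnrichedCategory V D'] {W' : Weight V D'} {S' : EnrichedFunctor V D' E}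
  {L : E} (η : VNatTrans W' (S'.comp V (corep L)))

/-- Limits commute with limits: if each `e ↦ P e d` carries the cone `η` to a limit in `V`, then so
does `e ↦ [D, V](W, P e)`. The hypotheses `hinj` and `hex` are uniqueness and existence for that
limit, stated for maps out of tensor products so that the two weights can be exchanged by
`swapRight`. -/
lemma isIso_weightComparison_homWeight
    (hinj : ∀ (d : D) (T : V) (f g : T ⟶ (P L).obj d),
      (∀ x, f ▷ W'.obj x ≫ _ ◁ coneHom η x ≫ A.lact L (S'.obj x) d =
        g ▷ W'.obj x ≫ _ ◁ coneHom η x ≫ A.lact L (S'.obj x) d) → f = g)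
    (hex : ∀ (d : D) (T : V) (ψ : ∀ x, T ⊗ W'.obj x ⟶ (P (S'.obj x)).obj d),
      (∀ x y, T ◁ act W' x y ≫ ψ y =
        (α_ _ _ _).inv ≫ ψ x ▷ _ ≫ _ ◁ S'.map x y ≫ A.lact (S'.obj x) (S'.obj y) d) →
      ∃ f : T ⟶ (P L).obj d, ∀ x, f ▷ W'.obj x ≫ _ ◁ coneHom η x ≫
        A.lact L (S'.obj x) d = ψ x) :
    IsIso (weightComparison (homWeight A W) η) := by
  have hcmp (x : D') (d : D) {T : V} (f : T ⟶ (homWeight A W).obj L) :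
      (f ▷ W'.obj x ≫ _ ◁ coneHom η x ≫ act (homWeight A W) L (S'.obj x)) ▷ W.obj d ≫
        homWeightEval A W (S'.obj x) d = swapRight _ _ _ ≫
          (f ▷ W.obj d ≫ homWeightEval A W L d) ▷ W'.obj x ≫ _ ◁ coneHom η x ≫
            A.lact L (S'.obj x) d := by
    simp only [comp_whiskerRight, Category.assoc]
    rw [act_homWeight_eval, reassoc_of% swapRight_naturality_middle, reassoc_of% swapRight_naturality_left,
      whisker_exchange_assoc]
  let T := natObj W' (S'.comp V (homWeight A W))
  let τ (x : D') : T ⊗ W'.obj x ⟶ (homWeight A W).obj (S'.obj x) :=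
    weightEval W' S' (homWeight A W) x
  have hτ (x y : D') : T ◁ act W' x y ≫ τ y = (α_ _ _ _).inv ≫ τ x ▷ _ ≫ _ ◁ S'.map x y ≫
      act (homWeight A W) (S'.obj x) (S'.obj y) := weightEval_act W' S' (homWeight A W) x y
  have hκ (d : D) : ∃ κ : T ⊗ W.obj d ⟶ (P L).obj d, ∀ x, κ ▷ W'.obj x ≫ _ ◁ coneHom η x ≫
      A.lact L (S'.obj x) d = swapRight _ _ _ ≫ τ x ▷ W.obj d ≫
        homWeightEval A W (S'.obj x) d := by
    refine hex d _ (fun x => swapRight _ _ _ ≫ τ x ▷ W.obj d ≫ homWeightEval A W (S'.obj x) d)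
      fun x y => ?_
    rw [reassoc_of% swapRight_naturality_right, ← comp_whiskerRight_assoc, hτ]
    simp only [comp_whiskerRight, Category.assoc]
    rw [act_homWeight_eval, reassoc_of% swapRight_naturality_middle, reassoc_of% swapRight_naturality_left,
      whisker_exchange_assoc, reassoc_of% swapRight_tensor_right, reassoc_of% swapRight_swapRight]
  choose κ hκ using hκ
  -- The pointwise lifts `κ d` assemble into a transformation out of `W`: by `hinj` compatibility
  -- may be tested against the cone, where it follows from the exchange law of the bimodule.
  obtain ⟨k, hk⟩ := exists_homWeight_lift A W κ fun d d' => by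
    refine hinj d' _ _ _ fun x => ?_
    rw [comp_whiskerRight, Category.assoc, hκ, reassoc_of% swapRight_naturality_middle,
      whisker_exchange_assoc, homWeightEval_act]
    simp only [comp_whiskerRight, Category.assoc]
    rw [← whisker_exchange_assoc, A.act_lact, reassoc_of% swapRight_naturality_right,
      reassoc_of% swapRight_naturality_left, ← comp_whiskerRight_assoc, ← comp_whiskerRight_assoc,
      Category.assoc, hκ, associator_inv_naturality_left_assoc, reassoc_of% swapRight_tensor_middle]
    simp only [comp_whiskerRight, Category.assoc]
  have hwc (x : D') : weightComparison (homWeight A W) η ▷ W'.obj x ≫ τ x =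
    _ ◁ coneHom η x ≫ act (homWeight A W) L (S'.obj x) := weightComparison_eval _ _ _
  refine ⟨k, homWeight_ext A W fun d => hinj d _ _ _ fun x => ?_, weightEval_ext fun x =>
    homWeight_ext A W fun d => ?_⟩
  · have h := hcmp x d (𝟙 _)
    rw [id_whiskerRight, Category.id_comp] at h
    rw [comp_whiskerRight (weightComparison _ _) k, Category.assoc, hk, comp_whiskerRight,
      Category.assoc, hκ, reassoc_of% swapRight_naturality_left, ← comp_whiskerRight_assoc, hwc, h,
      reassoc_of% swapRight_swapRight]
  · change ((k ≫ weightComparison (homWeight A W) η) ▷ W'.obj x ≫ τ x) ▷ _ ≫ _ =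
      (𝟙 T ▷ W'.obj x ≫ τ x) ▷ _ ≫ homWeightEval A W (S'.obj x) d
    rw [comp_whiskerRight k, Category.assoc, hwc, hcmp, hk, hκ, reassoc_of% swapRight_swapRight,
      id_whiskerRight, Category.id_comp]

end HomWeight

/-! ### The weight of weighted cocones -/

section CoconeWeight

variable {V : Type u} [Category.{v} V] [MonoidalCategory V] [SymmetricCategory V]
  [MonoidalClosed V] {C : Type u₁} [EnrichedCategory V C] {D : Type v} [EnrichedCategory V D]

lemma eComp_op (x y z : C) : eComp V (op x) (op y) (op z) =
    ((β_ _ _).hom ≫ eComp V z y x :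
      (EnrichedCategory.Hom y x : V) ⊗ (EnrichedCategory.Hom z y : V) ⟶ _) :=
  eComp_op_eq V (op z) (op y) (op x)

lemma act_opFunctor_corep (S : EnrichedFunctor V D C) (a : C) (d d' : Dᵒᵖ) :
    act ((opFunctor S).comp V (corep (op a))) d d' =
      ((EnrichedCategory.Hom (S.obj d.unop) a : V) ◁ S.map d'.unop d.unop ≫ (β_ _ _).hom ≫
        eComp V (S.obj d'.unop) (S.obj d.unop) a :) := by
  rw [act_functorComp, act_corep]
  exact congrArg (_ ◁ S.map d'.unop d.unop ≫ ·) (eComp_op a _ _)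

/-- Precomposition and postcomposition commute, by associativity. -/
lemma eComp_exchange (S : EnrichedFunctor V D C) (a a' : C) (d d' : D) :
    eComp V (S.obj d) a a' ▷ _ ≫ (_ ◁ S.map d' d ≫ (β_ _ _).hom ≫
        eComp V (S.obj d') (S.obj d) a') =
      swapRight _ _ _ ≫ (_ ◁ S.map d' d ≫ (β_ _ _).hom ≫
        eComp V (S.obj d') (S.obj d) a) ▷ _ ≫ eComp V (S.obj d') a a' := by
  rw [← whisker_exchange_assoc, comp_whiskerRight, Category.assoc,
    ← reassoc_of% swapRight_naturality_right]
  congr 1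
  rw [BraidedCategory.braiding_naturality_left_assoc, ← e_assoc]
  simp only [swapRight, comp_whiskerRight, Category.assoc, BraidedCategory.braiding_tensor_left_hom,
    Iso.hom_inv_id_assoc]

/-- The bimodule `C(S-, -)`. -/
def coconeAction (S : EnrichedFunctor V D C) :
    BimoduleAction fun a : C => (opFunctor S).comp V (corep (V := V) (op a)) where
  lact a a' d := eComp V (S.obj d.unop) a a'
  lact_id a d := by
    have h := act_id (corep (V := V) (S.obj d.unop)) a
    rwa [act_corep] at h
  lact_comp a a' a'' d := by
    have h := act_comp (corep (V := V) (S.obj d.unop)) a a' a''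
    rwa [act_corep, act_corep, act_corep] at h
  exchange a a' d d' := by
    rw [act_opFunctor_corep, act_opFunctor_corep]
    exact eComp_exchange S a a' d.unop d'.unop

variable [HasLimits V]

/-- The weight `a ↦ [Dᵒᵖ, V](W, C(S-, a))`. -/
def coconeWeight (W : Weight V Dᵒᵖ) (S : EnrichedFunctor V D C) : Weight V C :=
  homWeight (coconeAction S) W

/-- For each `d`, the representable `C(S d, -)` preserves the limit by its very definition, and an
end of such functors still does. -/
lemma preservesWeightedLimits_coconeWeight (W : Weight V Dᵒᵖ) (S : EnrichedFunctor V D C) :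
    PreservesWeightedLimits (coconeWeight W S) := by
  intro D' _ W' S' L η hη
  refine isIso_weightComparison_homWeight (coconeAction S) W η (fun d T f g h => ?_)
    (fun d T ψ hψ => ?_)
  · exact hη.hom_ext h
  · exact hη.exists_lift ψ hψ

/-- By Yoneda the comparison is evaluation at the cone itself, so a weak colimit is the same as a
weak representation of `coconeWeight`. -/
lemma comparison_eq_evalAt (W : Weight V Dᵒᵖ) (S : EnrichedFunctor V D C) {c : C}
    (η : VNatTrans W ((opFunctor S).comp V (corep (op c)))) (a : C) :
    comparison η (op a) = evalAt (coconeWeight W S) (x := c) (conePoint η) a := by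
  refine coneEval_ext fun d => ?_
  rw [comparison_eval]
  refine Eq.trans ?_ (evalAt_homWeight_eval (coconeAction S) W (conePoint_eval η d) a).symm
  rw [eComp_op]
  exact BraidedCategory.braiding_naturality_right_assoc _ _ _

lemma exists_conePoint_eq {D : Type v} [EnrichedCategory V D] {W : Weight V D}
    {S : EnrichedFunctor V D C} {X : C} (x : 𝟙_ V ⟶ natObj W (S.comp V (corep X))) :
    ∃ η : VNatTrans W (S.comp V (corep X)), conePoint η = x := by
  refine ⟨natTransOfPoint x, natObj_ext fun d => ?_⟩
  rw [conePoint, natObjPoint_eval, natTransOfPoint_app, Iso.hom_inv_id_assoc]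

end CoconeWeight

/-! ### Raising the index of accessibility -/

section RaiseIndex

/-- With `l = max ν κ`, take `μ` to be the successor of `2 ^ l`: a set of cardinality at most `2 ^
l` has at most `(2 ^ l) ^ κ = 2 ^ l` subsets of cardinality less than `κ`, so the full poset of
these is itself small enough. This is the sharp inequality that allows fewer than `μ` elements of a
`κ`-directed poset to be enclosed in a `κ`-directed subset of cardinality less than `μ`. -/
lemma exists_regular_cofinal (κ ν : Cardinal.{v}) [hκ : Fact κ.IsRegular] :
    ∃ (μ : Cardinal.{v}) (_ : Fact μ.IsRegular), κ < μ ∧ ν < μ ∧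
      ∀ (X : Type v) (_ : HasCardinalLT X μ),
        ∃ Y : Set (CardinalDirectedPoset.SetCardinalLT κ X), HasCardinalLT Y μ ∧ IsCofinal Y := by
  have hκ₀ : Cardinal.aleph0 ≤ κ := hκ.out.aleph0_le
  let l := max ν κ
  have hl : Cardinal.aleph0 ≤ l := hκ₀.trans (le_max_right _ _)
  have hl' : l < 2 ^ l := Cardinal.cantor l
  have hμ : (Order.succ ((2 : Cardinal.{v}) ^ l)).IsRegular :=
    Cardinal.isRegular_succ (hl.trans hl'.le)
  have hlt (c : Cardinal.{v}) (hc : c ≤ l) : c < Order.succ ((2 : Cardinal.{v}) ^ l) :=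
    (hc.trans_lt hl').trans (Order.lt_succ _)
  refine ⟨_, ⟨hμ⟩, hlt _ (le_max_right _ _), hlt _ (le_max_left _ _), fun X hX => ?_⟩
  refine ⟨Set.univ, ?_, fun a => ⟨a, trivial, le_rfl⟩⟩
  rw [hasCardinalLT_iff_cardinal_mk_lt, Order.lt_succ_iff] at hX ⊢
  have h₁ : Cardinal.mk (CardinalDirectedPoset.SetCardinalLT κ X) ≤
      Cardinal.mk { t : Set X // Cardinal.mk t ≤ κ } :=
    Cardinal.mk_subtype_mono fun t ht => ((hasCardinalLT_iff_cardinal_mk_lt _ _).1 ht).le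
  rw [Cardinal.mk_univ]
  refine h₁.trans ((Cardinal.mk_bounded_set_le X κ).trans ?_)
  calc max (Cardinal.mk X) Cardinal.aleph0 ^ κ ≤ ((2 : Cardinal.{v}) ^ l) ^ κ :=
        Cardinal.power_le_power_right (max_le hX (hl.trans hl'.le))
    _ = 2 ^ l := by
        rw [← Cardinal.power_mul, Cardinal.mul_eq_left hl (le_max_right _ _)
          (Cardinal.aleph0_pos.trans_le hκ₀).ne']

variable {C : Type u} [Category.{v} C] (κ μ : Cardinal.{v}) [Fact κ.IsRegular] [Fact μ.IsRegular]
  [HasCardinalFilteredColimits C κ] {α : Type v} [PartialOrder α]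

variable (α) in
/-- The poset of `κ`-directed subsets of cardinality `< μ`. -/
abbrev SmallDirectedSet : Type v :=
  { B : Set α // IsCardinalFiltered B κ ∧ HasCardinalLT B μ }

variable {κ μ}

/-- The inclusion of a directed subset. -/
abbrev SmallDirectedSet.incl (B : SmallDirectedSet κ μ α) : B.1 ⥤ α :=
  (Subtype.mono_coe (· ∈ B.1)).functor

instance (B : SmallDirectedSet κ μ α) : HasColimitsOfShape B.1 C :=
  have := B.2.1
  HasCardinalFilteredColimits.hasColimitsOfShape C κ B.1

variable (F : α ⥤ C)

/-- The cocone on the restriction of `F` to a smaller directed subset. -/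
abbrev stageCocone {B B' : SmallDirectedSet κ μ α} (h : B ⟶ B') : Cocone (B.incl ⋙ F) :=
  Cocone.mk (colimit (B'.incl ⋙ F))
    { app b := colimit.ι (B'.incl ⋙ F) ⟨b.1, leOfHom h b.2⟩
      naturality b b' g := by
        have := colimit.w (B'.incl ⋙ F)
          (homOfLE (leOfHom g) : (⟨b.1, leOfHom h b.2⟩ : B'.1) ⟶ ⟨b'.1, leOfHom h b'.2⟩)
        exact this.trans (Category.comp_id _).symm }

/-- The diagram of colimits over the small directed subsets. -/
def smallDirectedColimit : SmallDirectedSet κ μ α ⥤ C where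
  obj B := colimit (B.incl ⋙ F)
  map {B B'} h := colimit.desc (B.incl ⋙ F) (stageCocone F h)
  map_id B := colimit.hom_ext fun b => (colimit.ι_desc _ _).trans (Category.comp_id _).symm
  map_comp {_ B _} h h' := colimit.hom_ext fun b => by
    rw [colimit.ι_desc, colimit.ι_desc_assoc]
    exact (colimit.ι_desc (stageCocone F h') ⟨b.1, leOfHom h b.2⟩).symm

/-- The inclusion of a stage into the colimit over a small directed subset. -/
def stageι (B : SmallDirectedSet κ μ α) (b : B.1) :
    F.obj b.1 ⟶ (smallDirectedColimit F).obj B := colimit.ι (B.incl ⋙ F) b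

lemma stageι_map {B B' : SmallDirectedSet κ μ α} (h : B ⟶ B') (b : B.1) :
    stageι F B b ≫ (smallDirectedColimit F).map h = stageι F B' ⟨b.1, leOfHom h b.2⟩ :=
  colimit.ι_desc _ _

lemma map_stageι (B : SmallDirectedSet κ μ α) {b b' : B.1} (h : b.1 ≤ b'.1) :
    F.map (homOfLE h) ≫ stageι F B b' = stageι F B b :=
  colimit.w (B.incl ⋙ F) (homOfLE h : b ⟶ b')

lemma stage_hom_ext {B : SmallDirectedSet κ μ α} {X : C}
    {f g : (smallDirectedColimit F).obj B ⟶ X}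
    (h : ∀ b, stageι F B b ≫ f = stageι F B b ≫ g) : f = g := colimit.hom_ext h

variable {F} (c : Cocone F)

/-- The cocone on the colimits over small directed subsets. -/
def smallDirectedCocone : Cocone (smallDirectedColimit (κ := κ) (μ := μ) F) :=
  Cocone.mk c.pt
    { app B := colimit.desc (B.incl ⋙ F) (c.whisker B.incl)
      naturality B B' h := stage_hom_ext F fun b => by
        have h₁ := stageι_map F h b
        have h₂ (B : SmallDirectedSet κ μ α) (b : B.1) : stageι F B b ≫
          colimit.desc (B.incl ⋙ F) (c.whisker B.incl) = c.ι.app b.1 := colimit.ι_desc _ _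
        refine ((Category.assoc _ _ _).symm.trans (congrArg (· ≫ _) h₁)).trans ?_
        refine (h₂ B' _).trans ?_
        exact ((Category.assoc _ _ _).symm.trans ((congrArg (· ≫ 𝟙 c.pt) (h₂ B b)).trans
          (Category.comp_id _))).symm }

lemma stageι_cocone (B : SmallDirectedSet κ μ α) (b : B.1) :
    stageι F B b ≫ (smallDirectedCocone c).ι.app B = c.ι.app b.1 := colimit.ι_desc _ _

variable [IsCardinalFiltered α κ]

lemma isCardinalFiltered_smallDirectedSet (hκμ : κ < μ) (hμ : ∀ (X : Type v) (_ : HasCardinalLT X μ),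
    ∃ Y : Set (CardinalDirectedPoset.SetCardinalLT κ X), HasCardinalLT Y μ ∧ IsCofinal Y) :
    IsCardinalFiltered (SmallDirectedSet κ μ α) μ := by
  refine isCardinalFiltered_preorder _ _ fun K s hK => ?_
  obtain ⟨B, hB, h₁, h₂⟩ := Cardinal.SharplyLT.exists_isCardinalFiltered_set_of_exists_cofinal
    hκμ hμ (⋃ k, (s k).1)
    (hasCardinalLT_iUnion _ ((hasCardinalLT_iff_cardinal_mk_lt _ _).2 hK) fun k => (s k).2.2)
  exact ⟨⟨B, h₁, h₂⟩, fun k => (Set.subset_iUnion (fun k => (s k).1) k).trans hB⟩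

/-- Every index lies in some small directed subset, and the stages containing it agree in the limit
because the poset of such subsets is directed; so a cocone on the partial colimits is the same as a
cocone on `F`. -/
lemma nonempty_isColimit_smallDirectedCocone (hκμ : κ < μ)
    (hμ : ∀ (X : Type v) (_ : HasCardinalLT X μ),
      ∃ Y : Set (CardinalDirectedPoset.SetCardinalLT κ X), HasCardinalLT Y μ ∧ IsCofinal Y)
    (hc : IsColimit c) : Nonempty (IsColimit (smallDirectedCocone (κ := κ) (μ := μ) c)) := by
  have := isCardinalFiltered_smallDirectedSet (α := α) hκμ hμ
  have := isFiltered_of_isCardinalFiltered (SmallDirectedSet κ μ α) μ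
  have hμ₀ : Cardinal.aleph0 ≤ μ := (Fact.out : μ.IsRegular).aleph0_le
  -- Pairs are needed for naturality, which compares two indices inside one subset; a single index
  -- uses `B i i`.
  have hex (i j : α) : ∃ B : SmallDirectedSet κ μ α, i ∈ B.1 ∧ j ∈ B.1 := by
    obtain ⟨B, hB, h₁, h₂⟩ := Cardinal.SharplyLT.exists_isCardinalFiltered_set_of_exists_cofinal
      hκμ hμ ({i, j} : Set α) (hasCardinalLT_of_finite _ _ hμ₀)
    exact ⟨⟨B, h₁, h₂⟩, hB (by simp), hB (by simp)⟩
  choose B hB hB' using hex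
  have hindep (s : Cocone (smallDirectedColimit (κ := κ) (μ := μ) F)) (i : α)
      (B B' : SmallDirectedSet κ μ α) (h : i ∈ B.1) (h' : i ∈ B'.1) :
      stageι F B ⟨i, h⟩ ≫ s.ι.app B = stageι F B' ⟨i, h'⟩ ≫ s.ι.app B' := by
    rw [← s.w (IsFiltered.leftToMax B B'), ← s.w (IsFiltered.rightToMax B B'),
      ← Category.assoc, ← Category.assoc, stageι_map, stageι_map]
  refine ⟨{
    desc s := hc.desc (Cocone.mk s.pt
      { app i := stageι F (B i i) ⟨i, hB i i⟩ ≫ s.ι.app (B i i)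
        naturality i j h := ?_ })
    fac s B' := stage_hom_ext F fun b => ?_
    uniq s m hm := hc.hom_ext fun i => ?_ }⟩
  · refine Eq.trans ?_ (Category.comp_id _).symm
    rw [hindep s j _ (B i j) _ (hB' i j), hindep s i _ (B i j) _ (hB i j), ← Category.assoc]
    exact congrArg (· ≫ s.ι.app (B i j)) (map_stageι F (B i j) (b := ⟨i, hB i j⟩)
      (b' := ⟨j, hB' i j⟩) (leOfHom h))
  · refine (Category.assoc _ _ _).symm.trans ?_
    refine (congrArg (· ≫ _) (stageι_cocone c B' b)).trans ?_
    exact (hc.fac _ _).trans (hindep s b.1 _ _ _ _)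
  · rw [hc.fac]
    refine Eq.trans ?_ (congrArg (stageι F (B i i) ⟨i, hB i i⟩ ≫ ·) (hm (B i i)))
    exact ((Category.assoc _ _ _).symm.trans
      (congrArg (· ≫ m) (stageι_cocone c (B i i) ⟨i, hB i i⟩))).symm

/-- Rewrites a `κ`-filtered colimit as a `μ`-filtered colimit of `κ`-directed colimits of size less
than `μ`, with `μ` arbitrarily large. The new stages lie in the closure of `P` under `μ`-small
colimits, which is essentially small. -/
lemma exists_essentiallySmall_presentation {C : Type u} [Category.{v} C] (κ ν : Cardinal.{v})
    [Fact κ.IsRegular] [HasCardinalFilteredColimits C κ] (P : ObjectProperty C)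
    [ObjectProperty.EssentiallySmall.{v} P]
    (hP : ∀ X : C, ∃ (H : Type v) (_ : SmallCategory H) (_ : IsCardinalFiltered H κ) (F : H ⥤ C)
      (t : F ⟶ (Functor.const H).obj X), (∀ h, P (F.obj h)) ∧
        Nonempty (IsColimit (Cocone.mk X t))) :
    ∃ (μ : Cardinal.{v}) (_ : Fact μ.IsRegular) (σ : Type v) (K : σ → C), ν < μ ∧
      ∀ X : C, ∃ (H : Type v) (_ : SmallCategory H) (_ : IsCardinalFiltered H μ) (F : H ⥤ C)
        (t : F ⟶ (Functor.const H).obj X),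
        (∀ h, ∃ s, Nonempty (F.obj h ≅ K s)) ∧ Nonempty (IsColimit (Cocone.mk X t)) := by
  obtain ⟨μ, _, hκμ, hνμ, hμ⟩ := exists_regular_cofinal κ ν
  obtain ⟨Q, hQ, -, hQ'⟩ := ObjectProperty.EssentiallySmall.exists_small_le.{v}
    (P.colimitsCardinalClosure μ)
  refine ⟨μ, inferInstance, Shrink.{v} (Subtype Q), fun s => ((equivShrink _).symm s).1, hνμ,
    fun X => ?_⟩
  obtain ⟨H, _, _, F, t, hF, ⟨ht⟩⟩ := hP X
  obtain ⟨α, _, _, φ, _⟩ := IsCardinalFiltered.exists_cardinal_directed H κ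
  have hc : IsColimit ((Cocone.mk X t).whisker φ) :=
    (Functor.Final.isColimitWhiskerEquiv φ _).symm ht
  obtain ⟨hc'⟩ := nonempty_isColimit_smallDirectedCocone (κ := κ) (μ := μ) _ hκμ hμ hc
  refine ⟨SmallDirectedSet κ μ α, inferInstance, isCardinalFiltered_smallDirectedSet hκμ hμ,
    _, (smallDirectedCocone ((Cocone.mk X t).whisker φ)).ι, fun B => ?_, ⟨hc'⟩⟩
  -- In a poset an arrow is determined by its end points, so `B` has fewer than `μ` arrows.
  have hB : HasCardinalLT (Arrow B.1) μ := by
    refine (hasCardinalLT_prod (Fact.out : μ.IsRegular).aleph0_le B.2.2 B.2.2).of_injective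
      (fun f => (f.left, f.right)) fun f g h => ?_
    obtain ⟨a, b, f⟩ := f
    obtain ⟨a', b', g⟩ := g
    obtain ⟨h₁ : a = a', h₂ : b = b'⟩ := Prod.mk.inj h
    subst h₁ h₂
    obtain rfl : f = g := Subsingleton.elim _ _
    rfl
  have := P.isClosedUnderColimitsOfShape_colimitsCardinalClosure μ B.1 hB
  have h : P.colimitsCardinalClosure μ ((smallDirectedColimit (φ ⋙ F)).obj B) :=
    ObjectProperty.prop_colimit _ (B.incl ⋙ φ ⋙ F)
      fun b => P.le_colimitsCardinalClosure μ _ (hF _)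
  obtain ⟨Y, hY, ⟨e⟩⟩ := hQ' _ h
  exact ⟨equivShrink _ ⟨Y, hY⟩, ⟨by simpa using e⟩⟩

end RaiseIndex

/-! ### Accessibility of the hom-functors -/

section Accessibility

variable {V : Type u} [Category.{v} V] [MonoidalCategory V] [MonoidalClosed V]
  {C : Type w} [Category.{v} C] [EnrichedOrdinaryCategory V C] {κ : Cardinal.{v}}
  [Fact κ.IsRegular]

lemma IsEnrichedCardinalAccessible.hasCardinalFilteredColimits
    (hC : IsEnrichedCardinalAccessible V C κ) : HasCardinalFilteredColimits C κ where
  hasColimitsOfShape J _ _ := ⟨fun F => by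
    obtain ⟨t, ht⟩ := hC.exists_colimit J F
    exact ⟨⟨⟨t, ht.isColimit.some⟩⟩⟩⟩

lemma IsEnrichedPresentable.isCardinalAccessible (hC : IsEnrichedCardinalAccessible V C κ)
    {A : C} (hA : IsEnrichedPresentable V κ A) : (eCoyoneda V A).IsCardinalAccessible κ where
  preservesColimitOfShape J _ _ := ⟨fun {F} => by
    obtain ⟨t, ht⟩ := hC.exists_colimit J F
    exact preservesColimit_of_preserves_colimit_cocone ht.isColimit.some
      (hA J F t ht).isColimit.some⟩

/-- Writing `Y` as a small conical colimit of presentable objects makes `V(T, C(Y, -))` a small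
limit of functors `V(T, C(G i, -))`. These are accessible because `G i` and `T` are presentable, and
a sufficiently small limit of accessible functors is accessible. -/
lemma isAccessible_points_eCoyoneda [IsLocallyPresentable.{v} V]
    (hC : IsEnrichedCardinalAccessible V C κ) (Y : C) (T : V) :
    Functor.IsAccessible.{v} (eCoyoneda V Y ⋙ coyoneda.obj (op T)) := by
  obtain ⟨ι, G, hG, hG'⟩ := hC.exists_generator
  obtain ⟨H, _, _, F, t, hF, ht⟩ := hG' Y
  obtain ⟨κ₁, _, h₁⟩ : ∃ (κ₁ : Cardinal.{v}) (_ : Fact κ₁.IsRegular),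
      IsCardinalPresentable T κ₁ := (inferInstance : IsPresentable.{v} T).exists_cardinal
  obtain ⟨κ₂, h₂, h₂'⟩ := HasCardinalLT.exists_regular_cardinal.{v} (Arrow Hᵒᵖ)
  have : Fact κ₂.IsRegular := ⟨h₂⟩
  let μ := (κ ⊔ κ₁) ⊔ κ₂
  have hle : κ ≤ μ := le_sup_left.trans le_sup_left
  have hle₁ : κ₁ ≤ μ := le_sup_right.trans le_sup_left
  -- A maximum of two cardinals is one of them, hence regular if both are.
  have : Fact (κ ⊔ κ₁).IsRegular := ⟨iteInduction (fun _ => Fact.out) (fun _ => Fact.out)⟩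
  have : Fact μ.IsRegular := ⟨iteInduction (fun _ => Fact.out) (fun _ => Fact.out)⟩
  let N : Cᵒᵖ ⥤ C ⥤ Type v := eHomFunctor V C ⋙
    (Functor.whiskeringRight C V (Type v)).obj (coyoneda.obj (op T))
  let s : Cone (F.op ⋙ N) := N.mapCone (Cocone.mk Y t).op
  -- Limits of functors are pointwise: `C(-, X)` turns the conical colimit `Y` into a limit, which
  -- `V(T, -)` preserves.
  have hs : IsLimit s := evaluationJointlyReflectsLimits _ fun X =>
    isLimitOfPreserves (coyoneda.obj (op T)) (ht.isLimit X).some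
  have hT : (coyoneda.obj (op T)).IsCardinalAccessible μ :=
    isCardinalPresentable_of_le T hle₁
  have (h : Hᵒᵖ) : ((F.op ⋙ N).obj h).IsCardinalAccessible μ := by
    have : (eCoyoneda V (F.obj h.unop)).IsCardinalAccessible μ := by
      obtain ⟨i, hi⟩ := hF h.unop
      have := (hG i).isCardinalAccessible hC
      rw [hi] at this
      exact Functor.isCardinalAccessible_of_le _ hle
    exact inferInstanceAs ((eCoyoneda V (F.obj h.unop) ⋙ coyoneda.obj (op T)).IsCardinalAccessible μ)
  have := Functor.isCardinalAccessible_of_isLimit s hs μ (h₂'.of_le le_sup_right)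
  exact Functor.isAccessible_of_isCardinalAccessible s.pt μ

variable {μ : Cardinal.{v}} [Fact μ.IsRegular] {Y : C} {T : V}
  {H : Type v} [SmallCategory H] [IsCardinalFiltered H μ] {F : H ⥤ C} {t : Cocone F}

lemma exists_stage_factorization
    (hY : (eCoyoneda V Y ⋙ coyoneda.obj (op T)).IsCardinalAccessible μ) (ht : IsColimit t)
    (f : T ⟶ (EnrichedCategory.Hom Y t.pt : V)) :
    ∃ (h : H) (g : T ⟶ (EnrichedCategory.Hom Y (F.obj h) : V)),
      g ≫ eHomWhiskerLeft V Y (t.ι.app h) = f := by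
  have := Functor.preservesColimitsOfShape_of_isCardinalAccessible
    (eCoyoneda V Y ⋙ coyoneda.obj (op T)) μ H
  exact Types.jointly_surjective_of_isColimit
    (isColimitOfPreserves (eCoyoneda V Y ⋙ coyoneda.obj (op T)) ht) f

lemma exists_stage_eq
    (hY : (eCoyoneda V Y ⋙ coyoneda.obj (op T)).IsCardinalAccessible μ) (ht : IsColimit t) {h : H}
    (f g : T ⟶ (EnrichedCategory.Hom Y (F.obj h) : V))
    (hfg : f ≫ eHomWhiskerLeft V Y (t.ι.app h) = g ≫ eHomWhiskerLeft V Y (t.ι.app h)) :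
    ∃ (h' : H) (a : h ⟶ h'), f ≫ eHomWhiskerLeft V Y (F.map a) =
      g ≫ eHomWhiskerLeft V Y (F.map a) := by
  have := Functor.preservesColimitsOfShape_of_isCardinalAccessible
    (eCoyoneda V Y ⋙ coyoneda.obj (op T)) μ H
  have := isFiltered_of_isCardinalFiltered H μ
  exact (Types.FilteredColimit.isColimit_eq_iff'
    (isColimitOfPreserves (eCoyoneda V Y ⋙ coyoneda.obj (op T)) ht) f g).1 hfg

end Accessibility

/-! ### The solution set condition -/

section SolutionSet

variable {V : Type u} [Category.{v} V] [MonoidalCategory V] [SymmetricCategory V]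
  [MonoidalClosed V] [HasLimits V]
  {C : Type w} [Category.{v} C] [EnrichedOrdinaryCategory V C]
  {D : Type v} [EnrichedCategory V D]

/-- The action `W d ⊗ D(d', d) ⟶ W d'` of a weight on the opposite of `D`. -/
def opAct (W : Weight V Dᵒᵖ) (d d' : D) :
    W.obj (op d) ⊗ (EnrichedCategory.Hom d' d : V) ⟶ W.obj (op d') := act W (op d) (op d')

/-- The equations making a family of maps `W d ⟶ C(S d, a)` into a cocone. -/
def IsCoconeFamily (W : Weight V Dᵒᵖ) (S : EnrichedFunctor V D C) {a : C}
    (y : ∀ d : D, W.obj (op d) ⟶ (EnrichedCategory.Hom (S.obj d) a : V)) (d d' : D) : Prop :=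
  opAct W d d' ≫ y d' = y d ▷ (EnrichedCategory.Hom d' d : V) ≫
    _ ◁ S.map d' d ≫ (β_ _ _).hom ≫ eComp V (S.obj d') (S.obj d) a

lemma cocone_comp_whiskerLeft (S : EnrichedFunctor V D C) {T : V} {a a' : C} (g : a ⟶ a')
    (d d' : D) (y : T ⟶ (EnrichedCategory.Hom (S.obj d) a : V)) :
    (y ▷ (EnrichedCategory.Hom d' d : V) ≫
      _ ◁ S.map d' d ≫ (β_ _ _).hom ≫ eComp V (S.obj d') (S.obj d) a) ≫
        eHomWhiskerLeft V (S.obj d') g =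
    (y ≫ eHomWhiskerLeft V (S.obj d) g) ▷ (EnrichedCategory.Hom d' d : V) ≫
      _ ◁ S.map d' d ≫ (β_ _ _).hom ≫ eComp V (S.obj d') (S.obj d) a' := by
  simp only [Category.assoc, eComp_eHomWhiskerLeft, comp_whiskerRight]
  rw [← BraidedCategory.braiding_naturality_left_assoc, whisker_exchange_assoc]

/-- The evaluation `[Dᵒᵖ, V](W, C(S-, a)) ⊗ W d ⟶ C(S d, a)`. -/
def coconeEval (W : Weight V Dᵒᵖ) (S : EnrichedFunctor V D C) (a : C) (d : D) :
    (coconeWeight W S).obj a ⊗ W.obj (op d) ⟶ (EnrichedCategory.Hom (S.obj d) a : V) :=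
  homWeightEval (coconeAction S) W a (op d)

lemma coconeEval_act (W : Weight V Dᵒᵖ) (S : EnrichedFunctor V D C) (a : C) (d d' : D) :
    (coconeWeight W S).obj a ◁ opAct W d d' ≫ coconeEval W S a d' =
      (α_ _ _ (EnrichedCategory.Hom d' d : V)).inv ≫ coconeEval W S a d ▷ _ ≫
        _ ◁ S.map d' d ≫ (β_ _ _).hom ≫ eComp V (S.obj d') (S.obj d) a := by
  have h := homWeightEval_act (coconeAction S) W a (op d) (op d')
  rw [act_opFunctor_corep] at h
  exact h

lemma coconeWeight_ext (W : Weight V Dᵒᵖ) (S : EnrichedFunctor V D C) {a : C} {T : V}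
    {f g : T ⟶ (coconeWeight W S).obj a}
    (h : ∀ d, f ▷ W.obj (op d) ≫ coconeEval W S a d = g ▷ W.obj (op d) ≫ coconeEval W S a d) :
    f = g := homWeight_ext (coconeAction S) W fun d => h d.unop

lemma exists_coconeWeight_lift (W : Weight V Dᵒᵖ) (S : EnrichedFunctor V D C) {a : C} {T : V}
    (ψ : ∀ d : D, T ⊗ W.obj (op d) ⟶ (EnrichedCategory.Hom (S.obj d) a : V))
    (hψ : ∀ d d' : D, T ◁ opAct W d d' ≫ ψ d' =
      (α_ _ _ (EnrichedCategory.Hom d' d : V)).inv ≫ ψ d ▷ _ ≫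
        _ ◁ S.map d' d ≫ (β_ _ _).hom ≫ eComp V (S.obj d') (S.obj d) a) :
    ∃ f : T ⟶ (coconeWeight W S).obj a, ∀ d,
      f ▷ W.obj (op d) ≫ coconeEval W S a d = ψ d := by
  obtain ⟨f, hf⟩ := exists_homWeight_lift (coconeAction S) W (e := a)
    (fun d : Dᵒᵖ => ψ d.unop) fun d d' => by
      have h := act_opFunctor_corep S a d d'
      refine (hψ d.unop d'.unop).trans ?_
      exact congrArg (fun z => (α_ _ _ (EnrichedCategory.Hom d'.unop d.unop : V)).inv ≫
        ψ d.unop ▷ _ ≫ z) h.symm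
  exact ⟨f, fun d => hf (op d)⟩

lemma act_coconeEval (W : Weight V Dᵒᵖ) (S : EnrichedFunctor V D C) (a a' : C) (d : D) :
    act (coconeWeight W S) a a' ▷ W.obj (op d) ≫ coconeEval W S a' d =
      swapRight _ _ _ ≫ coconeEval W S a d ▷ _ ≫ eComp V (S.obj d) a a' :=
  act_homWeight_eval (coconeAction S) W a a' (op d)

lemma evalAt_coconeEval (W : Weight V Dᵒᵖ) (S : EnrichedFunctor V D C) {a : C}
    {x : 𝟙_ V ⟶ (coconeWeight W S).obj a} {d : D}
    {t : W.obj (op d) ⟶ (EnrichedCategory.Hom (S.obj d) a : V)}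
    (h : x ▷ W.obj (op d) ≫ coconeEval W S a d = (λ_ _).hom ≫ t) (a' : C) :
    evalAt (coconeWeight W S) x a' ▷ W.obj (op d) ≫ coconeEval W S a' d =
      (β_ _ _).hom ≫ t ▷ _ ≫ eComp V (S.obj d) a a' :=
  evalAt_homWeight_eval (coconeAction S) W h a'

lemma exists_coconeWeight_point (W : Weight V Dᵒᵖ) (S : EnrichedFunctor V D C) {a : C}
    (y : ∀ d : D, W.obj (op d) ⟶ (EnrichedCategory.Hom (S.obj d) a : V))
    (hy : ∀ d d', IsCoconeFamily W S y d d') :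
    ∃ x : 𝟙_ V ⟶ (coconeWeight W S).obj a, ∀ d : D,
      x ▷ W.obj (op d) ≫ coconeEval W S a d = (λ_ _).hom ≫ y d := by
  refine exists_coconeWeight_lift W S (fun d => (λ_ _).hom ≫ y d) fun d d' => ?_
  rw [leftUnitor_naturality_assoc]
  refine (congrArg _ (hy d d')).trans ?_
  simp

lemma exists_coconeFamily (W : Weight V Dᵒᵖ) (S : EnrichedFunctor V D C) {a : C}
    (x : 𝟙_ V ⟶ (coconeWeight W S).obj a) :
    ∃ y : ∀ d : D, W.obj (op d) ⟶ (EnrichedCategory.Hom (S.obj d) a : V),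
      (∀ d d', IsCoconeFamily W S y d d') ∧ ∀ d : D,
      x ▷ W.obj (op d) ≫ coconeEval W S a d = (λ_ _).hom ≫ y d := by
  refine ⟨fun d => (λ_ _).inv ≫ x ▷ W.obj (op d) ≫ coconeEval W S a d, fun d d' => ?_, fun d =>
      (Iso.hom_inv_id_assoc _ _).symm⟩
  rw [IsCoconeFamily, leftUnitor_inv_naturality_assoc, whisker_exchange_assoc, coconeEval_act]
  simp only [comp_whiskerRight, Category.assoc, leftUnitor_inv_whiskerRight]
  rw [associator_inv_naturality_left_assoc]

lemma eHomEquiv_evalAt_coconeWeight (W : Weight V Dᵒᵖ) (S : EnrichedFunctor V D C) {a a' : C}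
    (g : a ⟶ a') {x : 𝟙_ V ⟶ (coconeWeight W S).obj a} {x' : 𝟙_ V ⟶ (coconeWeight W S).obj a'}
    {y : ∀ d : D, W.obj (op d) ⟶ (EnrichedCategory.Hom (S.obj d) a : V)}
    {y' : ∀ d : D, W.obj (op d) ⟶ (EnrichedCategory.Hom (S.obj d) a' : V)}
    (hx : ∀ d, x ▷ W.obj (op d) ≫ coconeEval W S a d = (λ_ _).hom ≫ y d)
    (hx' : ∀ d, x' ▷ W.obj (op d) ≫ coconeEval W S a' d = (λ_ _).hom ≫ y' d)
    (hy : ∀ d, y d ≫ eHomWhiskerLeft V (S.obj d) g = y' d) :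
    eHomEquiv V g ≫ evalAt (coconeWeight W S) x a' = x' := by
  refine coconeWeight_ext W S fun d => ?_
  rw [comp_whiskerRight, Category.assoc, evalAt_coconeEval W S (hx d) a', hx', ← hy d,
    BraidedCategory.braiding_naturality_left_assoc, whisker_exchange_assoc, eHomWhiskerLeft,
    rightUnitor_inv_naturality_assoc]
  simp

variable [IsLocallyPresentable.{v} V]

/-- A cocone `W ⟶ C(S-, z)` consists of fewer than `μ` maps subject to fewer than `μ` equations,
once `μ` is large. Writing `z` as a `μ`-filtered colimit of objects from a small set, the maps
factor through one stage and the equations hold at a later one; hence cocones with vertex in that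
set form a solution set. -/
lemma exists_isSolutionSet_coconeWeight (hC : IsEnrichedAccessible V C) (W : Weight V Dᵒᵖ)
    (S : EnrichedFunctor V D C) :
    ∃ (ι : Type v) (f : ι → Elements (coconeWeight W S)), IsSolutionSet (coconeWeight W S) f := by
  obtain ⟨-, κ, -, _, -, -, hC⟩ := hC
  have := hC.hasCardinalFilteredColimits
  obtain ⟨ι, G, -, hG⟩ := hC.exists_generator
  choose ν hν hν' using fun d : D => (isAccessible_points_eCoyoneda (V := V) hC (S.obj d)
    (W.obj (op d))).exists_cardinal
  choose ρ hρ hρ' using fun p : D × D => (isAccessible_points_eCoyoneda (V := V) hC (S.obj p.2)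
    (W.obj (op p.1) ⊗ (EnrichedCategory.Hom p.2 p.1 : V))).exists_cardinal
  -- `μ` must exceed the accessibility index of the functors classifying the components (`ν`) and
  -- the equations (`ρ`), and the number of objects and pairs of objects of `D`.
  let τ := max (iSup ν) (max (iSup ρ) (max (Cardinal.mk D) (Cardinal.mk (D × D))))
  have hsmall : ObjectProperty.EssentiallySmall.{v} (ObjectProperty.ofObj G) := inferInstance
  obtain ⟨μ, _, σ, K, hμ, hK⟩ := exists_essentiallySmall_presentation κ τ
    (ObjectProperty.ofObj G) fun X => by
      obtain ⟨H, h₁, h₂, F, t, h₃, h₄⟩ := hG X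
      refine ⟨H, h₁, h₂, F, t, fun h => ?_, h₄.isColimit⟩
      obtain ⟨i, hi⟩ := h₃ h
      rw [← hi]
      exact ObjectProperty.ofObj_apply G i
  have hD : HasCardinalLT D μ := (hasCardinalLT_iff_cardinal_mk_lt _ _).2
    (lt_of_le_of_lt ((le_max_left _ _).trans ((le_max_right _ _).trans (le_max_right _ _))) hμ)
  have hDD : HasCardinalLT (D × D) μ := (hasCardinalLT_iff_cardinal_mk_lt _ _).2
    (lt_of_le_of_lt ((le_max_right _ _).trans ((le_max_right _ _).trans (le_max_right _ _))) hμ)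
  have hν₁ (d : D) : (eCoyoneda V (S.obj d) ⋙
      coyoneda.obj (op (W.obj (op d)))).IsCardinalAccessible μ := by
    have := hν d
    have := hν' d
    exact Functor.isCardinalAccessible_of_le _
      ((le_ciSup Cardinal.bddAbove_of_small d).trans ((le_max_left _ _).trans hμ.le))
  have hρ₁ (p : D × D) : (eCoyoneda V (S.obj p.2) ⋙ coyoneda.obj
      (op (W.obj (op p.1) ⊗ (EnrichedCategory.Hom p.2 p.1 : V)))).IsCardinalAccessible μ := by
    have := hρ p
    have := hρ' p
    exact Functor.isCardinalAccessible_of_le _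
      ((le_ciSup Cardinal.bddAbove_of_small p).trans (((le_max_left _ _).trans (le_max_right _ _)).trans hμ.le))
  refine ⟨Σ s, 𝟙_ V ⟶ (coconeWeight W S).obj (K s), fun p => ⟨K p.1, p.2⟩, fun z => ?_⟩
  obtain ⟨y, hy, hzy⟩ := exists_coconeFamily W S z.pt
  obtain ⟨H, _, _, F, t, hF, ⟨ht⟩⟩ := hK z.base
  -- Each component factors through a stage, and `h₁` is a stage common to all of them.
  choose h₀ g₀ hg₀ using fun d => exists_stage_factorization (hν₁ d) ht (y d)
  let h₁ : H := IsCardinalFiltered.max h₀ hD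
  let g₁ (d : D) : W.obj (op d) ⟶ (EnrichedCategory.Hom (S.obj d) (F.obj h₁) : V) :=
    g₀ d ≫ eHomWhiskerLeft V (S.obj d) (F.map (IsCardinalFiltered.toMax h₀ hD d))
  have hg₁ (d : D) : g₁ d ≫ eHomWhiskerLeft V (S.obj d) (t.app h₁) = y d := by
    rw [Category.assoc, ← eHomWhiskerLeft_comp]
    exact ((congrArg (fun k => g₀ d ≫ eHomWhiskerLeft V (S.obj d) k)
      ((Cocone.mk z.base t).w (IsCardinalFiltered.toMax h₀ hD d))).trans (hg₀ d))
  -- Both sides of each cocone equation agree in the colimit, hence at some later stage; `m` is a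
  -- stage that works for all pairs simultaneously.
  choose h₂ a₂ ha₂ using fun p : D × D => exists_stage_eq (hρ₁ p) ht
    (opAct W p.1 p.2 ≫ g₁ p.2) (g₁ p.1 ▷ (EnrichedCategory.Hom p.2 p.1 : V) ≫
      _ ◁ S.map p.2 p.1 ≫ (β_ _ _).hom ≫ eComp V (S.obj p.2) (S.obj p.1) (F.obj h₁)) (by
        rw [Category.assoc, cocone_comp_whiskerLeft]
        refine ((congrArg _ (hg₁ p.2)).trans (hy p.1 p.2)).trans ?_
        exact congrArg (fun k => k ▷ (EnrichedCategory.Hom p.2 p.1 : V) ≫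
          _ ◁ S.map p.2 p.1 ≫ (β_ _ _).hom ≫ eComp V (S.obj p.2) (S.obj p.1) z.base)
            (hg₁ p.1).symm)
  obtain ⟨m, b, a, ha⟩ := IsCardinalFiltered.wideSpan a₂ hDD
  obtain ⟨s, ⟨e⟩⟩ := hF m
  let g₃ (d : D) : W.obj (op d) ⟶ (EnrichedCategory.Hom (S.obj d) (K s) : V) :=
    g₁ d ≫ eHomWhiskerLeft V (S.obj d) (F.map a ≫ e.hom)
  obtain ⟨x, hx⟩ := exists_coconeWeight_point W S g₃ fun d d' => by
    have hF : F.map a ≫ e.hom = F.map (a₂ (d, d')) ≫ F.map (b (d, d')) ≫ e.hom := by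
      rw [← F.map_comp_assoc, ha]
    have h := ha₂ (d, d') =≫ eHomWhiskerLeft V (S.obj d') (F.map (b (d, d')) ≫ e.hom)
    rw [Category.assoc _ (eHomWhiskerLeft _ _ _), Category.assoc _ (eHomWhiskerLeft _ _ _),
      ← eHomWhiskerLeft_comp, ← hF] at h
    rw [IsCoconeFamily, ← cocone_comp_whiskerLeft, ← Category.assoc]
    exact h
  refine ⟨⟨s, x⟩, eHomEquiv V (e.inv ≫ t.app m),
    eHomEquiv_evalAt_coconeWeight W S _ hx hzy fun d => ?_⟩
  have h : (F.map a ≫ e.hom) ≫ e.inv ≫ t.app m = F.map a ≫ t.app m := by simp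
  refine (Category.assoc _ _ _).trans ?_
  rw [← eHomWhiskerLeft_comp, h]
  exact (congrArg (fun k => g₁ d ≫ eHomWhiskerLeft V (S.obj d) k)
      ((Cocone.mk z.base t).w a)).trans (hg₁ d)

variable [ModelCategory V]

theorem hasEWeakColimits_of_hasPowers (hI : IsCofibrant (𝟙_ V)) (hC : IsEnrichedAccessible V C)
    (hP : HasPowers V C) (hL : HasEnoughCofibrantlyWeightedLimits V C) :
    HasEWeakColimits V C := by
  intro D _ W S
  obtain ⟨ι, f, hf⟩ := exists_isSolutionSet_coconeWeight hC W S
  obtain ⟨c, x, hx⟩ := exists_shrinkable_evalAt hI hP hL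
    (preservesWeightedLimits_coconeWeight W S) hf
  obtain ⟨η, hη⟩ := exists_conePoint_eq (W := W) (S := opFunctor S) (X := op c) x
  refine ⟨c, η, fun a => ?_⟩
  rw [comparison_eq_evalAt, hη]
  exact hx a

end SolutionSet

/-! ### Cones induced by weak colimits -/

section WeakColimitCone

variable {V : Type u} [Category.{v} V] [MonoidalCategory V] [SymmetricCategory V]
  [MonoidalClosed V]

lemma braiding_swapRight (X Y Z : V) :
    (β_ X (Y ⊗ Z)).hom ≫ swapRight Y Z X = (α_ X Y Z).inv ≫ (β_ X Y).hom ▷ Z := by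
  simp only [swapRight, BraidedCategory.braiding_tensor_right_hom, Category.assoc,
    Iso.inv_hom_id_assoc]
  rw [← MonoidalCategory.whiskerLeft_comp_assoc, SymmetricCategory.symmetry]
  simp

lemma swapRight_braiding (X Y Z : V) :
    swapRight X Y Z ≫ (β_ X Z).hom ▷ Y = (β_ (X ⊗ Y) Z).hom ≫ (α_ Z X Y).inv := by
  simp only [swapRight, BraidedCategory.braiding_tensor_left_hom, Category.assoc,
    Iso.hom_inv_id, Category.comp_id]

variable [HasLimits V] {C : Type w} [Category.{v} C] [EnrichedOrdinaryCategory V C]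
  {A D : Type v} [EnrichedCategory V A] [EnrichedCategory V D]
  {F : Weight V Aᵒᵖ} {K : EnrichedFunctor V A C}

/-- The components `F i ⟶ C(K i, c)` of a cocone. -/
def coconeHom {c : C} (η : VNatTrans F ((opFunctor K).comp V (corep (op c)))) (i : A) :
    F.obj (op i) ⟶ (EnrichedCategory.Hom (K.obj i) c : V) := η.app (op i)

lemma opAct_coconeHom {c : C} (η : VNatTrans F ((opFunctor K).comp V (corep (op c)))) (i j : A) :
    opAct F i j ≫ coconeHom η j = coconeHom η i ▷ _ ≫ _ ◁ K.map j i ≫ (β_ _ _).hom ≫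
      eComp V (K.obj j) (K.obj i) c := by
  have h := η.act_app (op i) (op j)
  rw [act_opFunctor_corep] at h
  exact h

lemma conePoint_coconeEval {c : C} (η : VNatTrans F ((opFunctor K).comp V (corep (op c))))
    (i : A) : (show 𝟙_ V ⟶ (coconeWeight F K).obj c from conePoint η) ▷ F.obj (op i) ≫
      coconeEval F K c i = (λ_ _).hom ≫ coconeHom η i :=
  conePoint_eval η (op i)

/-- The transformation `C(c, S-) ⟶ M S-` given by a point of `M c`. -/
def evalTrans (S : EnrichedFunctor V D C) (M : Weight V C) {c : C} (x : 𝟙_ V ⟶ M.obj c) :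
    VNatTrans (S.comp V (corep c)) (S.comp V M) :=
  VNatTrans.ofAct (fun d => evalAt M x (S.obj d)) fun d d' => by
    rw [act_functorComp, act_functorComp, act_corep]
    refine (Category.assoc _ _ _).trans ?_
    refine (congrArg (fun z => (EnrichedCategory.Hom c (S.obj d) : V) ◁ S.map d d' ≫ z)
      (eComp_evalAt M x (S.obj d) (S.obj d'))).trans ?_
    exact whisker_exchange_assoc _ _ _

/-- The family `ev` is a canonical `W`-cone in the weights `[F, C(K-, S d)]`. It has to be lifted
along the maps `C(c, S d) ⟶ [F, C(K-, S d)]`, compatibly in `d`. These maps are pointwise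
shrinkable, so by `ℰ`-stability the map they induce on `[D, V](W, -)` is shrinkable. -/
lemma exists_cone_of_weakColimit [ModelCategory V] {W : Weight V D} (hW : IsEStable W)
    {S : EnrichedFunctor V D C} {c : C} (η : VNatTrans F ((opFunctor K).comp V (corep (op c))))
    (hη : ∀ a : C, Shrinkable V (comparison η (op a)))
    (ev : ∀ i d, F.obj (op i) ⊗ W.obj d ⟶ (EnrichedCategory.Hom (K.obj i) (S.obj d) : V))
    (hev : ∀ i j d, opAct F i j ▷ W.obj d ≫ ev j d = swapRight _ _ _ ≫ ev i d ▷ _ ≫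
      _ ◁ K.map j i ≫ (β_ _ _).hom ≫ eComp V (K.obj j) (K.obj i) (S.obj d))
    (hev' : ∀ i d d', F.obj (op i) ◁ act W d d' ≫ ev i d' = (α_ _ _ _).inv ≫ ev i d ▷ _ ≫
      _ ◁ S.map d d' ≫ eComp V (K.obj i) (S.obj d) (S.obj d')) :
    ∃ ζ : VNatTrans W (S.comp V (corep c)), ∀ i d,
      coconeHom η i ▷ W.obj d ≫ _ ◁ coneHom ζ d ≫ eComp V (K.obj i) c (S.obj d) = ev i d := by
  have hcan (d : D) : ∃ f : W.obj d ⟶ (coconeWeight F K).obj (S.obj d), ∀ i,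
      f ▷ F.obj (op i) ≫ coconeEval F K (S.obj d) i = (β_ _ _).hom ≫ ev i d :=
    exists_coconeWeight_lift F K (fun i => (β_ _ _).hom ≫ ev i d) fun i j => by
      rw [BraidedCategory.braiding_naturality_right_assoc, hev, ← Category.assoc (β_ _ _).hom,
        braiding_swapRight]
      simp only [comp_whiskerRight, Category.assoc]
  choose can hcan using hcan
  have hnat (d d' : D) : act W d d' ≫ can d' = can d ▷ _ ≫ _ ◁ S.map d d' ≫
      act (coconeWeight F K) (S.obj d) (S.obj d') := by
    refine coconeWeight_ext F K fun i => ?_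
    simp only [comp_whiskerRight, Category.assoc]
    rw [hcan, act_coconeEval, reassoc_of% swapRight_naturality_middle, reassoc_of% swapRight_naturality_left,
      whisker_exchange_assoc, ← comp_whiskerRight_assoc, hcan,
      BraidedCategory.braiding_naturality_left_assoc, hev', comp_whiskerRight, Category.assoc,
      ← Category.assoc (swapRight _ _ _), swapRight_braiding]
    simp only [Category.assoc]
  let canT : VNatTrans W (S.comp V (coconeWeight F K)) := VNatTrans.ofAct can fun d d' => by
    rw [act_functorComp]
    exact hnat d d'
  let y : 𝟙_ V ⟶ (coconeWeight F K).obj c := conePoint η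
  -- Only the section is used here; stability of the homotopy data is what makes this natural
  -- section available.
  obtain ⟨s, hs, -⟩ := (isEStable_iff W).1 hW _ _ (evalTrans S (coconeWeight F K) y) fun d => by
    have h := hη (S.obj d)
    rw [comparison_eq_evalAt] at h
    exact h
  obtain ⟨ζ, hζ⟩ := exists_conePoint_eq (S := S) (X := c) (natObjPoint canT ≫ s)
  have hζ' : conePoint ζ ≫ natObjMap W (evalTrans S (coconeWeight F K) y) =
      natObjPoint canT := by rw [hζ, Category.assoc, hs, Category.comp_id]
  have hζ'' (d : D) : coneHom ζ d ≫ evalAt (coconeWeight F K) y (S.obj d) = can d := by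
    have h := congrArg (fun z => z ▷ W.obj d ≫ natObjEval W _ d) hζ'
    rw [natObjPoint_eval, comp_whiskerRight, Category.assoc, natObjMap_eval] at h
    have h' : conePoint ζ ▷ W.obj d ≫ natObjEval W (S.comp V (corep c)) d =
      (λ_ _).hom ≫ coneHom ζ d := conePoint_eval ζ d
    rw [← Category.assoc, h'] at h
    exact (cancel_epi (λ_ (W.obj d)).hom).1 ((Category.assoc _ _ _).symm.trans h)
  refine ⟨ζ, fun i d => ?_⟩
  have h := congrArg (fun z => z ▷ F.obj (op i) ≫ coconeEval F K (S.obj d) i) (hζ'' d)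
  rw [hcan, comp_whiskerRight, Category.assoc,
    evalAt_coconeEval F K (conePoint_coconeEval η i) (S.obj d),
    BraidedCategory.braiding_naturality_left_assoc, whisker_exchange_assoc] at h
  exact (cancel_epi _).1 h

end WeakColimitCone

/-! ### Restriction of weighted cones -/

section ConeWeight

variable {V : Type u} [Category.{v} V] [MonoidalCategory V] [SymmetricCategory V]
  [MonoidalClosed V] {C : Type w} [EnrichedCategory V C]
  {D : Type v} [EnrichedCategory V D]

lemma eComp_braiding_eComp (X' X Y Z : C) :
    ((β_ _ _).hom ≫ eComp V X' X Y) ▷ _ ≫ eComp V X' Y Z =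
      swapRight _ _ _ ≫ eComp V X Y Z ▷ _ ≫ (β_ _ _).hom ≫ eComp V X' X Z := by
  rw [BraidedCategory.braiding_naturality_left_assoc, ← e_assoc,
    ← Category.assoc (β_ _ _).hom (α_ _ _ _).inv, ← swapRight_braiding, Category.assoc,
    reassoc_of% swapRight_swapRight, comp_whiskerRight, Category.assoc]

lemma eComp_braiding_exchange (S : EnrichedFunctor V D C) (X X' : C) (d d' : D) :
    ((β_ _ _).hom ≫ eComp V X' X (S.obj d)) ▷ _ ≫ _ ◁ S.map d d' ≫
        eComp V X' (S.obj d) (S.obj d') =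
      swapRight _ _ _ ≫ (_ ◁ S.map d d' ≫ eComp V X (S.obj d) (S.obj d')) ▷ _ ≫
        (β_ _ _).hom ≫ eComp V X' X (S.obj d') := by
  rw [← whisker_exchange_assoc, eComp_braiding_eComp, reassoc_of% swapRight_naturality_right]
  simp only [comp_whiskerRight, Category.assoc]

/-- The bimodule `C(-, S-)`. -/
def coneAction (S : EnrichedFunctor V D C) :
    BimoduleAction fun X : Cᵒᵖ => S.comp V (corep (V := V) X.unop) where
  lact X X' d := eComp V (op (S.obj d)) X X'
  lact_id X d := by
    have h := act_id (corep (V := V) (op (S.obj d))) X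
    rwa [act_corep] at h
  lact_comp X X' X'' d := by
    have h := act_comp (corep (V := V) (op (S.obj d))) X X' X''
    rwa [act_corep, act_corep, act_corep] at h
  exchange X X' d d' := by
    rw [act_functorComp, act_functorComp, act_corep, act_corep]
    have h (d : D) := eComp_op (V := V) (S.obj d) X.unop X'.unop
    refine Eq.trans ?_ ((eComp_braiding_exchange S X.unop X'.unop d d').trans ?_)
    · exact congrArg (fun z => z ▷ _ ≫ _ ◁ S.map d d' ≫
        eComp V X'.unop (S.obj d) (S.obj d')) (h d)
    · exact congrArg (fun z => swapRight _ _ _ ≫ (_ ◁ S.map d d' ≫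
        eComp V X.unop (S.obj d) (S.obj d')) ▷ _ ≫ z) (h d').symm

variable [HasLimits V] (W : Weight V D) (S : EnrichedFunctor V D C)

/-- The action `[D, V](W, C(X, S-)) ⊗ C(X', X) ⟶ [D, V](W, C(X', S-))`. -/
def coneRestrict (X X' : C) :
    natObj W (S.comp V (corep X)) ⊗ (EnrichedCategory.Hom X' X : V) ⟶
      natObj W (S.comp V (corep X')) :=
  act (homWeight (coneAction S) W) (op X) (op X')

lemma coneRestrict_eval (X X' : C) (d : D) :
    coneRestrict W S X X' ▷ W.obj d ≫ coneEval W S X' d =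
      swapRight _ _ _ ≫ coneEval W S X d ▷ _ ≫ (β_ _ _).hom ≫ eComp V X' X (S.obj d) := by
  have h := act_homWeight_eval (coneAction S) W (op X) (op X') d
  have h' := eComp_op (V := V) (S.obj d) X X'
  refine h.trans ?_
  exact congrArg (fun z => swapRight _ _ _ ≫ coneEval W S X d ▷ _ ≫ z) h'

variable {W S}

/-- Naturality of the comparison map in `X`, at the level of hom-objects. -/
lemma comparison_coneRestrict {c : C} (ζ : VNatTrans W (S.comp V (corep c))) (X X' : C) :
    comparison ζ X ▷ _ ≫ coneRestrict W S X X' =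
      (β_ _ _).hom ≫ eComp V X' X c ≫ comparison ζ X' := by
  refine coneEval_ext fun d => ?_
  simp only [comp_whiskerRight, Category.assoc]
  rw [coneRestrict_eval, comparison_eval, reassoc_of% swapRight_naturality_left,
    ← comp_whiskerRight_assoc, comparison_eval, comp_whiskerRight, Category.assoc,
    ← reassoc_of% swapRight_naturality_right, ← eComp_braiding_eComp, whisker_exchange_assoc]
  simp only [comp_whiskerRight, Category.assoc]

variable (W) in
/-- The weight `i ↦ [D, V](W, C(G i, S-))` on the opposite of a full sub-`V`-category. -/
def familyConeWeight (S : EnrichedFunctor V D C) {ι : Type v} (G : ι → C) :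
    Weight V (FullOn G)ᵒᵖ :=
  (opFunctor (fullOnInclusion G)).comp V (homWeight (coneAction S) W)

lemma opAct_familyConeWeight {ι : Type v} (G : ι → C) (i j : ι) :
    opAct (D := FullOn G) (familyConeWeight W S G) i j = coneRestrict W S (G i) (G j) := by
  refine (act_functorComp (opFunctor (fullOnInclusion G)) (homWeight (coneAction S) W) _ _).trans ?_
  refine (congrArg (· ≫ _) (MonoidalCategory.whiskerLeft_id _ _)).trans ?_
  exact Category.id_comp _

end ConeWeight

/-! ### Idempotents -/

section Idempotent

/-- The shape of an idempotent. -/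
inductive IdempotentShape : Type v
  | star : IdempotentShape

instance : SmallCategory IdempotentShape.{v} where
  Hom _ _ := ULift Bool
  id _ := ⟨true⟩
  comp f g := ⟨f.down && g.down⟩
  id_comp f := by simp
  comp_id f := by simp
  assoc f g h := by simp [Bool.and_assoc]

/-- The nontrivial endomorphism in the shape of an idempotent. -/
def IdempotentShape.e : IdempotentShape.star.{v} ⟶ IdempotentShape.star := ULift.up false

lemma IdempotentShape.comp_e (f : IdempotentShape.star.{v} ⟶ IdempotentShape.star) :
    f ≫ e = e := ULift.ext _ _ (Bool.and_false _)

/-- The endomorphism `e` absorbs every morphism, so the family constantly equal to `e` is a cocone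
on any diagram whatsoever. -/
lemma isCardinalFiltered_idempotentShape (κ : Cardinal.{v}) [Fact κ.IsRegular] :
    IsCardinalFiltered IdempotentShape.{v} κ where
  nonempty_cocone F _ := ⟨Cocone.mk IdempotentShape.star
    { app _ := IdempotentShape.e
      naturality _ _ f := (IdempotentShape.comp_e (F.map f)).trans (Category.comp_id _).symm }⟩

variable {C : Type w} [Category.{v} C]

/-- The diagram given by an idempotent. -/
def idempotentDiagram {c : C} (e : c ⟶ c) (he : e ≫ e = e) : IdempotentShape.{v} ⥤ C where
  obj _ := c
  map f := if f.down then 𝟙 c else e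
  map_id _ := rfl
  map_comp := by
    rintro _ _ _ ⟨_ | _⟩ ⟨_ | _⟩
    · exact he.symm
    · exact (Category.comp_id _).symm
    · exact (Category.id_comp _).symm
    · exact (Category.id_comp _).symm

/-- The colimit of an idempotent, regarded as a filtered diagram, is its splitting. -/
lemma exists_idempotent_splitting (κ : Cardinal.{v}) [Fact κ.IsRegular]
    [HasCardinalFilteredColimits C κ] {c : C} (e : c ⟶ c) (he : e ≫ e = e) :
    ∃ (L : C) (r : c ⟶ L) (m : L ⟶ c), r ≫ m = e ∧ m ≫ r = 𝟙 L := by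
  have := isCardinalFiltered_idempotentShape κ
  have := HasCardinalFilteredColimits.hasColimitsOfShape C κ IdempotentShape.{v}
  let P := idempotentDiagram e he
  let r : c ⟶ colimit P := colimit.ι P IdempotentShape.star
  have hr : e ≫ r = r := colimit.w P IdempotentShape.e
  let m : colimit P ⟶ c := colimit.desc P (Cocone.mk c
    { app _ := e
      naturality := by
        rintro _ _ ⟨_ | _⟩
        · exact he.trans (Category.comp_id _).symm
        · exact (Category.id_comp _).trans (Category.comp_id _).symm })
  have hm : r ≫ m = e := colimit.ι_desc _ _
  refine ⟨_, r, m, hm, colimit.hom_ext ?_⟩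
  rintro ⟨⟩
  change r ≫ m ≫ r = r ≫ 𝟙 _
  rw [reassoc_of% hm, hr, Category.comp_id]

end Idempotent

/-! ### Limits from weak colimits -/

section Generators

variable {V : Type u} [Category.{v} V] [MonoidalCategory V]
  {C : Type w} [Category.{v} C] [EnrichedOrdinaryCategory V C]

lemma eHomEquiv_whiskerLeft {X Y Z : C} (f : X ⟶ Y) (g : Y ⟶ Z) :
    eHomEquiv V f ≫ eHomWhiskerLeft V X g = eHomEquiv V (f ≫ g) := by
  rw [eHomEquiv_comp, eHomWhiskerLeft, rightUnitor_inv_naturality_assoc,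
    MonoidalCategory.tensorHom_def, unitors_inv_equal, Category.assoc]

lemma eHomEquiv_whiskerRight {X Y Z : C} (f : X ⟶ Y) (g : Y ⟶ Z) :
    eHomEquiv V g ≫ eHomWhiskerRight V f Z = eHomEquiv V (f ≫ g) := by
  rw [eHomEquiv_comp, eHomWhiskerRight, leftUnitor_inv_naturality_assoc,
    MonoidalCategory.tensorHom_def', Category.assoc]

variable {ι : Type v} {G : ι → C} {H : Type v} [SmallCategory H] {F : H ⥤ C} {c : C}
  {t : F ⟶ (Functor.const H).obj c}

lemma hom_eq_of_whiskerLeft_eq (hF : ∀ h, F.obj h ∈ Set.range G)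
    (ht : IsColimit (Cocone.mk c t)) {X : C} {a b : c ⟶ X}
    (h : ∀ i, eHomWhiskerLeft V (G i) a = eHomWhiskerLeft V (G i) b) : a = b := by
  have h' (Y : C) (hY : Y ∈ Set.range G) : eHomWhiskerLeft V Y a = eHomWhiskerLeft V Y b := by
    obtain ⟨i, rfl⟩ := hY
    exact h i
  refine ht.hom_ext fun k => (eHomEquiv V).injective ?_
  rw [← eHomEquiv_whiskerLeft, ← eHomEquiv_whiskerLeft]
  exact congrArg _ (h' _ (hF k))

/-- Full faithfulness on the generators. The natural family `E` sends the legs of the colimit `c` to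
another cocone, which defines `e`. That `e` induces `E i` on `C(G i, c)` is tested on the stages
`C(G i, F h)`, whose colimit this is by presentability of `G i`. -/
lemma exists_endo_whiskerLeft_eq (hF : ∀ h, F.obj h ∈ Set.range G)
    [MonoidalClosed V] {κ : Cardinal.{v}} [Fact κ.IsRegular]
    [IsCardinalFiltered H κ] (hG : ∀ i, IsEnrichedPresentable V κ (G i))
    (ht : IsConicalColimit V (Cocone.mk c t))
    (E : ∀ i, (EnrichedCategory.Hom (G i) c : V) ⟶ (EnrichedCategory.Hom (G i) c : V))
    (hE : ∀ i j, eComp V (G i) (G j) c ≫ E i = _ ◁ E j ≫ eComp V (G i) (G j) c) :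
    ∃ e : c ⟶ c, ∀ i, eHomWhiskerLeft V (G i) e = E i := by
  -- The stages are only propositionally equal to generators, so each object is bundled with its
  -- endomorphism; membership in the range of `g` then replaces transport along equalities.
  let Φ := Σ X : C, (EnrichedCategory.Hom X c : V) ⟶ (EnrichedCategory.Hom X c : V)
  let g (i : ι) : Φ := ⟨G i, E i⟩
  have hg (p q : Φ) (hp : p ∈ Set.range g) (hq : q ∈ Set.range g) :
      eComp V p.1 q.1 c ≫ p.2 = _ ◁ q.2 ≫ eComp V p.1 q.1 c := by
    obtain ⟨i, rfl⟩ := hp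
    obtain ⟨j, rfl⟩ := hq
    exact hE i j
  have hE' (X : C) (hX : X ∈ Set.range G) : ∃ e, (⟨X, e⟩ : Φ) ∈ Set.range g := by
    obtain ⟨i, rfl⟩ := hX
    exact ⟨E i, i, rfl⟩
  choose E' hE' using fun h => hE' _ (hF h)
  obtain ⟨ht₁⟩ := ht.isColimit
  let τ (h : H) : F.obj h ⟶ c := t.app h
  let a (h : H) : F.obj h ⟶ c := (eHomEquiv V).symm (eHomEquiv V (τ h) ≫ E' h)
  have ha (h : H) : eHomEquiv V (a h) = eHomEquiv V (τ h) ≫ E' h :=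
    (eHomEquiv V).apply_symm_apply _
  have hna {h h' : H} (f : h ⟶ h') : F.map f ≫ a h' = a h := by
    have h₁ : eHomWhiskerRight V (F.map f) c ≫ E' h = E' h' ≫ eHomWhiskerRight V (F.map f) c := by
      rw [eHomWhiskerRight, Category.assoc, Category.assoc, hg _ _ (hE' h) (hE' h'),
        leftUnitor_inv_naturality_assoc, whisker_exchange_assoc]
    have h₂ : F.map f ≫ τ h' = τ h := (Cocone.mk c t).w f
    apply (eHomEquiv V).injective
    rw [← eHomEquiv_whiskerRight, ha, ha, Category.assoc, ← h₁, ← Category.assoc,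
      eHomEquiv_whiskerRight, h₂]
  let e : c ⟶ c := ht₁.desc (Cocone.mk c
    { app := a
      naturality h h' f := by
        refine Eq.trans ?_ (Category.comp_id _).symm
        exact hna f })
  have he (h : H) : τ h ≫ e = a h := ht₁.fac _ h
  refine ⟨e, fun i => (hG i H F _ ht).isColimit.some.hom_ext fun h => ?_⟩
  change eHomWhiskerLeft V (G i) (τ h) ≫ eHomWhiskerLeft V (G i) e =
    eHomWhiskerLeft V (G i) (τ h) ≫ E i
  rw [← eHomWhiskerLeft_comp, he, eHomWhiskerLeft, ha, MonoidalCategory.whiskerLeft_comp,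
    Category.assoc, ← hg ⟨_, E i⟩ _ ⟨i, rfl⟩ (hE' h), eHomWhiskerLeft]
  simp only [Category.assoc]

variable [SymmetricCategory V] [MonoidalClosed V] [HasLimits V] {D : Type v} [EnrichedCategory V D]
  {W : Weight V D} {S : EnrichedFunctor V D C} {L : C}

variable (W S) in
/-- The restriction `[D, V](W, C(X, S-)) ⟶ [D, V](W, C(X', S-))` along a morphism. -/
def coneRestrictHom {X X' : C} (f : X' ⟶ X) :
    natObj W (S.comp V (corep X)) ⟶ natObj W (S.comp V (corep X')) :=
  (ρ_ _).inv ≫ _ ◁ eHomEquiv V f ≫ coneRestrict W S X X'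

lemma coneRestrictHom_eval {X X' : C} (f : X' ⟶ X) (d : D) :
    coneRestrictHom W S f ▷ W.obj d ≫ coneEval W S X' d =
      coneEval W S X d ≫ eHomWhiskerRight V f (S.obj d) := by
  simp only [coneRestrictHom, comp_whiskerRight, Category.assoc]
  rw [coneRestrict_eval, reassoc_of% swapRight_naturality_middle, whisker_exchange_assoc,
    BraidedCategory.braiding_naturality_right_assoc, eHomWhiskerRight]
  simp [swapRight]

lemma coneRestrictHom_comp {X X' X'' : C} (f : X' ⟶ X) (g : X'' ⟶ X') :
    coneRestrictHom W S (g ≫ f) = coneRestrictHom W S f ≫ coneRestrictHom W S g := by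
  refine coneEval_ext fun d => ?_
  rw [comp_whiskerRight, Category.assoc, coneRestrictHom_eval, coneRestrictHom_eval,
    ← Category.assoc, coneRestrictHom_eval, Category.assoc, eHomWhiskerRight_comp]

lemma comparison_coneRestrictHom (ζ : VNatTrans W (S.comp V (corep L))) {X X' : C} (f : X' ⟶ X) :
    comparison ζ X ≫ coneRestrictHom W S f = eHomWhiskerRight V f L ≫ comparison ζ X' := by
  rw [coneRestrictHom, rightUnitor_inv_naturality_assoc, ← whisker_exchange_assoc,
    comparison_coneRestrict, BraidedCategory.braiding_naturality_right_assoc, eHomWhiskerRight]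
  simp

/-- Both `C(X, L)` and `[D, V](W, C(X, S-))` are determined by restriction to the stages of the
colimit `X`, as `C(-, L)` and every `C(-, S d)` send it to a limit; so invertibility passes from the
stages to `X`. -/
lemma isIso_comparison_of_isConicalColimit (ζ : VNatTrans W (S.comp V (corep L))) {X : C}
    {t : F ⟶ (Functor.const H).obj X} (ht : IsConicalColimit V (Cocone.mk X t))
    (hF : ∀ h, IsIso (comparison ζ (F.obj h))) : IsIso (comparison ζ X) := by
  have hw {h h' : H} (f : h ⟶ h') : F.map f ≫ t.app h' = t.app h := (Cocone.mk X t).w f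
  have hext (Y : C) {T : V} (a b : T ⟶ (EnrichedCategory.Hom X Y : V))
      (hab : ∀ h, a ≫ eHomWhiskerRight V (t.app h) Y = b ≫ eHomWhiskerRight V (t.app h) Y) :
      a = b := (ht.isLimit Y).some.hom_ext fun h => hab h.unop
  obtain ⟨k, hk⟩ : ∃ k : natObj W (S.comp V (corep X)) ⟶ (EnrichedCategory.Hom X L : V),
      ∀ h, k ≫ eHomWhiskerRight V (t.app h) L =
        coneRestrictHom W S (t.app h) ≫ inv (comparison ζ (F.obj h)) := by
    let q (h : H) : natObj W (S.comp V (corep X)) ⟶ (EnrichedCategory.Hom (F.obj h) L : V) :=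
      coneRestrictHom W S (t.app h) ≫ inv (comparison ζ (F.obj h))
    refine ⟨(ht.isLimit L).some.lift (Cone.mk _
      { app h := q h.unop
        naturality h h' f := ?_ }), fun h => (ht.isLimit L).some.fac _ (op h)⟩
    refine (Category.id_comp _).trans ?_
    change q h'.unop = q h.unop ≫ eHomWhiskerRight V (F.map f.unop) L
    dsimp only [q]
    rw [← hw f.unop, coneRestrictHom_comp, Category.assoc, Category.assoc]
    congr 1
    rw [IsIso.comp_inv_eq, Category.assoc, ← comparison_coneRestrictHom,
      IsIso.inv_hom_id_assoc]
  refine ⟨k, hext L _ _ fun h => ?_, coneEval_ext fun d => hext (S.obj d) _ _ fun h => ?_⟩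
  · rw [Category.assoc, hk, ← Category.assoc, comparison_coneRestrictHom, Category.assoc,
      IsIso.hom_inv_id, Category.id_comp, Category.comp_id]
  · rw [Category.assoc, Category.assoc, ← coneRestrictHom_eval, ← comp_whiskerRight_assoc,
      ← comp_whiskerRight_assoc, Category.assoc, comparison_coneRestrictHom, ← Category.assoc, hk,
      Category.assoc, IsIso.inv_hom_id, Category.id_comp, Category.comp_id]

/-- Take `c` to be the weak colimit of the generators weighted by the presheaf `i ↦ [D, V](W, C(G i,
S-))` that the limit should represent. Its coprojections are the sections `s i`, and the cone on `c`
is obtained by lifting the evaluation maps. -/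
lemma exists_family_section [ModelCategory V] (hC : HasEWeakColimits V C) (hW : IsEStable W)
    (S : EnrichedFunctor V D C) (G : ι → C) :
    ∃ (c : C) (ζ : VNatTrans W (S.comp V (corep c)))
      (s : ∀ i, natObj W (S.comp V (corep (G i))) ⟶ (EnrichedCategory.Hom (G i) c : V)),
      (∀ i j, coneRestrict W S (G i) (G j) ≫ s j =
        s i ▷ _ ≫ (β_ _ _).hom ≫ eComp V (G j) (G i) c) ∧
      ∀ i, s i ≫ comparison ζ (G i) = 𝟙 _ := by
  obtain ⟨c, η, hη⟩ := hC (FullOn G) (familyConeWeight W S G) (fullOnInclusion G)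
  have hid (X Y : V) {Z : V} (f : X ⊗ Y ⟶ Z) : X ◁ 𝟙 Y ≫ f = f := by simp
  obtain ⟨ζ, hζ⟩ := exists_cone_of_weakColimit hW (S := S) η hη
    (fun (i : ι) d => coneEval W S (G i) d)
    (fun (i j : ι) d => by
      have h := coneRestrict_eval W S (G i) (G j) d
      rw [← opAct_familyConeWeight] at h
      refine h.trans ?_
      exact congrArg (fun z => swapRight _ _ _ ≫ coneEval W S (G i) d ▷ _ ≫ z)
        (hid _ _ _).symm)
    (fun (i : ι) d d' => coneEval_act W S (G i) d d')
  have hsec (i : ι) (s : natObj W (S.comp V (corep (G i))) ⟶ (EnrichedCategory.Hom (G i) c : V))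
      (hs : ∀ d, s ▷ W.obj d ≫ _ ◁ coneHom ζ d ≫ eComp V (G i) c (S.obj d) =
        coneEval W S (G i) d) : s ≫ comparison ζ (G i) = 𝟙 _ := by
    refine coneEval_ext fun d => ?_
    rw [comp_whiskerRight, Category.assoc, comparison_eval, id_whiskerRight, Category.id_comp, hs]
  refine ⟨c, ζ, fun i => coconeHom η i, fun i j => ?_, fun i => ?_⟩
  · have h := opAct_coconeHom η i j
    rw [opAct_familyConeWeight] at h
    refine h.trans ?_
    exact congrArg (fun z => coconeHom η i ▷ _ ≫ z) (hid _ _ _)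
  · exact hsec i (coconeHom η i) (hζ i)

lemma exists_restricted_cone {c : C} (ζ : VNatTrans W (S.comp V (corep c))) (m : L ⟶ c) :
    ∃ ζ' : VNatTrans W (S.comp V (corep L)), ∀ X,
      comparison ζ' X = eHomWhiskerLeft V X m ≫ comparison ζ X := by
  obtain ⟨ζ', hζ'⟩ := exists_conePoint_eq (eHomEquiv V m ≫ comparison ζ L)
  refine ⟨ζ', fun X => coneEval_ext fun d => ?_⟩
  rw [comparison_eval, ← coneHom_precomp ζ' ζ hζ'.symm d, comp_whiskerRight, Category.assoc,
    comparison_eval, precomp_eHomEquiv, MonoidalCategory.whiskerLeft_comp, Category.assoc,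
    ← eHomWhiskerLeft_eComp, whisker_exchange_assoc]

theorem hasEStableLimits_of_hasEWeakColimits [ModelCategory V] (hC : IsEnrichedAccessible V C)
    (hC' : HasEWeakColimits V C) : HasEStableLimits V C := by
  intro D _ W hW S
  obtain ⟨-, κ, -, _, -, -, hC⟩ := hC
  have := hC.hasCardinalFilteredColimits
  obtain ⟨ι, G, hG, hG'⟩ := hC.exists_generator
  obtain ⟨c, ζ, s, hs, hs'⟩ := exists_family_section hC' hW S G
  obtain ⟨H, _, _, F, t, hF, ht⟩ := hG' c
  -- The composites `comparison ≫ s` are natural in the generator and idempotent because `s` is a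
  -- section, so they come from an idempotent of `c`.
  obtain ⟨e, he⟩ := exists_endo_whiskerLeft_eq hF hG ht
    (fun i => comparison ζ (G i) ≫ s i) fun i j => by
      have h := hs j i
      rw [← cancel_epi (β_ _ _).hom, ← Category.assoc (eComp _ _ _ _), ← Category.assoc,
        ← comparison_coneRestrict, Category.assoc, h, ← comp_whiskerRight_assoc,
        BraidedCategory.braiding_naturality_left_assoc]
  have hee : e ≫ e = e := hom_eq_of_whiskerLeft_eq (V := V) hF ht.isColimit.some fun i => by
    rw [eHomWhiskerLeft_comp, he, Category.assoc, reassoc_of% hs' i]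
  obtain ⟨L, r, m, hrm, hmr⟩ := exists_idempotent_splitting κ e hee
  obtain ⟨ζ', hζ'⟩ := exists_restricted_cone ζ m
  -- Splitting `e` makes `C(G i, L)` a splitting of `comparison ≫ s`; since `[D, V](W, C(G i, S-))`
  -- splits it too, the comparison for `L` is invertible on generators.
  have hG₁ (i : ι) : IsIso (comparison ζ' (G i)) := by
    refine ⟨s i ≫ eHomWhiskerLeft V (G i) r, ?_, ?_⟩
    · rw [hζ', Category.assoc, ← Category.assoc (comparison ζ (G i)), ← he,
        ← eHomWhiskerLeft_comp, ← eHomWhiskerLeft_comp, ← hrm, Category.assoc, hmr,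
        Category.comp_id, hmr, eHomWhiskerLeft_id]
    · rw [hζ', Category.assoc, ← Category.assoc (eHomWhiskerLeft _ _ _), ← eHomWhiskerLeft_comp,
        hrm, he, Category.assoc, hs', Category.comp_id, hs']
  refine ⟨L, ζ', fun X => ?_⟩
  obtain ⟨H, _, _, F, t, hF, ht⟩ := hG' X
  refine isIso_comparison_of_isConicalColimit ζ' ht fun h => ?_
  obtain ⟨i, hi⟩ := hF h
  rw [← hi]
  exact hG₁ i

end Generators

end HEnriched

end

/-! ### The equivalence of the three conditions -/

theorem mainTheorem4
    (V : Type u) [Category.{v} V] [MonoidalCategory V] [SymmetricCategory V] [MonoidalClosed V]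
    [HasLimits V] [HasColimits V] [IsLocallyPresentable.{v} V]
    [ModelCategory V] [PushoutProductAxiom V] (hI : IsCofibrant (𝟙_ V))
    (hE : EnoughCofibrantlyWeightedLimitsEStable V)
    (C : Type w) [Category.{v} C] [EnrichedOrdinaryCategory V C]
    (hC : IsEnrichedAccessible V C) :
    List.TFAE [
      HasEStableLimits V C,
      HasPowers V C ∧ HasEnoughCofibrantlyWeightedLimits V C,
      HasEWeakColimits V C] := by
  -- The assumption `hE` enters only in this implication: it makes the required cofibrant weights
  -- `ℰ`-stable, so that `C` has the corresponding limits.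
  tfae_have 1 → 2 := fun h => ⟨hasPowers_of_hasEStableLimits h, fun D _ P => by
    obtain ⟨Q, hQ, hQ'⟩ := hE D P
    exact ⟨Q, hQ, h D Q hQ'⟩⟩
  tfae_have 2 → 3 := fun h => hasEWeakColimits_of_hasPowers hI hC h.1 h.2
  tfae_have 3 → 1 := hasEStableLimits_of_hasEWeakColimits hC
  tfae_finish
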